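/- All rings are finite commutative rings with identity. For a finite abelian group $G$ (written additively), an S-ring over $G$ is a subring $\mathcal A$ of $\mathbb Z G$ having a $\mathbb Z$-basis of the form $\sum_{x\in X}x$, $X\in\mathcal S(\mathcal A)$, where $\mathcal S(\mathcal A)$ is a partition of $G$ into nonempty sets (the basic sets) with $\{0\}\in\mathcal S(\mathcal A)$ and $-X\in\mathcal S(\mathcal A)$ for all $X\in\mathcal S(\mathcal A)$; its rank is $|\mathcal S(\mathcal A)|$. The tensor product of S-rings over $G_1$ and $G_2$ is the S-ring over $G_1\times G_2$ whose basic sets are the products $X_1\times X_2$ of basic sets of the factors. An S-ring over a ring $R$ is an S-ring $\mathcal A$ over the additive group $R^+$ such that $uX\in\mathcal S(\mathcal A)$ for all $X\in\mathcal S(\mathcal A)$ and $u\in R^\times$. An $\mathcal A$-ideal is an ideal of $R$ that is a union of basic sets; a maximal $\mathcal A$-ideal is a maximal element of the set of $\mathcal A$-ideals different from $R$. For an $\mathcal A$-ideal $I$, $\mathcal A_I$ is the S-ring over $I^+$ whose basic sets are those of $\mathcal A$ contained in $I$. For $X\subset R$ let $I_L(X)$ be the largest ideal $I$ of $R$ with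 $X+I=X$. One says that $\mathcal A$ satisfies the $I/J$-condition if $I,J$ are $\mathcal A$-ideals and $J\subset I_L(X)\cap I$ for every basic set $X\subset R\setminus I$; $\mathcal A$ is a non-trivial generalized wreath product if it satisfies the $I/J$-condition for some $I\ne R$ and $J\neq0$. Write $\mathcal P(R)$ for the set of primes dividing $|R|$, $R_p$ for the $p$-component of $R$ (the Sylow $p$-subgroup of $R^+$, which is a ring), and $R_Q=\prod_{p\in Q}R_p$ for $Q\subset\mathcal P(R)$; the group $R_Q^\times$ acts on $R=R_Q\times R_{\mathcal P(R)\setminus Q}$ by multiplication in the first factor, and $X\subset R$ is $Q$-rational if $R_Q^\times X=X$. A Galois ring is a local ring $S$ whose radical is $pS$ for a prime $p$; $R$ is a CG-ring if $R_p$ is a Galois ring for every $p\in\mathcal P(R)$. **Theorem.** Let $\mathcal A$ be an S-ring over a CG-ring $R$. 1. Let $I$ be a maximal $\mathcal A$-ideal such that $R/I$ is not a field, and let $Q=\mathcal P(R/I)$. Then every basic set of $\mathcal A$ contained in $R\setminus I$ is $Q$-rational. 2. Let $I$ and $Q$ be as in (1), let $I^\star$ be the intersection of all $\mathcal A$-ideals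 containing $R_Q$, and let $J=I\cap I^\star$. Then $\mathcal A$ satisfies the $I/J$-condition. Moreover, if $J=0$, then $R=I\oplus I^\star$ and $\mathcal A=\mathcal A_I\otimes\mathcal A_{I^\star}$. 3. Suppose that the set of maximal $\mathcal A$-ideals differs from the set of maximal ideals of $R$. Then $\mathcal A$ is a non-trivial generalized wreath product, or $R\cong R_1\times R_2$ (as rings) and under this isomorphism $\mathcal A$ is the tensor product of an S-ring over $R_1$ and an S-ring of rank $2$ over $R_2$, where $R_2$ is not a field. (Here $R_1$ may be the zero ring.) -/

import Mathlib

open scoped Pointwise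

universe u

noncomputable section

/-! ### Schur rings over finite abelian groups (written additively) -/

/-- The element `ξ(X) = ∑_{x ∈ X} x` of the integral group ring `ℤ G`. -/
def groupRingSum {G : Type*} [Finite G] (X : Set G) : AddMonoidAlgebra ℤ G :=
  ∑ x ∈ X.toFinite.toFinset, AddMonoidAlgebra.single x (1 : ℤ)

theorem coeff_groupRingSum {G : Type*} [Finite G] (X : Set G) (g : G) [Decidable (g ∈ X)] :
    (groupRingSum X).coeff g = if g ∈ X then 1 else 0 := by
  classical
  unfold groupRingSum
  rw [← AddMonoidAlgebra.coeffAddEquiv_apply, map_sum, Finsupp.finsetSum_apply]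
  simp [Finsupp.single_apply]

/-- An element of `ℤ G` lies in the span of the `ξ(X)`, `X` running over the classes of a
partition, iff its coefficients are constant on the classes. -/
theorem mem_span_groupRingSum_iff {G : Type*} [Finite G] {S : Set (Set G)}
    (hS : Setoid.IsPartition S) (f : AddMonoidAlgebra ℤ G) :
    f ∈ Submodule.span ℤ (groupRingSum '' S) ↔
      ∀ X ∈ S, ∀ x ∈ X, ∀ y ∈ X, f.coeff x = f.coeff y := by
  classical
  constructor
  · intro hf
    induction hf using Submodule.span_induction with
    | mem f hf =>
      obtain ⟨Y, hY, rfl⟩ := hf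
      intro X hX x hx y hy
      rw [coeff_groupRingSum, coeff_groupRingSum]
      have key : ∀ z ∈ X, z ∈ Y → X = Y := fun z hz hz' =>
        (hS.2 z).unique ⟨hX, hz⟩ ⟨hY, hz'⟩
      by_cases h1 : x ∈ Y
      · have := key x hx h1
        subst this
        simp [hx, hy]
      · have h2 : y ∉ Y := fun h => h1 (key y hy h ▸ hx)
        simp [h1, h2]
    | zero => simp
    | add f g _ _ hf hg =>
      intro X hX x hx y hy
      simp [hf X hX x hx y hy, hg X hX x hx y hy]
    | smul a f _ hf =>
      intro X hX x hx y hy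
      simp [hf X hX x hx y hy]
  · intro hf
    have hne : ∀ X : S, (X : Set G).Nonempty := fun X =>
      Set.nonempty_iff_ne_empty.2 fun h => hS.1 (h ▸ X.2)
    have : Fintype S := Fintype.ofFinite S
    have key : f = ∑ X : S, f.coeff (hne X).some • groupRingSum (X : Set G) := by
      apply AddMonoidAlgebra.coeff_injective
      ext g
      rw [← AddMonoidAlgebra.coeffAddEquiv_apply (_ : AddMonoidAlgebra ℤ G),
        ← AddMonoidAlgebra.coeffAddEquiv_apply (∑ X : S, _), map_sum, Finsupp.finsetSum_apply]
      obtain ⟨X, ⟨hX, hg⟩, huniq⟩ := hS.2 g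
      rw [Finset.sum_eq_single (⟨X, hX⟩ : S)]
      · simp [coeff_groupRingSum, hg]
        exact hf X hX g hg _ (hne ⟨X, hX⟩).some_mem
      · intro Y _ hY
        have : g ∉ (Y : Set G) := fun h => hY (Subtype.ext (huniq Y ⟨Y.2, h⟩))
        simp [coeff_groupRingSum, this]
      · simp
    rw [key]
    exact Submodule.sum_mem _ fun X _ => Submodule.smul_mem _ _
      (Submodule.subset_span ⟨X, X.2, rfl⟩)

/-- A Schur ring over the finite abelian group `G`: a subring of `ℤ G` spanned over `ℤ` by the
elements `ξ(X)` (which are then a `ℤ`-basis), where `X` runs over a partition of `G` into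
nonempty sets, the basic sets, which contains `{0}` and is closed under negation. -/
@[ext]
structure SchurRing (G : Type*) [AddCommGroup G] [Finite G] where
  /-- the underlying subring of the group ring -/
  toSubring : Subring (AddMonoidAlgebra ℤ G)
  /-- the family of basic sets -/
  basicSets : Set (Set G)
  isPartition : Setoid.IsPartition basicSets
  singleton_zero_mem : {0} ∈ basicSets
  neg_mem_basicSets : ∀ X ∈ basicSets, -X ∈ basicSets
  mem_iff_mem_span : ∀ f, f ∈ toSubring ↔ f ∈ Submodule.span ℤ (groupRingSum '' basicSets)

namespace SchurRing

variable {G G' G₁ G₂ : Type*} [AddCommGroup G] [Finite G] [AddCommGroup G'] [Finite G']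
  [AddCommGroup G₁] [Finite G₁] [AddCommGroup G₂] [Finite G₂]

/-- The rank of a Schur ring, i.e. its rank as a `ℤ`-module. -/
def rank (A : SchurRing G) : ℕ := Module.finrank ℤ A.toSubring

/-- `Y` is an `A`-set: a union of basic sets. -/
def IsASet (A : SchurRing G) (Y : Set G) : Prop := ∃ F ⊆ A.basicSets, Y = ⋃₀ F

theorem isASet_iff (A : SchurRing G) (Y : Set G) :
    A.IsASet Y ↔ ∀ X ∈ A.basicSets, ∀ x ∈ X, x ∈ Y → X ⊆ Y := by
  constructor
  · rintro ⟨F, hF, rfl⟩ X hX x hx ⟨Z, hZ, hxZ⟩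
    have : X = Z := (A.isPartition.2 x).unique ⟨hX, hx⟩ ⟨hF hZ, hxZ⟩
    exact this ▸ Set.subset_sUnion_of_mem hZ
  · intro h
    refine ⟨{X ∈ A.basicSets | X ⊆ Y}, fun X hX => hX.1, ?_⟩
    ext y
    constructor
    · intro hy
      obtain ⟨X, ⟨hX, hyX⟩, -⟩ := A.isPartition.2 y
      exact ⟨X, ⟨hX, h X hX y hyX hy⟩, hyX⟩
    · rintro ⟨X, hX, hy⟩
      exact hX.2 hy

theorem comap_isPartition (A : SchurRing G) (i : G' →+ G) (hi : Function.Injective i)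
    (hr : A.IsASet (Set.range i)) : Setoid.IsPartition {X : Set G' | i '' X ∈ A.basicSets} := by
  constructor
  · intro h
    rw [Set.mem_ofPred_eq, Set.image_empty] at h
    exact A.isPartition.1 h
  · intro g
    obtain ⟨X, ⟨hX, hg⟩, huniq⟩ := A.isPartition.2 (i g)
    have hsub := (isASet_iff A _).1 hr X hX _ hg ⟨g, rfl⟩
    refine ⟨i ⁻¹' X, ⟨?_, hg⟩, ?_⟩
    · rwa [Set.mem_ofPred_eq, Set.image_preimage_eq_of_subset hsub]
    · rintro Y ⟨hY, hgY⟩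
      rw [← huniq _ ⟨hY, g, hgY, rfl⟩, Set.preimage_image_eq _ hi]

/-- Pull-back of a Schur ring along an injective homomorphism whose image is an `A`-subgroup. -/
def comap (A : SchurRing G) (i : G' →+ G) (hi : Function.Injective i)
    (hr : A.IsASet (Set.range i)) : SchurRing G' where
  toSubring := A.toSubring.comap (AddMonoidAlgebra.mapDomainRingHom ℤ i)
  basicSets := {X | i '' X ∈ A.basicSets}
  isPartition := comap_isPartition A i hi hr
  singleton_zero_mem := by simpa using A.singleton_zero_mem
  neg_mem_basicSets := fun X hX => by
    have := A.neg_mem_basicSets _ hX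
    rwa [← Set.image_neg_of_apply_neg_eq_neg (fun x _ => map_neg i x)] at this
  mem_iff_mem_span := fun f => by
    rw [Subring.mem_comap, A.mem_iff_mem_span, mem_span_groupRingSum_iff A.isPartition,
      mem_span_groupRingSum_iff (comap_isPartition A i hi hr)]
    have hc : ∀ x, (AddMonoidAlgebra.mapDomainRingHom ℤ i f).coeff (i x) = f.coeff x := fun x => by
      simpa using Finsupp.mapDomain_apply hi f.coeff x
    constructor
    · intro h X hX x hx y hy
      rw [← hc x, ← hc y]
      exact h _ hX _ ⟨x, hx, rfl⟩ _ ⟨y, hy, rfl⟩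
    · intro h X hX x hx y hy
      by_cases hxr : x ∈ Set.range i
      · have hsub := (isASet_iff A _).1 hr X hX x hx hxr
        obtain ⟨x', rfl⟩ := hxr
        obtain ⟨y', rfl⟩ := hsub hy
        rw [hc, hc]
        refine h (i ⁻¹' X) ?_ _ hx _ hy
        rwa [Set.mem_ofPred_eq, Set.image_preimage_eq_of_subset hsub]
      · have hyr : y ∉ Set.range i := fun hyr =>
          hxr ((isASet_iff A _).1 hr X hX y hy hyr hx)
        have h0 : ∀ z, z ∉ Set.range i →
            (AddMonoidAlgebra.mapDomainRingHom ℤ i f).coeff z = 0 := fun z hz => by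
          simpa using Finsupp.mapDomain_of_notMem_range f.coeff z hz
        rw [h0 x hxr, h0 y hyr]

/-- The Schur ring over `G'` obtained from one over `G` by transport along an isomorphism. -/
def map (A : SchurRing G) (e : G ≃+ G') : SchurRing G' :=
  A.comap (e.symm : G' →+ G) e.symm.injective
    ((isASet_iff A _).2 fun _ _ _ _ _ y _ => e.symm.surjective y)

/-- The Schur ring `A_H` over an `A`-subgroup `H`; its basic sets are those of `A` inside `H`. -/
def restrict (A : SchurRing G) (H : AddSubgroup G) (hH : A.IsASet (H : Set G)) : SchurRing H :=
  A.comap H.subtype H.subtype_injective (by simpa using hH)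

theorem tensor_isPartition (A₁ : SchurRing G₁) (A₂ : SchurRing G₂) :
    Setoid.IsPartition (Set.image2 (fun X₁ X₂ => X₁ ×ˢ X₂) A₁.basicSets A₂.basicSets) := by
  constructor
  · rintro ⟨X₁, h₁, X₂, h₂, h⟩
    rcases Set.prod_eq_empty_iff.1 h with rfl | rfl
    · exact A₁.isPartition.1 h₁
    · exact A₂.isPartition.1 h₂
  · rintro ⟨g₁, g₂⟩
    obtain ⟨X₁, ⟨h₁, m₁⟩, u₁⟩ := A₁.isPartition.2 g₁
    obtain ⟨X₂, ⟨h₂, m₂⟩, u₂⟩ := A₂.isPartition.2 g₂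
    refine ⟨X₁ ×ˢ X₂, ⟨⟨X₁, h₁, X₂, h₂, rfl⟩, m₁, m₂⟩, ?_⟩
    rintro _ ⟨⟨Y₁, k₁, Y₂, k₂, rfl⟩, n₁, n₂⟩
    rw [u₁ Y₁ ⟨k₁, n₁⟩, u₂ Y₂ ⟨k₂, n₂⟩]

theorem groupRingSum_prod (X₁ : Set G₁) (X₂ : Set G₂) :
    groupRingSum (X₁ ×ˢ X₂) =
      AddMonoidAlgebra.mapDomainRingHom ℤ (AddMonoidHom.inl G₁ G₂) (groupRingSum X₁) *
      AddMonoidAlgebra.mapDomainRingHom ℤ (AddMonoidHom.inr G₁ G₂) (groupRingSum X₂) := by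
  classical
  have : (X₁ ×ˢ X₂).toFinite.toFinset = X₁.toFinite.toFinset ×ˢ X₂.toFinite.toFinset := by
    ext; simp
  unfold groupRingSum
  rw [this, map_sum, map_sum, Finset.sum_mul_sum, Finset.sum_product]
  simp [AddMonoidAlgebra.single_mul_single]

theorem mul_mem_span_tensor (A₁ : SchurRing G₁) (A₂ : SchurRing G₂) (f₁ : AddMonoidAlgebra ℤ G₁)
    (h₁ : f₁ ∈ A₁.toSubring) (f₂ : AddMonoidAlgebra ℤ G₂) (h₂ : f₂ ∈ A₂.toSubring) :
    AddMonoidAlgebra.mapDomainRingHom ℤ (AddMonoidHom.inl G₁ G₂) f₁ *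
      AddMonoidAlgebra.mapDomainRingHom ℤ (AddMonoidHom.inr G₁ G₂) f₂ ∈
      Submodule.span ℤ (groupRingSum ''
        Set.image2 (fun X₁ X₂ => X₁ ×ˢ X₂) A₁.basicSets A₂.basicSets) := by
  rw [mem_iff_mem_span] at h₁ h₂
  induction h₁ using Submodule.span_induction with
  | mem f hf =>
    obtain ⟨X₁, hX₁, rfl⟩ := hf
    induction h₂ using Submodule.span_induction with
    | mem g hg =>
      obtain ⟨X₂, hX₂, rfl⟩ := hg
      rw [← groupRingSum_prod]
      exact Submodule.subset_span ⟨_, ⟨X₁, hX₁, X₂, hX₂, rfl⟩, rfl⟩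
    | zero => simp
    | add f g _ _ hf hg => rw [map_add, mul_add]; exact add_mem hf hg
    | smul a f _ hf => rw [map_zsmul, mul_smul_comm]; exact Submodule.smul_mem _ _ hf
  | zero => simp
  | add f g _ _ hf hg => rw [map_add, add_mul]; exact add_mem hf hg
  | smul a f _ hf => rw [map_zsmul, smul_mul_assoc]; exact Submodule.smul_mem _ _ hf

/-- The tensor product `A₁ ⊗ A₂`, a Schur ring over `G₁ × G₂` whose basic sets are the products
of basic sets of the factors. -/
def tensor (A₁ : SchurRing G₁) (A₂ : SchurRing G₂) : SchurRing (G₁ × G₂) where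
  toSubring :=
    { carrier := Submodule.span ℤ (groupRingSum ''
        Set.image2 (fun X₁ X₂ => X₁ ×ˢ X₂) A₁.basicSets A₂.basicSets)
      zero_mem' := zero_mem _
      add_mem' := fun h k => add_mem h k
      neg_mem' := fun h => neg_mem h
      one_mem' := by
        have := mul_mem_span_tensor A₁ A₂ 1 (one_mem _) 1 (one_mem _)
        rwa [map_one, map_one, one_mul] at this
      mul_mem' := by
        intro f g hf hg
        rw [SetLike.mem_coe] at hf hg ⊢
        induction hf using Submodule.span_induction with
        | mem f hf =>
          obtain ⟨_, ⟨X₁, hX₁, X₂, hX₂, rfl⟩, rfl⟩ := hf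
          induction hg using Submodule.span_induction with
          | mem g hg =>
            obtain ⟨_, ⟨Y₁, hY₁, Y₂, hY₂, rfl⟩, rfl⟩ := hg
            dsimp only
            rw [groupRingSum_prod, groupRingSum_prod, mul_mul_mul_comm, ← map_mul, ← map_mul]
            have m₁ : ∀ X ∈ A₁.basicSets, groupRingSum X ∈ A₁.toSubring := fun X hX =>
              (A₁.mem_iff_mem_span _).2 (Submodule.subset_span ⟨X, hX, rfl⟩)
            have m₂ : ∀ X ∈ A₂.basicSets, groupRingSum X ∈ A₂.toSubring := fun X hX =>
              (A₂.mem_iff_mem_span _).2 (Submodule.subset_span ⟨X, hX, rfl⟩)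
            exact mul_mem_span_tensor A₁ A₂ _ (mul_mem (m₁ _ hX₁) (m₁ _ hY₁))
              _ (mul_mem (m₂ _ hX₂) (m₂ _ hY₂))
          | zero => simp
          | add f g _ _ hf hg => rw [mul_add]; exact add_mem hf hg
          | smul a f _ hf => rw [mul_smul_comm]; exact Submodule.smul_mem _ _ hf
        | zero => simp
        | add f g _ _ hf hg => rw [add_mul]; exact add_mem hf hg
        | smul a f _ hf => rw [smul_mul_assoc]; exact Submodule.smul_mem _ _ hf }
  basicSets := Set.image2 (fun X₁ X₂ => X₁ ×ˢ X₂) A₁.basicSets A₂.basicSets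
  isPartition := tensor_isPartition A₁ A₂
  singleton_zero_mem := ⟨{0}, A₁.singleton_zero_mem, {0}, A₂.singleton_zero_mem, by ext ⟨x, y⟩; simp [Prod.ext_iff]⟩
  neg_mem_basicSets := by
    rintro _ ⟨X₁, h₁, X₂, h₂, rfl⟩
    exact ⟨-X₁, A₁.neg_mem_basicSets _ h₁, -X₂, A₂.neg_mem_basicSets _ h₂, rfl⟩
  mem_iff_mem_span := fun _ => Iff.rfl

end SchurRing

/-! ### Componentwise Galois rings -/

/-- A finite commutative ring `S` is a Galois ring of characteristic a power of the prime `p`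
if it is local and its radical is `pS`. -/
def IsGaloisRing (p : ℕ) (S : Type*) [CommRing S] : Prop :=
  Finite S ∧ p.Prime ∧ IsLocalRing S ∧ Ring.jacobson S = Ideal.span {(p : S)}

/-- `R` is a CG-ring: for every prime `p` dividing `|R|`, the `p`-component of `R` is a Galois ring,
that is, `R` is the direct product, over these `p`, of Galois rings `S p` of characteristic a
power of `p`. -/
def IsCGRing (R : Type u) [CommRing R] : Prop :=
  ∃ (S : (Nat.card R).primeFactors → Type u) (_ : ∀ p, CommRing (S p)),
    (∀ p : (Nat.card R).primeFactors, IsGaloisRing (p : ℕ) (S p)) ∧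
      Nonempty (R ≃+* ∀ p : (Nat.card R).primeFactors, S p)

section Ring

variable (R : Type u) [CommRing R]

/-- The `p`-component `R_p` of `R`: the elements of additive order a power of `p`. -/
def pComponent (p : ℕ) : Ideal R where
  carrier := {x | ∃ k : ℕ, p ^ k • x = 0}
  zero_mem' := ⟨0, by simp⟩
  add_mem' := by
    rintro x y ⟨k, hk⟩ ⟨l, hl⟩
    refine ⟨k + l, ?_⟩
    rw [smul_add, pow_add, mul_smul, mul_smul, smul_comm (p ^ k) (p ^ l) x, hk, hl]
    simp
  smul_mem' := by
    rintro c x ⟨k, hk⟩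
    exact ⟨k, by rw [smul_comm, hk, smul_zero]⟩

/-- `R_Q`, the product (i.e. the direct sum inside `R`) of the `R_p` with `p ∈ Q`. -/
def component (Q : Finset ℕ) : Ideal R := ⨆ p ∈ Q, pComponent R p

/-- The group `R_Q^×`, acting on `R = R_Q × R_{Q'}` through the first factor: the units of `R` whose
`Q'`-projection is `1`. -/
def componentUnits (Q : Finset ℕ) : Set Rˣ := {u | (u : R) - 1 ∈ component R Q}

end Ring

/-! ### Schur rings over a ring -/

section SchurRingOverRing

variable {R : Type u} [CommRing R]

/-- `X` is `Q`-rational: `R_Q^× X = X`. -/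
def IsRationalSet (Q : Finset ℕ) (X : Set R) : Prop := componentUnits R Q • X = X

/-- `I_L(X)`: the largest ideal `I` such that `X + I = X`. -/
def lowerIdeal (X : Set R) : Ideal R := sSup {I | X + (I : Set R) = X}

theorem add_lowerIdeal (X : Set R) : X + (lowerIdeal X : Set R) = X := by
  refine Set.Subset.antisymm ?_ fun x hx => ⟨x, hx, 0, zero_mem _, add_zero x⟩
  rintro _ ⟨x, hx, r, hr, rfl⟩
  dsimp only
  change r ∈ sSup {I : Ideal R | X + (I : Set R) = X} at hr
  rw [sSup_eq_iSup'] at hr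
  induction hr using Submodule.iSup_induction' generalizing x with
  | mem I r hr => exact I.2.subset ⟨x, hx, r, hr, rfl⟩
  | zero => rwa [add_zero]
  | add r s _ _ hr hs => rw [← add_assoc]; exact hs _ (hr _ hx)

namespace SchurRing

variable [Finite R]

/-- A Schur ring over the group `R^+` is a Schur ring over the ring `R` if it is invariant under
multiplication by the units of `R`. -/
def IsOverRing (A : SchurRing R) : Prop := ∀ (v : Rˣ), ∀ X ∈ A.basicSets, v • X ∈ A.basicSets

/-- `I` is an `A`-ideal. -/
def IsAIdeal (A : SchurRing R) (I : Ideal R) : Prop := A.IsASet (I : Set R)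

theorem isAIdeal_sInf (A : SchurRing R) (F : Set (Ideal R)) (hF : ∀ I ∈ F, A.IsAIdeal I) :
    A.IsAIdeal (sInf F) := by
  refine (A.isASet_iff _).2 fun X hX x hx hxF y hy => ?_
  simp only [SetLike.mem_coe, Submodule.mem_sInf] at hxF ⊢
  exact fun I hI => (A.isASet_iff _).1 (hF I hI) X hX x hx (hxF I hI) hy

/-- The maximal `A`-ideals: the maximal elements among the proper `A`-ideals. -/
def maximalAIdeals (A : SchurRing R) : Set (Ideal R) :=
  {I | Maximal (fun I' => A.IsAIdeal I' ∧ I' ≠ ⊤) I}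

/-- The Schur ring `A_I` over the additive group of an `A`-ideal `I`. -/
def restrictIdeal (A : SchurRing R) (I : Ideal R) (hI : A.IsAIdeal I) : SchurRing I :=
  A.restrict I.toAddSubgroup hI

/-- `A` satisfies the `I/J`-condition, i.e. is a generalized wreath product with respect to the
`A`-ideals `I` and `J`. -/
def SatisfiesCondition (A : SchurRing R) (I J : Ideal R) : Prop :=
  A.IsAIdeal I ∧ A.IsAIdeal J ∧
    ∀ X ∈ A.basicSets, X ⊆ (I : Set R)ᶜ → J ≤ lowerIdeal X ⊓ I

/-- `A` is a non-trivial generalized wreath product. -/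
def IsNontrivialGenWreath (A : SchurRing R) : Prop :=
  ∃ I J : Ideal R, A.SatisfiesCondition I J ∧ I ≠ ⊤ ∧ J ≠ ⊥

/-- `R` is the direct sum of the `A`-ideals `I` and `J`, and `A = A_I ⊗ A_J`. -/
def IsInternalTensor (A : SchurRing R) (I J : Ideal R) : Prop :=
  ∃ (hI : A.IsAIdeal I) (hJ : A.IsAIdeal J) (h : IsCompl I J),
    ((A.restrictIdeal I hI).tensor (A.restrictIdeal J hJ)).map
      (Submodule.prodEquivOfIsCompl I J h).toAddEquiv = A

/-- `A` is, up to a ring isomorphism `R ≅ R₁ × R₂`, the tensor product of Schur rings over the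
rings `R₁` and `R₂`, the second of which has rank `2` while `R₂` is not a field.
(`R₁` may be the zero ring, in which case `A` itself has rank `2`.) -/
def HasRankTwoTensorFactor (A : SchurRing R) : Prop :=
  ∃ (R₁ R₂ : Type u) (_ : CommRing R₁) (_ : CommRing R₂) (_ : Finite R₁) (_ : Finite R₂)
    (e : R ≃+* R₁ × R₂) (A₁ : SchurRing R₁) (A₂ : SchurRing R₂),
    A₁.IsOverRing ∧ A₂.IsOverRing ∧ A.map e.toAddEquiv = A₁.tensor A₂ ∧
      A₂.rank = 2 ∧ ¬ IsField R₂

/-- The set `Q = P(R/I)` of primes dividing `|R/I|`. -/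
def quotientPrimes (I : Ideal R) : Finset ℕ := (Nat.card (R ⧸ I)).primeFactors

/-- `I^⋆`: the intersection of all `A`-ideals containing `R_Q`, where `Q = P(R/I)`. -/
def starIdeal (A : SchurRing R) (I : Ideal R) : Ideal R :=
  sInf {I' | A.IsAIdeal I' ∧ component R (quotientPrimes I) ≤ I'}

end SchurRing

end SchurRingOverRing

end

/-! Everything follows from one claim, `rel_of_sub_mem_starIdeal`: if I is a maximal A-ideal, R/I is
not a field and S = I^⋆, then any two elements outside I that are congruent modulo S lie in one
basic set. Rationality follows because u − 1 ∈ R_Q ⊆ S for u ∈ R_Q^×. The I/(I ∩ S)-condition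
follows because translation by I ∩ S keeps elements outside I. If I ∩ S = 0, then R = I ⊕ S and the
basic sets outside I are the sums X + (S \ {0}) with X basic in I, which is a tensor product with a
factor of rank 2.

The claim is proved by induction on |R| (`rel_of_sub_mem_aux`), using that S is the smallest A-ideal
not contained in I. A minimal A-ideal V inside I ∩ S is factored out (or V = S if I ∩ S = 0), and
elements outside I that are congruent modulo V must be shown to be related. V contains all elements
killed by some prime p. The main tool is Schur's theorem on p-th powers: an A-set that is stable
under the units of R_p but not under translation by elements killed by p produces an A-ideal without
p-part (`exists_isAIdeal_of_not_translate`). An A-ideal not contained in I contains S, hence has a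
p-part.

If p divides |R/I|, translation is possible at every x with px ∉ I. The exceptional elements form a
proper ideal, since p ∉ I when R/I is not a field. So fewer than half of the elements of a basic set
outside I are exceptional, and averaging over V shows that such a set fills more than half of each
coset of V that it meets (`rel_of_sub_mem_of_translate`). If p is invertible modulo I, the
V-invariance is first obtained for functions invariant under the principal units of R_p. These form
a p-group, of order prime to |R/I|, and Fourier analysis removes the invariance assumption
(`map_add_eq_of_group_invariant`, `rel_add_of_torsion`).

In the third part, if all R/I are fields, some maximal ideal rR is not an A-ideal, and
`rel_add_of_torsion` applied to a suitable I and r gives a generalized wreath product.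

Of the CG-property only `IsFieldModPrimes` is used: each R/pR is zero or a field. -/

noncomputable section

namespace SchurRing

/-! ### Basic sets as classes of an equivalence relation. -/

section Group

variable {G : Type*} [AddCommGroup G] [Finite G]

/-- Two elements are related when they lie in a common basic set. -/
def Rel (A : SchurRing G) (x y : G) : Prop := ∃ X ∈ A.basicSets, x ∈ X ∧ y ∈ X

theorem rel_equivalence (A : SchurRing G) : Equivalence A.Rel where
  refl x := by
    obtain ⟨X, ⟨hX, hx⟩, -⟩ := A.isPartition.2 x
    exact ⟨X, hX, hx, hx⟩
  symm := fun ⟨X, hX, hx, hy⟩ => ⟨X, hX, hy, hx⟩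
  trans := by
    rintro x y z ⟨X, hX, hx, hy⟩ ⟨Y, hY, hy', hz⟩
    obtain rfl := (A.isPartition.2 y).unique ⟨hX, hy⟩ ⟨hY, hy'⟩
    exact ⟨X, hX, hx, hz⟩

variable {A : SchurRing G}

theorem Rel.refl (A : SchurRing G) (x : G) : A.Rel x x := A.rel_equivalence.refl x

theorem Rel.symm {x y : G} (h : A.Rel x y) : A.Rel y x := A.rel_equivalence.symm h

theorem Rel.trans {x y z : G} (h : A.Rel x y) (h' : A.Rel y z) : A.Rel x z :=
  A.rel_equivalence.trans h h'

theorem isASet_iff_rel {Y : Set G} : A.IsASet Y ↔ ∀ x y, A.Rel x y → x ∈ Y → y ∈ Y := by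
  rw [isASet_iff]
  constructor
  · rintro h x y ⟨X, hX, hx, hy⟩ hxY
    exact h X hX x hx hxY hy
  · intro h X hX x hx hxY y hy
    exact h x y ⟨X, hX, hx, hy⟩ hxY

theorem IsASet.mem_iff {Y : Set G} (hY : A.IsASet Y) {x y : G} (h : A.Rel x y) :
    x ∈ Y ↔ y ∈ Y :=
  ⟨isASet_iff_rel.1 hY x y h, isASet_iff_rel.1 hY y x h.symm⟩

theorem mem_basicSets_iff {X : Set G} : X ∈ A.basicSets ↔ ∃ x, X = {y | A.Rel x y} := by
  have key : ∀ X ∈ A.basicSets, ∀ x ∈ X, X = {y | A.Rel x y} := by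
    intro X hX x hx
    ext y
    refine ⟨fun hy => ⟨X, hX, hx, hy⟩, ?_⟩
    rintro ⟨Y, hY, hx', hy⟩
    obtain rfl := (A.isPartition.2 x).unique ⟨hX, hx⟩ ⟨hY, hx'⟩
    exact hy
  constructor
  · intro hX
    obtain ⟨x, hx⟩ := Set.nonempty_iff_ne_empty.2 fun h => A.isPartition.1 (h ▸ hX)
    exact ⟨x, key X hX x hx⟩
  · rintro ⟨x, rfl⟩
    obtain ⟨X, ⟨hX, hx⟩, -⟩ := A.isPartition.2 x
    exact key X hX x hx ▸ hX

theorem isASet_rel (A : SchurRing G) (x : G) : A.IsASet {y | A.Rel x y} :=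
  isASet_iff_rel.2 fun _ _ h h' => Rel.trans h' h

theorem rel_neg {x y : G} (h : A.Rel x y) : A.Rel (-x) (-y) := by
  obtain ⟨X, hX, hx, hy⟩ := h
  exact ⟨-X, A.neg_mem_basicSets X hX, by simpa using hx, by simpa using hy⟩

theorem rel_zero_left {x : G} : A.Rel 0 x ↔ x = 0 := by
  constructor
  · rintro ⟨X, hX, h0, hx⟩
    obtain rfl := (A.isPartition.2 0).unique ⟨hX, h0⟩ ⟨A.singleton_zero_mem, rfl⟩
    exact hx
  · rintro rfl
    exact Rel.refl A 0

theorem mem_toSubring_iff {f : AddMonoidAlgebra ℤ G} :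
    f ∈ A.toSubring ↔ ∀ x y, A.Rel x y → f.coeff x = f.coeff y := by
  rw [A.mem_iff_mem_span, mem_span_groupRingSum_iff A.isPartition]
  constructor
  · rintro h x y ⟨X, hX, hx, hy⟩
    exact h X hX x hx y hy
  · intro h X hX x hx y hy
    exact h x y ⟨X, hX, hx, hy⟩

theorem groupRingSum_mem {X : Set G} (hX : A.IsASet X) : groupRingSum X ∈ A.toSubring := by
  classical
  rw [mem_toSubring_iff]
  intro x y h
  simp only [coeff_groupRingSum, hX.mem_iff h]

theorem coeff_groupRingSum_mul {G : Type*} [AddCommGroup G] [Finite G] (X Y : Set G) (z : G) :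
    (groupRingSum X * groupRingSum Y).coeff z = ({x | x ∈ X ∧ z - x ∈ Y}.ncard : ℤ) := by
  classical
  have := Fintype.ofFinite G
  have e : {x | x ∈ X ∧ z - x ∈ Y} =
      ((X.toFinite.toFinset.filter fun x => z - x ∈ Y : Finset G) : Set G) := by
    ext; simp
  rw [e, Set.ncard_coe_finset, Finset.card_filter]
  nth_rewrite 1 [groupRingSum]
  rw [Finset.sum_mul, ← AddMonoidAlgebra.coeffAddEquiv_apply, map_sum, Finsupp.finsetSum_apply]
  push_cast
  refine Finset.sum_congr rfl fun x _ => ?_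
  rw [AddMonoidAlgebra.coeffAddEquiv_apply, ← coeff_groupRingSum]
  rw [sub_eq_neg_add]
  simp [AddMonoidAlgebra.coeff_single_mul_apply]

/-- The number of representations of an element as a sum of elements of two `A`-sets depends only
on its basic set. -/
theorem ncard_add_eq {X Y : Set G} (hX : A.IsASet X) (hY : A.IsASet Y) {z w : G}
    (h : A.Rel z w) :
    {x | x ∈ X ∧ z - x ∈ Y}.ncard = {x | x ∈ X ∧ w - x ∈ Y}.ncard := by
  have := mem_toSubring_iff.1 (mul_mem (groupRingSum_mem hX) (groupRingSum_mem hY)) z w h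
  rw [coeff_groupRingSum_mul, coeff_groupRingSum_mul] at this
  exact_mod_cast this

end Group
end SchurRing

/-! ### Sums, generated subgroups and stabilizers of A-sets; Schur's theorem on p-th powers. -/

namespace SchurRing

section Group

variable {G : Type*} [AddCommGroup G] [Finite G] {A : SchurRing G}

/-- X + Y is the support of ξ(X)ξ(Y), whose coefficients are constant on basic sets. -/
theorem IsASet.add {X Y : Set G} (hX : A.IsASet X) (hY : A.IsASet Y) : A.IsASet (X + Y) := by
  have key : ∀ z, z ∈ X + Y ↔ {x | x ∈ X ∧ z - x ∈ Y}.ncard ≠ 0 := by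
    intro z
    rw [Ne, Set.ncard_eq_zero (Set.toFinite _), ← Ne, ← Set.nonempty_iff_ne_empty]
    constructor
    · rintro ⟨x, hx, y, hy, rfl⟩
      exact ⟨x, hx, by simpa using hy⟩
    · rintro ⟨x, hx, hy⟩
      exact ⟨x, hx, _, hy, by simp⟩
  refine isASet_iff_rel.2 fun z w h hz => ?_
  rw [key] at hz ⊢
  rwa [← ncard_add_eq hX hY h]

theorem IsASet.inter {X Y : Set G} (hX : A.IsASet X) (hY : A.IsASet Y) : A.IsASet (X ∩ Y) :=
  isASet_iff_rel.2 fun _ _ h hz => ⟨(hX.mem_iff h).1 hz.1, (hY.mem_iff h).1 hz.2⟩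

theorem IsASet.neg {X : Set G} (hX : A.IsASet X) : A.IsASet (-X) :=
  isASet_iff_rel.2 fun _ _ h hz => (hX.mem_iff (rel_neg h)).1 hz

theorem IsASet.closure {X : Set G} (hX : A.IsASet X) :
    A.IsASet (AddSubgroup.closure X : Set G) := by
  set H := AddSubgroup.closure X
  -- The elements whose whole basic set lies in H. The sum of this A-set with itself is an A-set
  -- inside H, which carries the induction through sums.
  have hY : A.IsASet {x | ∀ y, A.Rel x y → y ∈ H} :=
    isASet_iff_rel.2 fun x y h hx z hz => hx z (h.trans hz)
  have sub : ∀ x ∈ H, ∀ y, A.Rel x y → y ∈ H := by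
    intro x hx
    induction hx using AddSubgroup.closure_induction with
    | mem x hx => exact fun y h => AddSubgroup.subset_closure ((hX.mem_iff h).1 hx)
    | zero =>
      intro y h
      rw [rel_zero_left.1 h]
      exact zero_mem H
    | add x y _ _ hx hy =>
      intro z hz
      obtain ⟨a, ha, b, hb, rfl⟩ := ((hY.add hY).mem_iff hz).1 ⟨x, hx, y, hy, rfl⟩
      exact add_mem (ha a (Rel.refl A a)) (hb b (Rel.refl A b))
    | neg x _ hx =>
      intro y h
      have := neg_mem (hx (-y) (by simpa using rel_neg h))
      rwa [neg_neg] at this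
  exact isASet_iff_rel.2 fun x y h hx => sub x hx y h

/-- The number of differences equal to `z` in an `A`-set depends only on the basic set of `z`. -/
theorem ncard_sub_eq {X : Set G} (hX : A.IsASet X) {z w : G} (h : A.Rel z w) :
    {x | x ∈ X ∧ x + z ∈ X}.ncard = {x | x ∈ X ∧ x + w ∈ X}.ncard := by
  have key : ∀ z, {x | x ∈ X ∧ x + z ∈ X}.ncard = {x | x ∈ -X ∧ z - x ∈ X}.ncard := by
    intro z
    have : {x | x ∈ -X ∧ z - x ∈ X} = -{x | x ∈ X ∧ x + z ∈ X} := by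
      ext x
      simp [sub_eq_neg_add]
    rw [this, Set.ncard_neg]
  rw [key, key, ncard_add_eq hX.neg hX h]

/-- The stabilizer of an `A`-set is an `A`-set. -/
theorem IsASet.stabilizer {X : Set G} (hX : A.IsASet X) :
    A.IsASet {g | ∀ x ∈ X, x + g ∈ X} := by
  -- z stabilizes X exactly when the number of x ∈ X with x + z ∈ X takes its largest possible
  -- value, and that number is constant on basic sets.
  have key : ∀ z, (∀ x ∈ X, x + z ∈ X) ↔ {x | x ∈ X ∧ x + z ∈ X}.ncard = X.ncard := by
    intro z
    constructor
    · intro h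
      congr 1
      ext x
      exact ⟨fun hx => hx.1, fun hx => ⟨hx, h x hx⟩⟩
    · intro h x hx
      have := Set.eq_of_subset_of_ncard_le (fun x hx => hx.1 : {x | x ∈ X ∧ x + z ∈ X} ⊆ X) h.ge
        (Set.toFinite _)
      exact (this.symm ▸ hx : x ∈ {x | x ∈ X ∧ x + z ∈ X}).2
  refine isASet_iff_rel.2 fun z w h hz => ?_
  rw [Set.mem_ofPred_eq, key] at hz ⊢
  rw [← hz, ncard_sub_eq hX h]

/-- Schur's theorem: modulo a prime `p`, the number of `p`-th roots in an `A`-set of an element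
depends only on the basic set of that element. -/
theorem ncard_nsmul_eq {X : Set G} (hX : A.IsASet X) {p : ℕ} (hp : p.Prime) {z w : G}
    (h : A.Rel z w) :
    p ∣ {x | x ∈ X ∧ p • x = z}.ncard ↔ p ∣ {x | x ∈ X ∧ p • x = w}.ncard := by
  classical
  have := Fact.mk hp
  -- Modulo p the Frobenius map turns ξ(X)^p into the sum of the elements px, x ∈ X, so the
  -- coefficients of ξ(X)^p count p-th roots.
  have key : ∀ g, ((({x | x ∈ X ∧ p • x = g}.ncard : ℕ) : ZMod p)) =
      (((groupRingSum X ^ p).coeff g : ℤ) : ZMod p) := by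
    intro g
    have e : {x | x ∈ X ∧ p • x = g} =
        ((X.toFinite.toFinset.filter fun x => p • x = g : Finset G) : Set G) := by
      ext; simp
    have : CharP (AddMonoidAlgebra (ZMod p) G) p := by
      refine (charP_of_injective_algebraMap (R := ZMod p) (fun a b hab => ?_) p)
      have := congrArg (fun f : AddMonoidAlgebra (ZMod p) G => f.coeff 0) hab
      simpa using this
    have h1 : (((groupRingSum X ^ p).coeff g : ℤ) : ZMod p) =
        (AddMonoidAlgebra.mapRingHom G (Int.castRingHom (ZMod p)) (groupRingSum X ^ p)).coeff g :=
      (eq_intCast (Int.castRingHom (ZMod p)) _).symm.trans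
        (AddMonoidAlgebra.coeff_mapRingHom (Int.castRingHom (ZMod p)) _ _).symm
    rw [h1, map_pow, groupRingSum, map_sum, sum_pow_char,
      ← AddMonoidAlgebra.coeffAddEquiv_apply, map_sum, Finsupp.finsetSum_apply, e,
      Set.ncard_coe_finset, Finset.card_filter]
    push_cast
    refine Finset.sum_congr rfl fun x _ => ?_
    simp [AddMonoidAlgebra.single_pow, Finsupp.single_apply]
  rw [← CharP.cast_eq_zero_iff (ZMod p) p, ← CharP.cast_eq_zero_iff (ZMod p) p, key, key,
    mem_toSubring_iff.1 (pow_mem (groupRingSum_mem hX) p) z w h]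

theorem isASet_nsmul {X : Set G} (hX : A.IsASet X) {p : ℕ} (hp : p.Prime) :
    A.IsASet {z | ¬ p ∣ {x | x ∈ X ∧ p • x = z}.ncard} :=
  isASet_iff_rel.2 fun _ _ h hz => fun h' => hz ((ncard_nsmul_eq hX hp h).2 h')

end Group

/-! ### Schur rings from equivalence relations, and images under epimorphisms. -/

section Construction

variable {G : Type*} [AddCommGroup G] [Finite G]

omit [Finite G] in
-- Convolutions are linear combinations of convolutions of indicators of level sets, which are
-- unions of classes. The coefficient ring is arbitrary because both ℤ (in `ofRel`) and ℂ (in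
-- `Inv.conv`) are needed.
theorem sum_mul_sub_eq {k : Type*} [CommRing k] [Fintype G] {r : G → G → Prop}
    (hr : ∀ X Y : Set G, (∀ x y, r x y → (x ∈ X ↔ y ∈ X)) → (∀ x y, r x y → (x ∈ Y ↔ y ∈ Y)) →
      ∀ z w, r z w → {x | x ∈ X ∧ z - x ∈ Y}.ncard = {x | x ∈ X ∧ w - x ∈ Y}.ncard)
    {f g : G → k} (hf : ∀ x y, r x y → f x = f y) (hg : ∀ x y, r x y → g x = g y) {z w : G}
    (h : r z w) : ∑ x, f x * g (z - x) = ∑ x, f x * g (w - x) := by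
  classical
  have key : ∀ z, ∑ x, f x * g (z - x) = ∑ a ∈ Finset.univ.image f, ∑ b ∈ Finset.univ.image g,
      (({x | x ∈ f ⁻¹' {a} ∧ z - x ∈ g ⁻¹' {b}}.ncard : ℕ) : k) * (a * b) := by
    intro z
    have h1 : ∀ x, f x * g (z - x) = ∑ a ∈ Finset.univ.image f, ∑ b ∈ Finset.univ.image g,
        if x ∈ f ⁻¹' {a} ∧ z - x ∈ g ⁻¹' {b} then a * b else 0 := by
      intro x
      rw [Finset.sum_eq_single (f x), Finset.sum_eq_single (g (z - x))]
      · simp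
      · intro b _ hb
        simp [hb.symm]
      · simp
      · intro a _ ha
        simp [ha.symm]
      · simp
    simp_rw [h1]
    rw [Finset.sum_comm]
    refine Finset.sum_congr rfl fun a _ => ?_
    rw [Finset.sum_comm]
    refine Finset.sum_congr rfl fun b _ => ?_
    have e : {x | x ∈ f ⁻¹' {a} ∧ z - x ∈ g ⁻¹' {b}} =
        ((Finset.univ.filter fun x => x ∈ f ⁻¹' {a} ∧ z - x ∈ g ⁻¹' {b} : Finset G) : Set G) := by
      ext; simp
    rw [← Finset.sum_filter, Finset.sum_const, e, Set.ncard_coe_finset, nsmul_eq_mul]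
  rw [key, key]
  refine Finset.sum_congr rfl fun a _ => Finset.sum_congr rfl fun b _ => ?_
  rw [hr _ _ (fun x y hxy => by simp [hf x y hxy]) (fun x y hxy => by simp [hg x y hxy]) z w h]

omit [Finite G] in
theorem coeff_mul_eq_sum [Fintype G] (f g : AddMonoidAlgebra ℤ G) (z : G) :
    (f * g).coeff z = ∑ x, f.coeff x * g.coeff (z - x) := by
  classical
  rw [AddMonoidAlgebra.coeff_mul, Finsupp.sum_fintype _ _ (by simp)]
  refine Finset.sum_congr rfl fun x _ => ?_
  rw [Finsupp.sum_fintype _ _ (by simp), Finset.sum_eq_single (z - x)]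
  · simp
  · intro b _ hb
    rw [if_neg]
    rintro rfl
    simp at hb
  · simp

/-- The Schur ring whose basic sets are the classes of a suitable equivalence relation. -/
def ofRel (r : G → G → Prop) (hr : Equivalence r) (h0 : ∀ x, r 0 x → x = 0)
    (hneg : ∀ x y, r x y → r (-x) (-y))
    (hcount : ∀ X Y : Set G, (∀ x y, r x y → (x ∈ X ↔ y ∈ X)) →
      (∀ x y, r x y → (x ∈ Y ↔ y ∈ Y)) →
      ∀ z w, r z w → {x | x ∈ X ∧ z - x ∈ Y}.ncard = {x | x ∈ X ∧ w - x ∈ Y}.ncard) :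
    SchurRing G :=
  have hpart : Setoid.IsPartition {X : Set G | ∃ x, X = {y | r x y}} := by
    constructor
    · rintro ⟨x, hx⟩
      have : x ∈ {y | r x y} := hr.refl x
      rw [← hx] at this
      exact this
    · intro x
      refine ⟨{y | r x y}, ⟨⟨x, rfl⟩, hr.refl x⟩, ?_⟩
      rintro _ ⟨⟨y, rfl⟩, hy⟩
      ext z
      exact ⟨fun hz => hr.trans (hr.symm hy) hz, fun hz => hr.trans hy hz⟩
  have hspan : ∀ f, f ∈ Submodule.span ℤ (groupRingSum '' {X : Set G | ∃ x, X = {y | r x y}}) ↔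
      ∀ x y, r x y → f.coeff x = f.coeff y := by
    intro f
    rw [mem_span_groupRingSum_iff hpart]
    constructor
    · exact fun h x y hxy => h _ ⟨x, rfl⟩ x (hr.refl x) y hxy
    · rintro h _ ⟨z, rfl⟩ x hx y hy
      exact h x y (hr.trans (hr.symm hx) hy)
  { toSubring :=
      { carrier := Submodule.span ℤ (groupRingSum '' {X : Set G | ∃ x, X = {y | r x y}})
        zero_mem' := zero_mem _
        add_mem' := fun h k => add_mem h k
        neg_mem' := fun h => neg_mem h
        one_mem' := by
          classical
          rw [SetLike.mem_coe, hspan]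
          intro x y hxy
          have : x = 0 ↔ y = 0 :=
            ⟨fun h => h0 y (h ▸ hxy), fun h => h0 x (hr.symm (h ▸ hxy))⟩
          simp only [AddMonoidAlgebra.one_def, AddMonoidAlgebra.coeff_single, Finsupp.single_apply, eq_comm, this]
        mul_mem' := by
          have := Fintype.ofFinite G
          intro f g hf hg
          rw [SetLike.mem_coe, hspan] at hf hg ⊢
          intro x y hxy
          rw [coeff_mul_eq_sum, coeff_mul_eq_sum]
          exact sum_mul_sub_eq hcount hf hg hxy }
    basicSets := {X | ∃ x, X = {y | r x y}}
    isPartition := hpart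
    singleton_zero_mem := ⟨0, by
      ext x
      exact ⟨fun h => by rw [Set.mem_singleton_iff.1 h]; exact hr.refl 0, fun h => h0 x h⟩⟩
    neg_mem_basicSets := by
      rintro _ ⟨x, rfl⟩
      refine ⟨-x, ?_⟩
      ext y
      exact ⟨fun h => by simpa using hneg _ _ h, fun h => by simpa using hneg _ _ h⟩
    mem_iff_mem_span := fun _ => Iff.rfl }

theorem rel_ofRel {r : G → G → Prop} (hr : Equivalence r) (h0 : ∀ x, r 0 x → x = 0)
    (hneg : ∀ x y, r x y → r (-x) (-y))
    (hcount : ∀ X Y : Set G, (∀ x y, r x y → (x ∈ X ↔ y ∈ X)) →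
      (∀ x y, r x y → (x ∈ Y ↔ y ∈ Y)) →
      ∀ z w, r z w → {x | x ∈ X ∧ z - x ∈ Y}.ncard = {x | x ∈ X ∧ w - x ∈ Y}.ncard) (x y : G) :
    (ofRel r hr h0 hneg hcount).Rel x y ↔ r x y := by
  constructor
  · rintro ⟨_, ⟨z, rfl⟩, hx, hy⟩
    exact hr.trans (hr.symm hx) hy
  · exact fun h => ⟨_, ⟨x, rfl⟩, hr.refl x, h⟩

variable {G' : Type*} [AddCommGroup G'] [Finite G']

theorem ncard_preimage (π : G →+ G') (hπ : Function.Surjective π) (S : Set G') :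
    (π ⁻¹' S).ncard = S.ncard * (π ⁻¹' {0}).ncard := by
  classical
  have := Fintype.ofFinite G
  have := Fintype.ofFinite G'
  have e : ∀ T : Set G', π ⁻¹' T = ((Finset.univ.filter fun x => π x ∈ T : Finset G) : Set G) := by
    intro T; ext; simp
  have e' : S = ((Finset.univ.filter fun x => x ∈ S : Finset G') : Set G') := by ext; simp
  rw [e, e, Set.ncard_coe_finset, Set.ncard_coe_finset]
  conv_rhs => rw [e', Set.ncard_coe_finset]
  rw [Finset.card_eq_sum_card_fiberwise (f := π) (t := Finset.univ.filter fun x => x ∈ S)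
    (fun x hx => by simpa using hx), Finset.sum_const_nat]
  intro y hy
  obtain ⟨x, rfl⟩ := hπ y
  refine Finset.card_bij (fun a _ => a - x) ?_ (by simp) ?_
  · intro a ha
    simp only [Finset.mem_filter, Finset.mem_univ, true_and] at ha ⊢
    simp [ha.2]
  · intro b hb
    refine ⟨b + x, ?_, by simp⟩
    simp only [Finset.mem_filter, Finset.mem_univ, true_and, Set.mem_singleton_iff] at hb hy ⊢
    simp [hb, hy]

/-- The relation on a quotient group induced by a Schur ring. -/
def PushRel (A : SchurRing G) (π : G →+ G') (z w : G') : Prop :=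
  ∃ x y, π x = z ∧ π y = w ∧ A.Rel x y

variable {A : SchurRing G} {π : G →+ G'}

omit [Finite G'] in
-- The basic set of x plus the kernel is an A-set containing every other preimage of π x, hence all
-- elements related to such a preimage. This lifting makes `PushRel` transitive.
theorem PushRel.lift (hker : A.IsASet (π ⁻¹' {0})) {x : G} {w : G'} (h : A.PushRel π (π x) w) :
    ∃ y, π y = w ∧ A.Rel x y := by
  obtain ⟨x', y', hx, rfl, h⟩ := h
  obtain ⟨y, hy, l, hl, hyl⟩ := (((A.isASet_rel x).add hker).mem_iff h).1
    ⟨x, Rel.refl A x, x' - x, by simp [hx], by simp⟩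
  refine ⟨y, ?_, hy⟩
  have hl : π l = 0 := hl
  rw [← hyl]
  simp [hl]

/-- The image of a Schur ring under an epimorphism whose kernel is an `A`-subgroup. -/
def push (A : SchurRing G) (π : G →+ G') (hπ : Function.Surjective π)
    (hker : A.IsASet (π ⁻¹' {0})) : SchurRing G' :=
  ofRel (A.PushRel π)
    { refl := fun z => by
        obtain ⟨x, rfl⟩ := hπ z
        exact ⟨x, x, rfl, rfl, Rel.refl A x⟩
      symm := fun ⟨x, y, hx, hy, h⟩ => ⟨y, x, hy, hx, h.symm⟩
      trans := by
        rintro _ _ _ ⟨x, y, rfl, rfl, h⟩ h'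
        obtain ⟨z, rfl, hz⟩ := PushRel.lift hker h'
        exact ⟨x, z, rfl, rfl, h.trans hz⟩ }
    (fun z h => by
      obtain ⟨y, rfl, hy⟩ := PushRel.lift (x := 0) hker (by rwa [map_zero])
      rw [rel_zero_left.1 hy, map_zero])
    (by
      rintro _ _ ⟨x, y, rfl, rfl, h⟩
      exact ⟨-x, -y, map_neg _ _, map_neg _ _, rel_neg h⟩)
    (by
      rintro X Y hX hY _ _ ⟨x, y, rfl, rfl, h⟩
      have hX' : A.IsASet (π ⁻¹' X) :=
        isASet_iff_rel.2 fun a b hab ha => (hX _ _ ⟨a, b, rfl, rfl, hab⟩).1 ha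
      have hY' : A.IsASet (π ⁻¹' Y) :=
        isASet_iff_rel.2 fun a b hab ha => (hY _ _ ⟨a, b, rfl, rfl, hab⟩).1 ha
      have key : ∀ z, {x | x ∈ π ⁻¹' X ∧ z - x ∈ π ⁻¹' Y} =
          π ⁻¹' {x | x ∈ X ∧ π z - x ∈ Y} := by
        intro z; ext; simp
      -- Counts in G are counts in G' multiplied by the order of the kernel.
      have := ncard_add_eq hX' hY' h
      rw [key, key, ncard_preimage π hπ, ncard_preimage π hπ {x | x ∈ X ∧ π y - x ∈ Y}] at this
      refine Nat.eq_of_mul_eq_mul_right ?_ this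
      exact (Set.ncard_pos (Set.toFinite _)).2 ⟨0, by simp⟩)

theorem rel_push (hπ : Function.Surjective π) (hker : A.IsASet (π ⁻¹' {0})) (z w : G') :
    (A.push π hπ hker).Rel z w ↔ A.PushRel π z w := rel_ofRel _ _ _ _ z w

theorem isASet_push (hπ : Function.Surjective π) (hker : A.IsASet (π ⁻¹' {0})) (Y : Set G') :
    (A.push π hπ hker).IsASet Y ↔ A.IsASet (π ⁻¹' Y) := by
  rw [isASet_iff_rel, isASet_iff_rel]
  constructor
  · exact fun h x y hxy hx => h _ _ ((rel_push hπ hker _ _).2 ⟨x, y, rfl, rfl, hxy⟩) hx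
  · intro h z w hzw hz
    obtain ⟨x, y, rfl, rfl, hxy⟩ := (rel_push hπ hker z w).1 hzw
    exact h x y hxy hz

end Construction
end SchurRing

/-! ### Idempotents, units and p-torsion in finite rings. -/

section RingFacts

theorem exists_isIdempotentElem_pow_succ {M : Type*} [Monoid M] [Finite M] (a : M) :
    ∃ k : ℕ, IsIdempotentElem (a ^ (k + 1)) := by
  obtain ⟨m, n, hmn, h⟩ := Finite.exists_ne_map_eq_of_infinite (fun n : ℕ => a ^ n)
  wlog hlt : m < n generalizing m n
  · exact this n m hmn.symm h.symm (by omega)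
  obtain ⟨d, rfl⟩ := Nat.exists_eq_add_of_lt hlt
  replace h : a ^ m = a ^ (m + d + 1) := h
  have step : ∀ j t, a ^ (m + j + (d + 1) * t) = a ^ (m + j) := by
    intro j t
    induction t with
    | zero => simp
    | succ t ih =>
      rw [show m + j + (d + 1) * (t + 1) = (m + d + 1) + (j + (d + 1) * t) by ring, pow_add, ← h,
        ← pow_add, ← ih]
      ring_nf
  -- With the successor, the exponent is (m + 1)(d + 1): a multiple of the period d + 1 that is at
  -- least m.
  refine ⟨m + (d * m + d), ?_⟩
  have := step (d * m + d + 1) (m + 1)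
  rw [IsIdempotentElem, ← pow_add]
  rw [show m + (d * m + d) + 1 + (m + (d * m + d) + 1) =
    m + (d * m + d + 1) + (d + 1) * (m + 1) by ring, this, add_assoc]
  rfl

/-- For every prime `p`, the elements of `R` are either multiples of `p` or units modulo `p`. -/
def IsFieldModPrimes (R : Type*) [CommRing R] : Prop :=
  ∀ p : ℕ, p.Prime → ∀ x : R, (∃ y, x = p * y) ∨ ∃ y z, x * y = 1 + p * z

/-- Immediate inheritance by quotients is the reason for working with this property: the main
induction replaces R by R/V. -/
theorem IsFieldModPrimes.of_surjective {R R' : Type*} [CommRing R] [CommRing R']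
    (hR : IsFieldModPrimes R) (f : R →+* R') (hf : Function.Surjective f) :
    IsFieldModPrimes R' := by
  intro p hp x
  obtain ⟨x, rfl⟩ := hf x
  rcases hR p hp x with ⟨y, h⟩ | ⟨y, z, h⟩
  · exact Or.inl ⟨f y, by rw [h]; simp⟩
  · exact Or.inr ⟨f y, f z, by rw [← map_mul, h]; simp⟩

theorem IsGaloisRing.isUnit_natCast {p q : ℕ} {S : Type*} [CommRing S] (h : IsGaloisRing p S)
    (hq : q.Prime) (hpq : p ≠ q) : IsUnit (q : S) := by
  obtain ⟨-, hp, hl, hj⟩ := h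
  rw [IsLocalRing.ringJacobson_eq_maximalIdeal] at hj
  by_contra hu
  have h1 : (q : S) ∈ IsLocalRing.maximalIdeal S := (IsLocalRing.mem_maximalIdeal _).2 hu
  have h2 : (p : S) ∈ IsLocalRing.maximalIdeal S := by
    rw [hj]; exact Ideal.mem_span_singleton_self _
  obtain ⟨a, b, hab⟩ := ((Nat.coprime_primes hp hq).2 hpq).isCoprime
  apply (Ideal.ne_top_iff_one _).1 (IsLocalRing.maximalIdeal.isMaximal S).ne_top
  have : (1 : S) = (a : S) * p + (b : S) * q := by
    rw [← Int.cast_natCast p, ← Int.cast_natCast q, ← Int.cast_mul, ← Int.cast_mul, ← Int.cast_add,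
      hab, Int.cast_one]
  rw [this]
  exact add_mem (Ideal.mul_mem_left _ _ h2) (Ideal.mul_mem_left _ _ h1)

theorem IsCGRing.isFieldModPrimes {R : Type u} [CommRing R] (hR : IsCGRing R) :
    IsFieldModPrimes R := by
  classical
  obtain ⟨S, inst, hS, ⟨e⟩⟩ := hR
  refine IsFieldModPrimes.of_surjective ?_ (e.symm : (∀ p, S p) →+* R) e.symm.surjective
  intro p hp x
  have hunit : ∀ q : (Nat.card R).primeFactors, (q : ℕ) ≠ p → IsUnit (p : S q) :=
    fun q hq => (hS q).isUnit_natCast hp hq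
  -- Only the factor at p decides: p is a unit in all others, where both alternatives can be met.
  by_cases hx : ∃ q : (Nat.card R).primeFactors, (q : ℕ) = p ∧ IsUnit (x q)
  · right
    obtain ⟨q, rfl, hq⟩ := hx
    have h : ∀ s, ∃ y z : S s, x s * y = 1 + ((q : ℕ) : S s) * z := by
      intro s
      by_cases hs : s = q
      · subst hs
        obtain ⟨y, hy⟩ := hq.exists_right_inv
        exact ⟨y, 0, by simp [hy]⟩
      · obtain ⟨y, hy⟩ := (hunit s fun h => hs (Subtype.ext h)).exists_right_inv
        exact ⟨0, -y, by simp [hy]⟩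
    choose y z h using h
    exact ⟨y, z, funext h⟩
  · left
    have h : ∀ s, ∃ y : S s, x s = (p : S s) * y := by
      intro s
      by_cases hs : (s : ℕ) = p
      · obtain ⟨-, hp', hl, hj⟩ := hS s
        rw [IsLocalRing.ringJacobson_eq_maximalIdeal] at hj
        have : x s ∈ Ideal.span {((s : ℕ) : S s)} := by
          rw [← hj, IsLocalRing.mem_maximalIdeal]
          exact fun hu => hx ⟨s, hs, hu⟩
        obtain ⟨y, hy⟩ := Ideal.mem_span_singleton.1 this
        exact ⟨y, by rw [hy, hs]⟩
      · obtain ⟨y, hy⟩ := (hunit s hs).exists_right_inv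
        exact ⟨y * x s, by rw [← mul_assoc, hy, one_mul]⟩
    choose y h using h
    exact ⟨y, funext h⟩

variable (R : Type*) [CommRing R] [Finite R]

/-- The idempotent of `R` generating the `p`-component. -/
def pIdem (p : ℕ) : R := 1 - (p : R) ^ (Classical.choose
  (exists_isIdempotentElem_pow_succ (p : R)) + 1)

theorem exists_pIdem_eq (p : ℕ) : ∃ k : ℕ, pIdem R p = 1 - (p : R) ^ (k + 1) ∧
    (p : R) ^ (k + 1) * pIdem R p = 0 := by
  refine ⟨_, rfl, ?_⟩
  have := Classical.choose_spec (exists_isIdempotentElem_pow_succ (p : R))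
  rw [pIdem, mul_sub, this.eq, mul_one, sub_self]

variable {R}

theorem pIdem_mul_self (p : ℕ) : pIdem R p * pIdem R p = pIdem R p := by
  obtain ⟨k, h, h'⟩ := exists_pIdem_eq R p
  nth_rewrite 1 [h]
  rw [sub_mul, h', one_mul, sub_zero]

theorem one_sub_pIdem (p : ℕ) : ∃ c, 1 - pIdem R p = p * c := by
  obtain ⟨k, h, -⟩ := exists_pIdem_eq R p
  exact ⟨(p : R) ^ k, by rw [h, pow_succ]; ring⟩

theorem pIdem_mul_of_mul_eq_zero {p : ℕ} {y : R} (h : (p : R) * y = 0) : pIdem R p * y = y := by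
  obtain ⟨c, hc⟩ := one_sub_pIdem (R := R) p
  have : (1 - pIdem R p) * y = 0 := by rw [hc, mul_right_comm, h, zero_mul]
  linear_combination -this

theorem isNilpotent_mul_pIdem (p : ℕ) (a : R) : IsNilpotent ((p : R) * pIdem R p * a) := by
  obtain ⟨k, -, h⟩ := exists_pIdem_eq R p
  refine ⟨k + 1, ?_⟩
  rw [mul_pow, mul_pow, pow_succ (pIdem R p), mul_comm (pIdem R p ^ k), ← mul_assoc, h]
  simp

theorem isUnit_one_add_mul_pIdem (p : ℕ) (a : R) : IsUnit (1 + (p : R) * pIdem R p * a) :=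
  (isNilpotent_mul_pIdem p a).isUnit_one_add

/-- The element equals a on the p-component and 1 on the others. It is a unit because a is
invertible modulo p and p is nilpotent on the p-component. -/
theorem isUnit_pIdem_mul_add {p : ℕ} {a y z : R} (h : a * y = 1 + p * z) :
    IsUnit (pIdem R p * a + (1 - pIdem R p)) := by
  have hee := pIdem_mul_self (R := R) p
  have : (pIdem R p * a + (1 - pIdem R p)) * (pIdem R p * y + (1 - pIdem R p)) =
      1 + (p : R) * pIdem R p * z := by
    linear_combination (a * y + 1 - a - y) * hee + pIdem R p * h
  exact isUnit_of_mul_isUnit_left (this ▸ isUnit_one_add_mul_pIdem p z)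

theorem AddSubgroup.exists_prime_nsmul_mem {G : Type*} [AddCommGroup G] [Finite G]
    {C : AddSubgroup G} {a : G} (ha : a ∉ C) : ∃ p : ℕ, p.Prime ∧ ∃ b, b ∉ C ∧ p • b ∈ C := by
  classical
  have hex : ∃ n : ℕ, 0 < n ∧ n • a ∈ C :=
    ⟨Nat.card G, Nat.card_pos, by rw [card_nsmul_eq_zero']; exact zero_mem C⟩
  obtain ⟨h0, hn⟩ := Nat.find_spec hex
  set n := Nat.find hex
  have h1 : n ≠ 1 := fun h => ha (by simpa [h] using hn)
  obtain ⟨p, hp, m, hm⟩ := Nat.exists_prime_and_dvd h1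
  refine ⟨p, hp, m • a, fun h => ?_, by rwa [← mul_smul, ← hm]⟩
  have hmpos : 0 < m := Nat.pos_of_ne_zero fun h => by simp [h] at hm; omega
  have : m < n := by rw [hm]; exact lt_mul_of_one_lt_left hmpos hp.one_lt
  exact Nat.find_min hex this ⟨hmpos, h⟩

/-- An additive subgroup that contains the units is everything. -/
theorem AddSubgroup.eq_top_of_units_mem (hR : IsFieldModPrimes R) (C : AddSubgroup R)
    (hC : ∀ u : Rˣ, (u : R) ∈ C) : C = ⊤ := by
  have hp : ∀ p : ℕ, p.Prime → ∀ a : R, pIdem R p * a ∈ C := by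
    intro p hp
    have key : ∀ a y z : R, a * y = 1 + p * z → pIdem R p * a ∈ C := by
      intro a y z h
      obtain ⟨k, hk, hk'⟩ := exists_pIdem_eq R p
      obtain ⟨u, hu⟩ := isUnit_pIdem_mul_add h
      -- Since p^(k+1) is the complementary idempotent, the p-part of u is an integer combination of
      -- u.
      have h1 : pIdem R p * a = (u : R) - (p ^ (k + 1)) • (u : R) := by
        have hee := pIdem_mul_self (R := R) p
        rw [hu, nsmul_eq_mul, Nat.cast_pow]
        have hp : (p : R) ^ (k + 1) = 1 - pIdem R p := by rw [hk]; ring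
        rw [hp]
        linear_combination (-a + 1) * hee
      rw [h1]
      exact sub_mem (hC u) (nsmul_mem (hC u) _)
    intro a
    rcases hR p hp a with ⟨b, hb⟩ | ⟨y, z, h⟩
    -- A multiple of p becomes a unit modulo p after subtracting 1.
    · have h1 := key (a - 1) (-1) (-b) (by rw [hb]; ring)
      have h2 := key 1 1 0 (by ring)
      rw [show pIdem R p * a = pIdem R p * (a - 1) + pIdem R p * 1 by ring]
      exact add_mem h1 h2
    · exact key a y z h
  by_contra hne
  obtain ⟨a, ha⟩ : ∃ a, a ∉ C := by
    by_contra h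
    push Not at h
    exact hne ((AddSubgroup.eq_top_iff' C).2 h)
  obtain ⟨p, hpp, b, hb, hpb⟩ := AddSubgroup.exists_prime_nsmul_mem ha
  obtain ⟨k, hk, -⟩ := exists_pIdem_eq R p
  apply hb
  -- The complementary part of b is p^(k+1)b = p^k(pb), which lies in C.
  have : b = pIdem R p * b + p ^ k • (p • b) := by
    rw [hk, nsmul_eq_mul, nsmul_eq_mul, Nat.cast_pow]
    ring
  rw [this]
  exact add_mem (hp p hpp b) (nsmul_mem hpb _)

/-- An additive subgroup stable under the units is stable under multiplication. -/
theorem AddSubgroup.mul_mem_of_units (hR : IsFieldModPrimes R) (H : AddSubgroup R)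
    (hH : ∀ u : Rˣ, ∀ x ∈ H, (u : R) * x ∈ H) (a : R) {x : R} (hx : x ∈ H) : a * x ∈ H := by
  have : H.comap (AddMonoidHom.mulRight x) = ⊤ :=
    AddSubgroup.eq_top_of_units_mem hR _ fun u => hH u x hx
  have h : a ∈ H.comap (AddMonoidHom.mulRight x) := this ▸ AddSubgroup.mem_top a
  exact h

/-- The elements killed by the prime `p` are the multiples of any nonzero one of them. -/
theorem exists_mul_eq_of_torsion (hR : IsFieldModPrimes R) {p : ℕ} (hp : p.Prime) {e e' : R}
    (he : (p : R) * e = 0) (h0 : e ≠ 0) (he' : (p : R) * e' = 0) : ∃ a, a * e = e' := by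
  let f : R →+ R := AddMonoidHom.mulRight e
  let g : R →+ R := AddMonoidHom.mulLeft (p : R)
  -- The map a ↦ ae has kernel pR, so its image has |R/pR| elements. That is also the number of
  -- elements killed by p, among which the image lies.
  have hker : f.ker = g.range := by
    ext a
    simp only [AddMonoidHom.mem_ker, AddMonoidHom.mem_range, f, g, AddMonoidHom.coe_mulRight,
      AddMonoidHom.coe_mulLeft]
    constructor
    · intro h
      rcases hR p hp a with ⟨b, hb⟩ | ⟨y, z, hyz⟩
      · exact ⟨b, hb.symm⟩
      · exact absurd (by linear_combination y * h - e * hyz - z * he) h0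
    · rintro ⟨b, rfl⟩
      linear_combination b * he
  have hle : f.range ≤ g.ker := by
    rintro _ ⟨a, rfl⟩
    simp only [AddMonoidHom.mem_ker, f, g, AddMonoidHom.coe_mulRight, AddMonoidHom.coe_mulLeft]
    linear_combination a * he
  have c1 := AddSubgroup.card_mul_index f.ker
  have c2 := AddSubgroup.card_mul_index g.ker
  rw [AddSubgroup.index_ker] at c1 c2
  rw [hker, ← c2, mul_comm] at c1
  have hcard : Nat.card f.range = Nat.card g.ker :=
    Nat.eq_of_mul_eq_mul_right Nat.card_pos c1
  have heq : f.range = g.ker := AddSubgroup.eq_of_le_of_card_ge hle hcard.ge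
  have : e' ∈ g.ker := he'
  rw [← heq] at this
  exact this

/-- The unit of the `p`-component through which two nonzero elements killed by `p` differ. -/
theorem exists_unit_mul_eq_of_torsion (hR : IsFieldModPrimes R) {p : ℕ} (hp : p.Prime) {e e' : R}
    (he : (p : R) * e = 0) (h0 : e ≠ 0) (he' : (p : R) * e' = 0) (h0' : e' ≠ 0) :
    ∃ u : Rˣ, (u : R) * (1 - pIdem R p) = 1 - pIdem R p ∧ (u : R) * e = e' := by
  obtain ⟨a, rfl⟩ := exists_mul_eq_of_torsion hR hp he h0 he'
  rcases hR p hp a with ⟨b, hb⟩ | ⟨y, z, h⟩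
  · exact absurd (by rw [hb]; linear_combination b * he) h0'
  · obtain ⟨u, hu⟩ := isUnit_pIdem_mul_add h
    have h1 := pIdem_mul_self (R := R) p
    have h2 := pIdem_mul_of_mul_eq_zero he
    refine ⟨u, ?_, ?_⟩
    · rw [hu]; linear_combination (1 - a) * h1
    · rw [hu]; linear_combination (a - 1) * h2

theorem exists_pow_mul_torsion {p : ℕ} {y : R} (h : pIdem R p * y ≠ 0) :
    ∃ s : ℕ, (p : R) ^ s * (pIdem R p * y) ≠ 0 ∧ (p : R) ^ (s + 1) * (pIdem R p * y) = 0 := by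
  classical
  obtain ⟨k, -, hk⟩ := exists_pIdem_eq R p
  have hex : ∃ n : ℕ, (p : R) ^ n * (pIdem R p * y) = 0 := ⟨k + 1, by rw [← mul_assoc, hk, zero_mul]⟩
  have hs := Nat.find_spec hex
  have hmin := fun m => Nat.find_min hex (m := m)
  rcases hn : Nat.find hex with _ | s
  · rw [hn] at hs
    exact absurd (by simpa using hs) h
  · rw [hn] at hs
    exact ⟨s, hmin s (by omega), hs⟩

/-- A nonzero ideal of the `p`-component contains all elements killed by `p`. -/
theorem Ideal.torsion_mem (hR : IsFieldModPrimes R) {p : ℕ} (hp : p.Prime) (U : Ideal R) {y e : R}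
    (hy : y ∈ U) (h : pIdem R p * y ≠ 0) (he : (p : R) * e = 0) : e ∈ U := by
  obtain ⟨s, hs, hs'⟩ := exists_pow_mul_torsion h
  obtain ⟨a, rfl⟩ := exists_mul_eq_of_torsion hR hp (by rw [← mul_assoc, ← pow_succ', hs']) hs he
  exact U.mul_mem_left _ (U.mul_mem_left _ (U.mul_mem_left _ hy))

/-- The principal ideals of the `p`-component form a chain. -/
theorem exists_mul_eq_of_pow (hR : IsFieldModPrimes R) {p : ℕ} (hp : p.Prime) (s : ℕ) {y z : R}
    (hy : pIdem R p * y = y) (hz : pIdem R p * z = z) (h : (p : R) ^ (s + 1) * y = 0)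
    (h' : (p : R) ^ s * z ≠ 0) : ∃ a, a * z = y := by
  have tors : ∀ y z : R, pIdem R p * z = z → z ≠ 0 → (p : R) * y = 0 → ∃ a, a * z = y := by
    intro y z hz h0 h
    have := Ideal.torsion_mem hR hp (Ideal.span {z}) (Ideal.mem_span_singleton_self z)
      (by rwa [hz]) h
    exact Ideal.mem_span_singleton'.1 this
  induction s generalizing y z with
  | zero => exact tors y z hz (by simpa using h') (by simpa using h)
  | succ s ih =>
    obtain ⟨c, hc⟩ := ih (y := p * y) (z := p * z) (by rw [mul_left_comm, hy])
      (by rw [mul_left_comm, hz]) (by rw [← h]; ring) (by rw [← mul_assoc, ← pow_succ]; exact h')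
    obtain ⟨d, hd⟩ := tors (y - c * z) z hz (fun h0 => h' (by rw [h0, mul_zero]))
      (by linear_combination -hc)
    exact ⟨d + c, by linear_combination hd⟩

/-- If the `p`-component of `x` is not killed by `p`, the translates of `x` by elements killed by
`p` are multiples of `x` by units congruent to `1` modulo `p`. -/
theorem exists_unit_mul_eq_add (hR : IsFieldModPrimes R) {p : ℕ} (hp : p.Prime) {x e : R}
    (hx : (p : R) * (pIdem R p * x) ≠ 0) (he : (p : R) * e = 0) :
    ∃ u : Rˣ, (∃ a, (u : R) = 1 + p * pIdem R p * a) ∧ (u : R) * x = x + e := by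
  -- The nonzero p-part of px generates an ideal containing e, so e is a multiple of it; this
  -- multiple is absorbed in a principal unit.
  have := Ideal.torsion_mem hR hp (Ideal.span {(p : R) * (pIdem R p * x)})
    (Ideal.mem_span_singleton_self _) (p := p) (e := e)
    (by
      have h1 := pIdem_mul_self (R := R) p
      have : pIdem R p * ((p : R) * (pIdem R p * x)) = (p : R) * (pIdem R p * x) := by
        linear_combination p * x * h1
      rwa [this]) he
  obtain ⟨a, ha⟩ := Ideal.mem_span_singleton'.1 this
  obtain ⟨u, hu⟩ := isUnit_one_add_mul_pIdem p a
  exact ⟨u, ⟨a, hu⟩, by rw [hu, ← ha]; ring⟩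

theorem one_add_mul_one_sub_pIdem (p : ℕ) (a : R) :
    (1 + (p : R) * pIdem R p * a) * (1 - pIdem R p) = 1 - pIdem R p := by
  have h1 := pIdem_mul_self (R := R) p
  linear_combination (-(p : R) * a) * h1

omit [Finite R] in
theorem prime_dvd_card_torsion {p : ℕ} (hp : p.Prime) {e : R} (h0 : e ≠ 0)
    (he : (p : R) * e = 0) : p ∣ {y : R | (p : R) * y = 0}.ncard := by
  have h := addOrderOf_dvd_natCard (G := (AddMonoidHom.mulLeft (p : R)).ker) ⟨e, he⟩
  have h1 : addOrderOf (⟨e, he⟩ : (AddMonoidHom.mulLeft (p : R)).ker) = p := by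
    have := Fact.mk hp
    refine addOrderOf_eq_prime ?_ ?_
    · ext
      simpa using he
    · intro h
      exact h0 (congrArg Subtype.val h)
  rw [h1] at h
  exact h

/-- Let `T` be stable under the units of the `p`-component. If `T` contains `x`, but not every
translate of `x` by an element killed by `p`, then the `p`-component of `x` is killed by `p`, and
the number of elements of `T` with the same multiple by `p` is prime to `p`. -/
theorem not_dvd_ncard_of_not_translate (hR : IsFieldModPrimes R) {p : ℕ} (hp : p.Prime) {T : Set R}
    (hT : ∀ u : Rˣ, (u : R) * (1 - pIdem R p) = 1 - pIdem R p → ∀ x ∈ T, (u : R) * x ∈ T)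
    {x e : R} (hx : x ∈ T) (he : (p : R) * e = 0) (hxe : x + e ∉ T) :
    (p : R) * (pIdem R p * x) = 0 ∧ ¬ p ∣ {y | y ∈ T ∧ p • y = p • x}.ncard := by
  have h1 := pIdem_mul_self (R := R) p
  have hpx : (p : R) * (pIdem R p * x) = 0 := by
    by_contra h
    obtain ⟨u, ⟨a, ha⟩, hu⟩ := exists_unit_mul_eq_add hR hp h he
    exact hxe (hu ▸ hT u (by rw [ha]; exact one_add_mul_one_sub_pIdem p a) x hx)
  refine ⟨hpx, ?_⟩
  set x' := (1 - pIdem R p) * x with hx'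
  set F : Set R := {y | (p : R) * y = 0 ∧ x' + y ∈ T} with hF
  have hcard : {y | y ∈ T ∧ p • y = p • x}.ncard = F.ncard := by
    have : {y | y ∈ T ∧ p • y = p • x} = (fun y => x' + y) '' F := by
      ext y
      constructor
      · rintro ⟨hy, hyx⟩
        rw [nsmul_eq_mul, nsmul_eq_mul] at hyx
        refine ⟨y - x', ⟨?_, by simpa using hy⟩, by simp⟩
        rw [hx']; linear_combination hyx + hpx
      · rintro ⟨z, ⟨hz, hzT⟩, rfl⟩
        refine ⟨hzT, ?_⟩
        rw [nsmul_eq_mul, nsmul_eq_mul, hx']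
        linear_combination hz - hpx
    rw [this, Set.ncard_image_of_injective _ (add_right_injective x')]
  rw [hcard]
  -- The units of the p-component permute transitively the nonzero elements of E = {y | py = 0}. As
  -- F is neither empty nor E, it is {0} or E \ {0}, of size 1 or −1 modulo p.
  have horb : ∀ y z : R, (p : R) * y = 0 → y ≠ 0 → (p : R) * z = 0 → z ≠ 0 → y ∈ F → z ∈ F := by
    intro y z hy hy0 hz hz0 hyF
    obtain ⟨u, hu, hyz⟩ := exists_unit_mul_eq_of_torsion hR hp hy hy0 hz hz0
    refine ⟨hz, ?_⟩
    have := hT u hu _ hyF.2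
    have h2 : (u : R) * (x' + y) = x' + z := by
      rw [hx']; linear_combination hyz + x * hu
    rwa [h2] at this
  have hxF : pIdem R p * x ∈ F := ⟨hpx, by rwa [hx', sub_mul, one_mul, sub_add_cancel]⟩
  have hyF : pIdem R p * x + e ∉ F := fun h => hxe (by
    have h2 : x' + (pIdem R p * x + e) = x + e := by rw [hx']; ring
    exact h2 ▸ h.2)
  have hy0 : (p : R) * (pIdem R p * x + e) = 0 := by linear_combination hpx + he
  have he0 : e ≠ 0 := by
    rintro rfl
    exact hyF (by simpa using hxF)
  by_cases hx0 : pIdem R p * x = 0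
  · have : F = {0} := by
      ext z
      constructor
      · intro hz
        by_contra hz0
        rw [hx0, zero_add] at hyF
        exact hyF (horb z e hz.1 hz0 he he0 hz)
      · rintro rfl
        rwa [hx0] at hxF
    rw [this, Set.ncard_singleton]
    exact hp.not_dvd_one
  · have hy00 : pIdem R p * x + e = 0 := by
      by_contra h
      exact hyF (horb _ _ hpx hx0 hy0 h hxF)
    have : F = {y : R | (p : R) * y = 0} \ {0} := by
      ext z
      constructor
      · intro hz
        refine ⟨hz.1, ?_⟩
        rintro rfl
        exact hyF (hy00 ▸ hz)
      · rintro ⟨hz, hz0⟩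
        exact horb _ _ hpx hx0 hz hz0 hxF
    have hd := prime_dvd_card_torsion hp he0 he
    have h3 := Set.ncard_sdiff_singleton_add_one (s := {y : R | (p : R) * y = 0}) (a := 0)
      (by simp) (Set.toFinite _)
    rw [← this] at h3
    rw [← h3] at hd
    intro h
    exact hp.not_dvd_one ((Nat.dvd_add_right h).1 hd)

theorem Ideal.exists_torsion_le (hR : IsFieldModPrimes R) {U : Ideal R} (hU : U ≠ ⊥) :
    ∃ p : ℕ, p.Prime ∧ (∀ e : R, (p : R) * e = 0 → e ∈ U) ∧ ∃ e : R, e ≠ 0 ∧ (p : R) * e = 0 := by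
  obtain ⟨a, ha, ha0⟩ := Submodule.exists_mem_ne_zero_of_ne_bot hU
  have ha1 : (⟨a, ha⟩ : U) ∉ (⊥ : AddSubgroup U) := fun h =>
    ha0 (congrArg Subtype.val (AddSubgroup.mem_bot.1 h))
  obtain ⟨p, hp, b, hb, hpb⟩ := AddSubgroup.exists_prime_nsmul_mem ha1
  have hb0 : (b : R) ≠ 0 := fun h => hb (AddSubgroup.mem_bot.2 (Subtype.ext h))
  have hpb' : (p : R) * (b : R) = 0 := by
    have := congrArg Subtype.val (AddSubgroup.mem_bot.1 hpb)
    simpa using this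
  refine ⟨p, hp, fun e he => U.torsion_mem hR hp b.2 ?_ he, b, hb0, hpb'⟩
  rwa [pIdem_mul_of_mul_eq_zero hpb']

end RingFacts

/-! ### A-ideals, stabilizing ideals and minimal A-ideals. -/

namespace SchurRing

section OverRing

variable {R : Type u} [CommRing R] [Finite R] {A : SchurRing R}

theorem IsOverRing.rel_mul (hA : A.IsOverRing) (u : Rˣ) {x y : R} (h : A.Rel x y) :
    A.Rel (u * x) (u * y) := by
  obtain ⟨X, hX, hx, hy⟩ := h
  exact ⟨u • X, hA u X hX, ⟨x, hx, rfl⟩, ⟨y, hy, rfl⟩⟩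

theorem IsOverRing.of_rel_mul (h : ∀ (u : Rˣ) (x y : R), A.Rel x y → A.Rel (u * x) (u * y)) :
    A.IsOverRing := by
  intro v X hX
  obtain ⟨x, rfl⟩ := mem_basicSets_iff.1 hX
  refine mem_basicSets_iff.2 ⟨v * x, ?_⟩
  ext y
  constructor
  · rintro ⟨z, hz, rfl⟩
    exact h v x z hz
  · intro hy
    refine ⟨(v⁻¹ : Rˣ) * y, ?_, ?_⟩
    · have := h v⁻¹ _ _ hy
      rwa [← mul_assoc, Units.inv_mul, one_mul] at this
    · change (v : R) * ((v⁻¹ : Rˣ) * y) = y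
      rw [← mul_assoc, Units.mul_inv, one_mul]

theorem IsOverRing.rel_mul_iff (hA : A.IsOverRing) (u : Rˣ) {x y : R} :
    A.Rel (u * x) y ↔ A.Rel x ((u⁻¹ : Rˣ) * y) := by
  constructor
  · intro h
    have := hA.rel_mul u⁻¹ h
    rwa [← mul_assoc, Units.inv_mul, one_mul] at this
  · intro h
    have := hA.rel_mul u h
    rwa [← mul_assoc, Units.mul_inv, one_mul] at this

/-- The unit multiples of D form an A-set, so the subgroup they generate is an A-subgroup. It is
stable under units, and the units generate R additively, so it is an ideal. -/
theorem IsOverRing.isAIdeal_span (hA : A.IsOverRing) (hR : IsFieldModPrimes R) {D : Set R}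
    (hD : A.IsASet D) : A.IsAIdeal (Ideal.span D) := by
  set D' : Set R := {x | ∃ u : Rˣ, (u : R) * x ∈ D}
  have hD' : A.IsASet D' := isASet_iff_rel.2 fun x y h ⟨u, hu⟩ =>
    ⟨u, (hD.mem_iff (hA.rel_mul u h)).1 hu⟩
  have hstable : ∀ u : Rˣ, ∀ x ∈ AddSubgroup.closure D', (u : R) * x ∈ AddSubgroup.closure D' := by
    intro u x hx
    induction hx using AddSubgroup.closure_induction with
    | mem x hx =>
      obtain ⟨v, hv⟩ := hx
      refine AddSubgroup.subset_closure ⟨v * u⁻¹, ?_⟩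
      rw [Units.val_mul, mul_assoc, ← mul_assoc ((u⁻¹ : Rˣ) : R), Units.inv_mul, one_mul]
      exact hv
    | zero => rw [mul_zero]; exact zero_mem _
    | add x y _ _ hx hy => rw [mul_add]; exact add_mem hx hy
    | neg x _ hx => rw [mul_neg]; exact neg_mem hx
  have key : (Ideal.span D : Set R) = AddSubgroup.closure D' := by
    apply Set.Subset.antisymm
    · let W : Ideal R :=
        { AddSubgroup.closure D' with
          smul_mem' := fun a x hx => AddSubgroup.mul_mem_of_units hR _ hstable a hx }
      have : Ideal.span D ≤ W := Ideal.span_le.2 fun x hx =>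
        AddSubgroup.subset_closure ⟨1, by simpa using hx⟩
      exact this
    · have : AddSubgroup.closure D' ≤ (Ideal.span D).toAddSubgroup := by
        rw [AddSubgroup.closure_le]
        rintro x ⟨u, hu⟩
        have h := (Ideal.span D).mul_mem_left ((u⁻¹ : Rˣ) : R) (Ideal.subset_span hu)
        rwa [← mul_assoc, Units.inv_mul, one_mul] at h
      exact this
  rw [IsAIdeal, key]
  exact hD'.closure

theorem IsAIdeal.sup {I J : Ideal R} (hI : A.IsAIdeal I) (hJ : A.IsAIdeal J) :
    A.IsAIdeal (I ⊔ J) := by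
  have : ((I ⊔ J : Ideal R) : Set R) = (I : Set R) + J := by
    ext x
    rw [SetLike.mem_coe, Submodule.mem_sup, Set.mem_add]
    rfl
  rw [IsAIdeal, this]
  exact IsASet.add hI hJ

theorem IsAIdeal.inf {I J : Ideal R} (hI : A.IsAIdeal I) (hJ : A.IsAIdeal J) :
    A.IsAIdeal (I ⊓ J) := IsASet.inter hI hJ

theorem IsAIdeal.mem_iff {I : Ideal R} (hI : A.IsAIdeal I) {x y : R} (h : A.Rel x y) :
    x ∈ I ↔ y ∈ I := IsASet.mem_iff hI h

theorem isAIdeal_top : A.IsAIdeal ⊤ := isASet_iff_rel.2 fun _ _ _ _ => Submodule.mem_top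

theorem isAIdeal_bot : A.IsAIdeal ⊥ := isASet_iff_rel.2 fun x y h hx => by
  obtain rfl : x = 0 := hx
  rw [rel_zero_left.1 h]
  exact Submodule.zero_mem _

/-- The largest ideal `I` with `T + I ⊆ T`. -/
def stabIdeal (T : Set R) : Ideal R where
  carrier := {g | ∀ a, ∀ x ∈ T, x + a * g ∈ T}
  zero_mem' := fun a x hx => by simpa using hx
  add_mem' := fun {g h} hg hh a x hx => by
    rw [mul_add, ← add_assoc]
    exact hh a _ (hg a x hx)
  smul_mem' := fun c g hg a x hx => by
    rw [smul_eq_mul, ← mul_assoc]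
    exact hg _ x hx

omit [Finite R] in
theorem add_mem_of_mem_stabIdeal {T : Set R} {g x : R} (hg : g ∈ stabIdeal T) (hx : x ∈ T) :
    x + g ∈ T := by simpa using hg 1 x hx

/-- An element g stabilizes T together with all its multiples iff every unit multiple of g does,
again because units generate R additively. The additive stabilizer is an A-set and basic sets are
permuted by units. -/
theorem IsOverRing.isAIdeal_stabIdeal (hA : A.IsOverRing) (hR : IsFieldModPrimes R) {T : Set R}
    (hT : A.IsASet T) : A.IsAIdeal (stabIdeal T) := by
  let M : AddSubmonoid R :=
    { carrier := {g | ∀ x ∈ T, x + g ∈ T}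
      zero_mem' := fun x hx => by simpa using hx
      add_mem' := fun {g h} hg hh x hx => by rw [← add_assoc]; exact hh _ (hg x hx) }
  let H : AddSubgroup R :=
    { M with
      neg_mem' := fun {g} hg => by
        have : -g = (Nat.card R - 1) • g := by
          have h1 : Nat.card R • g = 0 := card_nsmul_eq_zero'
          have h2 : Nat.card R = (Nat.card R - 1) + 1 := (Nat.sub_add_cancel Nat.card_pos).symm
          rw [h2, succ_nsmul] at h1
          exact (eq_neg_of_add_eq_zero_left h1).symm
        rw [this]
        exact nsmul_mem (show g ∈ M from hg) _ }
  have key : ∀ g, g ∈ stabIdeal T ↔ ∀ u : Rˣ, (u : R) * g ∈ H := by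
    intro g
    refine ⟨fun hg u => hg u, fun hg a => ?_⟩
    have : H.comap (AddMonoidHom.mulRight g) = ⊤ := AddSubgroup.eq_top_of_units_mem hR _ hg
    have h : a ∈ H.comap (AddMonoidHom.mulRight g) := this ▸ AddSubgroup.mem_top a
    exact h
  refine isASet_iff_rel.2 fun x y h hx => ?_
  rw [SetLike.mem_coe, key] at hx ⊢
  exact fun u => (hT.stabilizer.mem_iff (hA.rel_mul u h)).1 (hx u)

/-- The consequence of Schur's theorem on `p`-th powers used throughout: a stable `A`-set which is
not closed under translation by elements killed by `p` yields an `A`-ideal without `p`-part. -/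
theorem IsOverRing.exists_isAIdeal_of_not_translate (hA : A.IsOverRing) (hR : IsFieldModPrimes R)
    {p : ℕ} (hp : p.Prime) {T : Set R} (hTA : A.IsASet T)
    (hT : ∀ u : Rˣ, (u : R) * (1 - pIdem R p) = 1 - pIdem R p → ∀ x ∈ T, (u : R) * x ∈ T)
    {x e : R} (hx : x ∈ T) (he : (p : R) * e = 0) (hxe : x + e ∉ T) :
    ∃ U : Ideal R, A.IsAIdeal U ∧ (p : R) * x ∈ U ∧ (∀ y ∈ U, pIdem R p * y = 0) ∧
      (p : R) * (pIdem R p * x) = 0 := by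
  obtain ⟨h1, h2⟩ := not_dvd_ncard_of_not_translate hR hp hT hx he hxe
  have he0 : e ≠ 0 := by
    rintro rfl
    exact hxe (by simpa using hx)
  -- U is generated by the elements whose number of p-th roots in T is prime to p; these form an
  -- A-set by Schur's theorem.
  refine ⟨Ideal.span {z | ¬ p ∣ {x | x ∈ T ∧ p • x = z}.ncard},
    hA.isAIdeal_span hR (isASet_nsmul hTA hp), ?_, ?_, h1⟩
  · refine Ideal.subset_span ?_
    rw [← nsmul_eq_mul]
    exact h2
  · let W : Ideal R := LinearMap.ker (LinearMap.mulLeft R (pIdem R p))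
    have : Ideal.span {z | ¬ p ∣ {x | x ∈ T ∧ p • x = z}.ncard} ≤ W := by
      rw [Ideal.span_le]
      intro y hy
      rw [Set.mem_ofPred_eq] at hy
      obtain ⟨t, htT, rfl⟩ : {x | x ∈ T ∧ p • x = y}.Nonempty := by
        rw [Set.nonempty_iff_ne_empty]
        intro h
        rw [h] at hy
        simp at hy
      -- If T contains all these translates of t, the fibre over pt is a full coset of the
      -- p-torsion, of size divisible by p. Otherwise the p-part of pt vanishes.
      by_cases hall : ∀ e : R, (p : R) * e = 0 → t + e ∈ T
      · exfalso
        apply hy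
        have : {x | x ∈ T ∧ p • x = p • t} = (fun e => t + e) '' {e : R | (p : R) * e = 0} := by
          ext z
          constructor
          · rintro ⟨-, hz⟩
            rw [nsmul_eq_mul, nsmul_eq_mul] at hz
            exact ⟨z - t, by rw [Set.mem_ofPred_eq]; linear_combination hz, by simp⟩
          · rintro ⟨e, he, rfl⟩
            refine ⟨hall e he, ?_⟩
            rw [Set.mem_ofPred_eq] at he
            rw [nsmul_eq_mul, nsmul_eq_mul]
            linear_combination he
        rw [this, Set.ncard_image_of_injective _ (add_right_injective t)]
        exact prime_dvd_card_torsion hp he0 he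
      · push Not at hall
        obtain ⟨e', he', hte⟩ := hall
        have := (not_dvd_ncard_of_not_translate hR hp hT htT he' hte).1
        change pIdem R p * (p • t) = 0
        rw [nsmul_eq_mul]
        linear_combination this
    exact fun y hy => this hy

theorem isASet_orbit (A : SchurRing R) (z : R) :
    A.IsASet {t | ∃ u : Rˣ, A.Rel t (u * z)} :=
  isASet_iff_rel.2 fun _ _ h ⟨u, hu⟩ => ⟨u, h.symm.trans hu⟩

theorem IsOverRing.orbit_stable (hA : A.IsOverRing) {z t : R} (v : Rˣ)
    (ht : ∃ u : Rˣ, A.Rel t (u * z)) : ∃ u : Rˣ, A.Rel (v * t) (u * z) := by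
  obtain ⟨u, hu⟩ := ht
  refine ⟨v * u, ?_⟩
  rw [Units.val_mul, mul_assoc]
  exact hA.rel_mul v hu

/-- `V` is a minimal nonzero `A`-ideal. -/
def IsMinimalAIdeal (A : SchurRing R) (V : Ideal R) : Prop :=
  A.IsAIdeal V ∧ V ≠ ⊥ ∧ ∀ U : Ideal R, A.IsAIdeal U → U ≤ V → U ≠ ⊥ → V ≤ U

theorem exists_isMinimalAIdeal_le {J : Ideal R} (hJ : A.IsAIdeal J) (h : J ≠ ⊥) :
    ∃ V ≤ J, A.IsMinimalAIdeal V := by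
  have hfin : {U : Ideal R | A.IsAIdeal U ∧ U ≠ ⊥ ∧ U ≤ J}.Finite := Set.toFinite _
  obtain ⟨V, ⟨hV, hV0, hVJ⟩, hmin⟩ := hfin.exists_minimal ⟨J, hJ, h, le_rfl⟩
  exact ⟨V, hVJ, hV, hV0, fun U hU hUV hU0 => hmin ⟨hU, hU0, hUV.trans hVJ⟩ hUV⟩

theorem IsMinimalAIdeal.le_of_mem {V : Ideal R} (hV : A.IsMinimalAIdeal V) {U : Ideal R}
    (hU : A.IsAIdeal U) {e : R} (he : e ∈ V) (h0 : e ≠ 0) (heU : e ∈ U) : V ≤ U := by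
  refine (hV.2.2 (U ⊓ V) (hU.inf hV.1) inf_le_right ?_).trans inf_le_left
  intro h
  have : e ∈ U ⊓ V := ⟨heU, he⟩
  rw [h] at this
  exact h0 this

/-- Up to units, any two nonzero elements of a minimal `A`-ideal lie in the same basic set. -/
theorem IsMinimalAIdeal.exists_rel (hA : A.IsOverRing) (hR : IsFieldModPrimes R) {V : Ideal R}
    (hV : A.IsMinimalAIdeal V) {z w : R} (hz : z ∈ V) (hz0 : z ≠ 0) (hw : w ∈ V) (hw0 : w ≠ 0) :
    ∃ u : Rˣ, A.Rel z (u * w) := by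
  obtain ⟨p, hp, hEV, e, he0, he⟩ := Ideal.exists_torsion_le hR hV.2.1
  -- It suffices to compare each nonzero element with one fixed element e killed by p.
  have key : ∀ z ∈ V, z ≠ 0 → ∃ u : Rˣ, A.Rel e (u * z) := by
    intro z hz hz0
    set T := {t | ∃ u : Rˣ, A.Rel t (u * z)} with hTdef
    have hTA : A.IsASet T := A.isASet_orbit z
    have hTst : ∀ u : Rˣ, ∀ x ∈ T, (u : R) * x ∈ T := fun u x hx => hA.orbit_stable u hx
    have hTV : ∀ t ∈ T, t ∈ V := fun t ⟨u, hu⟩ => (hV.1.mem_iff hu).2 (V.mul_mem_left _ hz)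
    have hzT : z ∈ T := ⟨1, by simpa using Rel.refl A z⟩
    have h0T : (0 : R) ∉ T := by
      rintro ⟨u, hu⟩
      have := rel_zero_left.1 hu
      exact hz0 ((Units.mul_right_eq_zero u).1 this)
    -- If e ∉ T, then T has no element killed by p, since the nonzero ones are all associate to e.
    -- By Schur's theorem and minimality of V, T is then stable under V, and z − z = 0 would lie in
    -- T.
    by_contra heT
    have hnoT : ∀ x ∈ T, (p : R) * x ≠ 0 := by
      intro x hx hpx
      obtain ⟨u, -, hu⟩ := exists_unit_mul_eq_of_torsion hR hp hpx
        (fun h => h0T (h ▸ hx)) he he0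
      exact heT (hu ▸ hTst u x hx)
    have hET : ∀ e' : R, (p : R) * e' = 0 → e' ∈ stabIdeal T := by
      intro e' he' a x hx
      by_contra hxe
      obtain ⟨U, hU, hpxU, hUp, -⟩ := hA.exists_isAIdeal_of_not_translate hR hp hTA
        (fun u _ => hTst u) hx (by rw [mul_left_comm, he', mul_zero]) hxe
      have h1 := hV.le_of_mem hU (V.mul_mem_left p (hTV x hx)) (hnoT x hx) hpxU
      have h2 := hUp e (h1 (hEV e he))
      rw [pIdem_mul_of_mul_eq_zero he] at h2
      exact he0 h2
    have h1 := hV.le_of_mem (hA.isAIdeal_stabIdeal hR hTA) (hEV e he) he0 (hET e he)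
    have := add_mem_of_mem_stabIdeal (h1 (V.neg_mem hz)) hzT
    rw [add_neg_cancel] at this
    exact h0T this
  obtain ⟨u, hu⟩ := key z hz hz0
  obtain ⟨v, hv⟩ := key w hw hw0
  refine ⟨u⁻¹ * v, ?_⟩
  have := (hA.rel_mul_iff u).1 (hu.symm.trans hv)
  rwa [Units.val_mul, mul_assoc]

end OverRing
end SchurRing

/-- For a lift a with idempotent power ε, the element aε + (1 − ε) is a unit, and ε maps to 1. -/
theorem exists_units_map_eq {R R' : Type*} [CommRing R] [Finite R] [CommRing R'] (f : R →+* R')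
    (hf : Function.Surjective f) (u : R'ˣ) : ∃ v : Rˣ, f v = u := by
  obtain ⟨a, ha⟩ := hf u
  obtain ⟨k, hk⟩ := exists_isIdempotentElem_pow_succ a
  have hk' : a ^ (k + 1) * a ^ (k + 1) = a ^ (k + 1) := hk
  have h1 : f (a ^ (k + 1)) = 1 := by
    have h2 : f (a ^ (k + 1)) * f (a ^ (k + 1)) = f (a ^ (k + 1)) := by rw [← map_mul, hk']
    rw [map_pow, ha, ← Units.val_pow_eq_pow_val] at h2 ⊢
    exact (u ^ (k + 1)).mul_right_inj.1 (h2.trans (mul_one _).symm)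
  have h3 : (a * a ^ (k + 1) + (1 - a ^ (k + 1))) * (a ^ k * a ^ (k + 1) + (1 - a ^ (k + 1))) = 1 := by
    linear_combination (a ^ (k + 1) + 2 - a - a ^ k) * hk'
  refine ⟨⟨_, _, h3, by rw [mul_comm, h3]⟩, ?_⟩
  simp only [map_add, map_mul, map_sub, h1, ha, map_one]
  ring

instance Ideal.finite_quotient {R : Type*} [CommRing R] [Finite R] (V : Ideal R) :
    Finite (R ⧸ V) := Finite.of_surjective _ Ideal.Quotient.mk_surjective

namespace SchurRing

/-! ### Quotients by A-ideals. -/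

section Quotient

variable {R : Type u} [CommRing R] [Finite R] {A : SchurRing R} {V : Ideal R}

omit [Finite R] in
theorem preimage_mk_zero (V : Ideal R) :
    (Ideal.Quotient.mk V : R →+ R ⧸ V) ⁻¹' {0} = (V : Set R) := by
  ext x
  exact Ideal.Quotient.eq_zero_iff_mem

/-- The Schur ring over the quotient by an `A`-ideal. -/
def quot (A : SchurRing R) (V : Ideal R) (hV : A.IsAIdeal V) : SchurRing (R ⧸ V) :=
  A.push (Ideal.Quotient.mk V : R →+ R ⧸ V) Ideal.Quotient.mk_surjective (by
    rw [preimage_mk_zero]; exact hV)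

variable (hV : A.IsAIdeal V)

theorem rel_quot (z w : R ⧸ V) : (A.quot V hV).Rel z w ↔
    ∃ x y, Ideal.Quotient.mk V x = z ∧ Ideal.Quotient.mk V y = w ∧ A.Rel x y :=
  rel_push _ _ z w

theorem rel_quot_mk {x y : R} (h : A.Rel x y) :
    (A.quot V hV).Rel (Ideal.Quotient.mk V x) (Ideal.Quotient.mk V y) :=
  (rel_quot hV _ _).2 ⟨x, y, rfl, rfl, h⟩

theorem exists_rel_of_rel_quot {x y : R}
    (h : (A.quot V hV).Rel (Ideal.Quotient.mk V x) (Ideal.Quotient.mk V y)) :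
    ∃ v ∈ V, A.Rel x (y + v) := by
  obtain ⟨z, hz, h'⟩ := PushRel.lift (π := (Ideal.Quotient.mk V : R →+ R ⧸ V)) (by
    rw [preimage_mk_zero]; exact hV) ((rel_push _ _ _ _).1 h)
  exact ⟨z - y, Ideal.Quotient.eq.1 hz, by simpa using h'⟩

theorem isAIdeal_quot (U : Ideal (R ⧸ V)) :
    (A.quot V hV).IsAIdeal U ↔ A.IsAIdeal (U.comap (Ideal.Quotient.mk V)) :=
  isASet_push _ _ _

theorem IsOverRing.quot (hA : A.IsOverRing) : (A.quot V hV).IsOverRing := by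
  refine IsOverRing.of_rel_mul fun u z w h => ?_
  obtain ⟨v, hv⟩ := exists_units_map_eq (Ideal.Quotient.mk V) Ideal.Quotient.mk_surjective u
  obtain ⟨x, y, rfl, rfl, hxy⟩ := (rel_quot hV z w).1 h
  rw [← hv, ← map_mul, ← map_mul]
  exact rel_quot_mk hV (hA.rel_mul v hxy)

end Quotient

/-! ### Counting outside a maximal A-ideal. -/

section Maximal

variable {R : Type u} [CommRing R] [Finite R] {A : SchurRing R} {I : Ideal R}

theorem mem_maximalAIdeals :
    I ∈ A.maximalAIdeals ↔ Maximal (fun I' => A.IsAIdeal I' ∧ I' ≠ ⊤) I := Iff.rfl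

theorem isAIdeal_of_maximal (hI : I ∈ A.maximalAIdeals) : A.IsAIdeal I :=
  (mem_maximalAIdeals.1 hI).prop.1

theorem eq_top_of_maximal (hI : I ∈ A.maximalAIdeals) {U : Ideal R} (hU : A.IsAIdeal U)
    (h : ¬ U ≤ I) : I ⊔ U = ⊤ := by
  by_contra hne
  exact h (le_sup_right.trans ((mem_maximalAIdeals.1 hI).le_of_ge
    ⟨(isAIdeal_of_maximal hI).sup hU, hne⟩ le_sup_left))

/-- Up to units, any two elements outside a maximal `A`-ideal `I` lie in the same basic set
modulo `I`. -/
theorem exists_rel_of_notMem (hA : A.IsOverRing) (hR : IsFieldModPrimes R)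
    (hI : I ∈ A.maximalAIdeals) {x y : R} (hx : x ∉ I) (hy : y ∉ I) :
    ∃ u : Rˣ, ∃ i ∈ I, A.Rel x (u * y + i) := by
  have hIA := isAIdeal_of_maximal hI
  -- Maximality of I makes R/I a minimal A-ideal of the quotient, so `IsMinimalAIdeal.exists_rel`
  -- applies.
  have hmin : (A.quot I hIA).IsMinimalAIdeal ⊤ := by
    refine ⟨isAIdeal_top, fun h => ?_, fun U hU _ hU0 => ?_⟩
    · apply hx
      rw [← Ideal.Quotient.eq_zero_iff_mem, ← Ideal.mem_bot, ← h]
      exact Submodule.mem_top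
    · rw [isAIdeal_quot] at hU
      by_contra hne
      apply hU0
      have hle : U.comap (Ideal.Quotient.mk I) ≤ I := by
        by_contra hn
        have h1 := eq_top_of_maximal hI hU hn
        have h2 : I ≤ U.comap (Ideal.Quotient.mk I) := fun a ha => by
          rw [Ideal.mem_comap, Ideal.Quotient.eq_zero_iff_mem.2 ha]
          exact U.zero_mem
        rw [sup_eq_right.2 h2, Ideal.comap_eq_top_iff] at h1
        exact hne h1.ge
      rw [eq_bot_iff]
      intro z hz
      obtain ⟨a, rfl⟩ := Ideal.Quotient.mk_surjective z
      exact Ideal.mem_bot.2 (Ideal.Quotient.eq_zero_iff_mem.2 (hle hz))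
  obtain ⟨u, hu⟩ := hmin.exists_rel (hA.quot hIA)
    (hR.of_surjective (Ideal.Quotient.mk I) Ideal.Quotient.mk_surjective)
    (z := Ideal.Quotient.mk I x) (w := Ideal.Quotient.mk I y)
    Submodule.mem_top (fun h => hx (Ideal.Quotient.eq_zero_iff_mem.1 h))
    Submodule.mem_top (fun h => hy (Ideal.Quotient.eq_zero_iff_mem.1 h))
  obtain ⟨v, hv⟩ := exists_units_map_eq (Ideal.Quotient.mk I) Ideal.Quotient.mk_surjective u
  rw [← hv, ← map_mul] at hu
  obtain ⟨i, hi, h⟩ := exists_rel_of_rel_quot hIA hu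
  exact ⟨v, i, hi, h⟩

/-- A basic set outside a maximal `A`-ideal `I` is distributed evenly over the ideals
containing `I`. -/
theorem exists_card_mul_ncard_inter (hA : A.IsOverRing) (hR : IsFieldModPrimes R)
    (hI : I ∈ A.maximalAIdeals) {x : R} (hx : x ∉ I) :
    ∃ h : ℕ, ∀ U : Ideal R, I ≤ U →
      Nat.card Rˣ * Nat.card I * ({y | A.Rel x y} ∩ U : Set R).ncard =
        h * (Nat.card U - Nat.card I) := by
  classical
  have := Fintype.ofFinite R
  have hIA := isAIdeal_of_maximal hI
  set X : Set R := {y | A.Rel x y} with hX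
  have hXA : A.IsASet X := A.isASet_rel x
  have hXI : ∀ y ∈ X, y ∉ I := fun y hy h => hx ((hIA.mem_iff hy).2 h)
  -- The number of pairs (u, y) with u a unit, y ∈ X and uz ≡ y modulo I. It is invariant under
  -- basic sets, I-translation and units, hence constant outside I.
  let H : R → ℕ := fun z => ∑ u : Rˣ, {y | y ∈ X ∧ (u : R) * z - y ∈ (I : Set R)}.ncard
  have hrel : ∀ z w, A.Rel z w → H z = H w := fun z w h =>
    Finset.sum_congr rfl fun u _ => ncard_add_eq hXA hIA (hA.rel_mul u h)
  have hadd : ∀ z, ∀ i ∈ I, H (z + i) = H z := by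
    intro z i hi
    refine Finset.sum_congr rfl fun u _ => ?_
    congr 1
    ext y
    refine and_congr_right fun _ => ?_
    rw [show (u : R) * (z + i) - y = ((u : R) * z - y) + u * i by ring]
    exact I.add_mem_iff_left (I.mul_mem_left _ hi)
  have hmul : ∀ z, ∀ v : Rˣ, H (v * z) = H z := by
    intro z v
    refine Fintype.sum_equiv (Equiv.mulRight v) _ _ fun u => ?_
    simp [mul_assoc]
  have hconst : ∀ z, z ∉ I → H z = H x := by
    intro z hz
    obtain ⟨u, i, hi, h⟩ := exists_rel_of_notMem hA hR hI hz hx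
    rw [hrel _ _ h, hadd _ i hi, hmul]
  refine ⟨H x, fun U hIU => ?_⟩
  have hcardS : (U \ I : Set R).ncard = Nat.card U - Nat.card I := by
    rw [Set.ncard_sdiff hIU (Set.toFinite _)]
    rfl
  have e1 : ∑ z ∈ (U \ I : Set R).toFinset, H z = H x * (Nat.card U - Nat.card I) := by
    rw [Finset.sum_congr rfl fun z hz => hconst z (Set.mem_toFinset.1 hz).2, Finset.sum_const,
      ← hcardS, Set.ncard_eq_toFinset_card', smul_eq_mul, mul_comm]
  rw [← e1]
  simp only [H]
  rw [Finset.sum_comm, mul_assoc, Nat.card_eq_fintype_card (α := Rˣ), ← Finset.card_univ]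
  rw [← smul_eq_mul, ← Finset.sum_const]
  refine Finset.sum_congr rfl fun u _ => ?_
  have e2 : ∀ z, {y | y ∈ X ∧ (u : R) * z - y ∈ (I : Set R)}.ncard =
      ((Finset.univ : Finset R).filter fun y => y ∈ X ∧ (u : R) * z - y ∈ (I : Set R)).card := by
    intro z
    rw [← Set.ncard_coe_finset]
    congr 1; ext; simp
  simp_rw [e2]
  rw [← Finset.sum_congr rfl fun z _ => rfl]
  -- Double counting for fixed u: each y ∈ X ∩ U is met by exactly the |I| elements z of u⁻¹(y + I),
  -- all in U \ I; other y are never met.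
  have e3 := Finset.sum_card_bipartiteAbove_eq_sum_card_bipartiteBelow
    (s := (U \ I : Set R).toFinset) (t := (Finset.univ : Finset R))
    (fun z y => y ∈ X ∧ (u : R) * z - y ∈ (I : Set R))
  simp only [Finset.bipartiteAbove, Finset.bipartiteBelow] at e3
  rw [e3, ← Finset.sum_subset (Finset.subset_univ (X ∩ U : Set R).toFinset)]
  · rw [Finset.sum_const_nat (m := Nat.card I), Set.ncard_eq_toFinset_card', mul_comm]
    intro y hy
    obtain ⟨hyX, hyU⟩ := Set.mem_toFinset.1 hy
    have : (((U \ I : Set R).toFinset.filter fun z => y ∈ X ∧ (u : R) * z - y ∈ (I : Set R) :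
        Finset R) : Set R) = (fun i => ((u⁻¹ : Rˣ) : R) * (y + i)) '' I := by
      ext z
      simp only [Finset.coe_filter, Set.mem_toFinset, Set.mem_ofPred_eq, Set.mem_image]
      constructor
      · rintro ⟨-, -, h⟩
        refine ⟨_, h, ?_⟩
        rw [add_sub_cancel, ← mul_assoc, Units.inv_mul, one_mul]
      · rintro ⟨i, hi, rfl⟩
        have h1 : (u : R) * (((u⁻¹ : Rˣ) : R) * (y + i)) - y = i := by
          rw [← mul_assoc, Units.mul_inv, one_mul, add_sub_cancel_left]
        refine ⟨⟨U.mul_mem_left _ (U.add_mem hyU (hIU hi)), fun h => hXI y hyX ?_⟩, hyX, ?_⟩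
        · have h2 := I.sub_mem (I.mul_mem_left (u : R) h) hi
          rwa [← mul_assoc, Units.mul_inv, one_mul, add_sub_cancel_right] at h2
        · rw [h1]; exact hi
    rw [← Set.ncard_coe_finset, this, Set.ncard_image_of_injective]
    · rfl
    · intro a b h
      simpa using (Units.mul_right_inj u⁻¹).1 h
  · intro y _ hy
    rw [Finset.card_eq_zero, Finset.filter_eq_empty_iff]
    rintro z hz ⟨hyX, h⟩
    apply hy
    rw [Set.mem_toFinset] at hz ⊢
    refine ⟨hyX, ?_⟩
    have := U.sub_mem (U.mul_mem_left (u : R) hz.1) (hIU h)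
    rwa [sub_sub_cancel] at this

/-- By `exists_card_mul_ncard_inter` the two cardinalities are in the ratio |U| − |I| to |R| − |I|.
This is below one half even if |U| = |R|/2, because |I| > 0. -/
theorem two_mul_ncard_inter_lt (hA : A.IsOverRing) (hR : IsFieldModPrimes R)
    (hI : I ∈ A.maximalAIdeals) {x : R} (hx : x ∉ I) {U : Ideal R} (hIU : I ≤ U)
    (hU : 2 * Nat.card U ≤ Nat.card R) :
    2 * ({y | A.Rel x y} ∩ U : Set R).ncard < ({y | A.Rel x y} : Set R).ncard := by
  obtain ⟨h, hh⟩ := exists_card_mul_ncard_inter hA hR hI hx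
  have h1 := hh U hIU
  have h2 := hh ⊤ le_top
  have hI0 : 0 < Nat.card I := Nat.card_pos
  have hIU' : Nat.card I ≤ Nat.card U := Nat.card_mono (Set.toFinite (U : Set R)) hIU
  have htop : Nat.card (⊤ : Ideal R) = Nat.card R :=
    Nat.card_congr (Equiv.Set.univ R)
  rw [Submodule.top_coe, Set.inter_univ, htop] at h2
  have hX0 : 0 < ({y | A.Rel x y} : Set R).ncard :=
    (Set.ncard_pos (Set.toFinite _)).2 ⟨x, Rel.refl A x⟩
  set c := Nat.card Rˣ * Nat.card I
  have hc : 0 < c := Nat.mul_pos Nat.card_pos hI0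
  have hpos : 0 < h * (Nat.card R - Nat.card I) := h2 ▸ Nat.mul_pos hc hX0
  have hh0 : 0 < h := Nat.pos_of_mul_pos_right hpos
  refine lt_of_mul_lt_mul_left (a := c) ?_ (Nat.zero_le _)
  rw [h2, mul_left_comm, h1, mul_left_comm]
  exact Nat.mul_lt_mul_of_pos_left (by omega) hh0

/-- Let `V` be a minimal `A`-ideal, and suppose that most elements of the basic sets outside the
maximal `A`-ideal `I` can be translated by the elements of `V` killed by `p`. Then any two elements
outside `I` which are congruent modulo `V` lie in the same basic set. -/
theorem rel_of_sub_mem_of_translate (hA : A.IsOverRing) (hR : IsFieldModPrimes R)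
    (hI : I ∈ A.maximalAIdeals) {U : Ideal R} (hIU : I ≤ U) (hU : 2 * Nat.card U ≤ Nat.card R)
    {V : Ideal R} (hV : A.IsMinimalAIdeal V) {e : R} (heV : e ∈ V) (he0 : e ≠ 0)
    (htr : ∀ x, x ∉ U → ∀ u : Rˣ, A.Rel x (x + u * e)) {x y : R} (hx : x ∉ I) (hy : y ∉ I)
    (hxy : x - y ∈ V) : A.Rel x y := by
  classical
  have := Fintype.ofFinite R
  -- A basic set outside I fills more than half of each coset of V that it meets.
  have key : ∀ x, x ∉ I → Nat.card V < 2 * {y | y ∈ {y | A.Rel x y} ∧ x - y ∈ (V : Set R)}.ncard := by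
    intro x hx
    set X : Set R := {y | A.Rel x y} with hX
    have hXA : A.IsASet X := A.isASet_rel x
    have hlt : 2 * (X ∩ U).ncard < X.ncard := two_mul_ncard_inter_lt hA hR hI hx hIU hU
    -- A nonzero z ∈ V is related to some ue, and translation by ue can leave X only from X ∩ U,
    -- which is less than half of X.
    have hγ : ∀ z ∈ V, X.ncard < 2 * {y | y ∈ X ∧ y + z ∈ X}.ncard := by
      intro z hz
      by_cases hz0 : z = 0
      · subst hz0
        have : {y | y ∈ X ∧ y + 0 ∈ X} = X := by ext; simp
        rw [this]
        omega
      · obtain ⟨u, hu⟩ := hV.exists_rel hA hR hz hz0 heV he0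
        rw [ncard_sub_eq hXA hu]
        have hsub : X \ U ⊆ {y | y ∈ X ∧ y + u * e ∈ X} := fun y hy =>
          ⟨hy.1, (hXA.mem_iff (htr y hy.2 u)).1 hy.1⟩
        have h1 := Set.ncard_le_ncard hsub (Set.toFinite _)
        have h2 := Set.ncard_inter_add_ncard_sdiff_eq_ncard X U (Set.toFinite _)
        omega
    have hv : ∀ y ∈ X, {w | w ∈ X ∧ x - w ∈ (V : Set R)}.ncard =
        {w | w ∈ X ∧ y - w ∈ (V : Set R)}.ncard := fun y hy => ncard_add_eq hXA hV.1 hy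
    set v := {w | w ∈ X ∧ x - w ∈ (V : Set R)}.ncard
    -- Counting pairs of elements of X with difference in V; every coset of V that meets X contains
    -- v of its elements.
    have hsum : ∑ z ∈ (V : Set R).toFinset, {y | y ∈ X ∧ y + z ∈ X}.ncard = X.ncard * v := by
      have e3 := Finset.sum_card_bipartiteAbove_eq_sum_card_bipartiteBelow
        (s := (V : Set R).toFinset) (t := X.toFinset) (fun z y => y + z ∈ X)
      simp only [Finset.bipartiteAbove, Finset.bipartiteBelow] at e3
      have e1 : ∀ z, {y | y ∈ X ∧ y + z ∈ X}.ncard =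
          (X.toFinset.filter fun y => y + z ∈ X).card := by
        intro z
        rw [← Set.ncard_coe_finset]
        congr 1; ext; simp
      simp_rw [e1]
      rw [e3, Finset.sum_const_nat (m := v), Set.ncard_eq_toFinset_card']
      intro y hy
      rw [hv y (Set.mem_toFinset.1 hy), ← Set.ncard_coe_finset]
      have : {w | w ∈ X ∧ y - w ∈ (V : Set R)} = (fun z => y + z) ''
          (((V : Set R).toFinset.filter fun z => y + z ∈ X : Finset R) : Set R) := by
        ext w
        simp only [Finset.coe_filter, Set.mem_toFinset, Set.mem_ofPred_eq, Set.mem_image]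
        constructor
        · rintro ⟨hw, h⟩
          have := V.neg_mem h
          rw [neg_sub] at this
          exact ⟨w - y, ⟨this, by simpa using hw⟩, by simp⟩
        · rintro ⟨z, ⟨hz, h⟩, rfl⟩
          have := V.neg_mem hz
          exact ⟨h, by simpa using this⟩
      rw [this, Set.ncard_image_of_injective _ (add_right_injective y)]
    have hcard : Nat.card V = (V : Set R).toFinset.card := by
      rw [← Set.ncard_eq_toFinset_card']; rfl
    have hX0 : 0 < X.ncard := (Set.ncard_pos (Set.toFinite _)).2 ⟨x, Rel.refl A x⟩
    have : (V : Set R).toFinset.card * X.ncard <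
        ∑ z ∈ (V : Set R).toFinset, 2 * {y | y ∈ X ∧ y + z ∈ X}.ncard := by
      rw [← smul_eq_mul, ← Finset.sum_const]
      exact Finset.sum_lt_sum_of_nonempty ⟨0, by simp⟩
        fun z hz => hγ z (by simpa using hz)
    rw [← Finset.mul_sum, hsum, ← hcard] at this
    refine lt_of_mul_lt_mul_right (a := X.ncard) ?_ (Nat.zero_le _)
    calc _ < _ := this
      _ = _ := by ring
  -- Two basic sets that each fill more than half of x + V must meet.
  have h1 := key x hx
  have h2 := key y hy
  have hsub : ({z | z ∈ {z | A.Rel x z} ∧ x - z ∈ (V : Set R)} ∪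
      {z | z ∈ {z | A.Rel y z} ∧ y - z ∈ (V : Set R)}) ⊆ (fun v => x - v) '' V := by
    rintro z (⟨-, hz⟩ | ⟨-, hz⟩)
    · exact ⟨_, hz, by simp⟩
    · refine ⟨x - z, ?_, by simp⟩
      have := V.add_mem hxy hz
      rwa [sub_add_sub_cancel] at this
  have h3 := Set.ncard_le_ncard hsub (Set.toFinite _)
  rw [Set.ncard_image_of_injective _ (sub_right_injective)] at h3
  have h4 := Set.ncard_union_add_ncard_inter {z | z ∈ {z | A.Rel x z} ∧ x - z ∈ (V : Set R)}
    {z | z ∈ {z | A.Rel y z} ∧ y - z ∈ (V : Set R)} (Set.toFinite _) (Set.toFinite _)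
  have h5 : (V : Set R).ncard = Nat.card V := rfl
  obtain ⟨z, ⟨hz, -⟩, ⟨hz', -⟩⟩ := (Set.ncard_pos (Set.toFinite
    ({z | z ∈ {z | A.Rel x z} ∧ x - z ∈ (V : Set R)} ∩
    {z | z ∈ {z | A.Rel y z} ∧ y - z ∈ (V : Set R)}))).1 (by omega)
  exact Rel.trans hz (Rel.symm hz')

end Maximal
end SchurRing

namespace SchurRing

/-! ### Fourier transform, dual classes of characters and averaging over a coprime group. -/

section Duality

variable {G : Type*} [AddCommGroup G] [Finite G] [Fintype G]

/-- The Fourier transform. -/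
def fourier (f : G → ℂ) (χ : AddChar G ℂ) : ℂ := ∑ x, f x * χ x

/-- The functions which are constant on the basic sets. -/
def Inv (A : SchurRing G) (f : G → ℂ) : Prop := ∀ x y, A.Rel x y → f x = f y

variable {A : SchurRing G}

omit [Finite G] in
theorem fourier_conv (f g : G → ℂ) (χ : AddChar G ℂ) :
    fourier (fun z => ∑ x, f x * g (z - x)) χ = fourier f χ * fourier g χ := by
  simp only [fourier]
  rw [Finset.sum_mul_sum]
  simp_rw [Finset.sum_mul]
  rw [Finset.sum_comm]
  refine Finset.sum_congr rfl fun x _ => ?_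
  refine Fintype.sum_equiv (Equiv.subRight x) _ _ fun z => ?_
  have : χ z = χ x * χ (z - x) := by rw [← AddChar.map_add_eq_mul]; simp
  simp only [Equiv.subRight_apply, this]
  ring

theorem sum_fourier_mul (f : G → ℂ) (y : G) :
    ∑ χ, fourier f χ * χ (-y) = Fintype.card G * f y := by
  classical
  simp only [fourier, Finset.sum_mul]
  rw [Finset.sum_comm]
  have : ∀ x, ∑ χ : AddChar G ℂ, f x * χ x * χ (-y) = if x = y then Fintype.card G * f y else 0 := by
    intro x
    simp_rw [mul_assoc, ← AddChar.map_add_eq_mul, ← Finset.mul_sum, AddChar.sum_apply_eq_ite]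
    by_cases h : x = y
    · simp [h, mul_comm]
    · rw [if_neg h, if_neg (fun h' => h (by rwa [← sub_eq_add_neg, sub_eq_zero] at h')), mul_zero]
  simp [this]

theorem Inv.conv {f g : G → ℂ} (hf : A.Inv f) (hg : A.Inv g) :
    A.Inv fun z => ∑ x, f x * g (z - x) := by
  intro z w h
  refine sum_mul_sub_eq (r := A.Rel) (fun X Y hX hY z w h => ?_) hf hg h
  exact ncard_add_eq (isASet_iff_rel.2 fun x y h => (hX x y h).1)
    (isASet_iff_rel.2 fun x y h => (hY x y h).1) h

/-- The equivalence of characters dual to a Schur ring. -/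
def DualRel (A : SchurRing G) (χ ψ : AddChar G ℂ) : Prop :=
  ∀ f, A.Inv f → fourier f χ = fourier f ψ

/-- Transforms of invariant functions form an algebra under pointwise product that separates the
dual classes; Lagrange interpolation then yields the indicator of one class. -/
theorem exists_fourier_eq_indicator (A : SchurRing G) (χ : AddChar G ℂ) :
    ∃ g, A.Inv g ∧ (∀ ψ, A.DualRel χ ψ → fourier g ψ = 1) ∧
      ∀ ψ, ¬ A.DualRel χ ψ → fourier g ψ = 0 := by
  classical
  have hδ : A.Inv fun x => if x = 0 then 1 else 0 := by
    intro x y h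
    have : x = 0 ↔ y = 0 := ⟨fun hx => rel_zero_left.1 (hx ▸ h), fun hy => rel_zero_left.1 (hy ▸ h.symm)⟩
    simp only [this]
  have hFδ : ∀ ψ : AddChar G ℂ, fourier (fun x => if x = 0 then 1 else 0) ψ = 1 := by
    intro ψ
    simp [fourier]
  have key : ∀ s : Finset (AddChar G ℂ), (∀ ψ ∈ s, ¬ A.DualRel χ ψ) →
      ∃ g, A.Inv g ∧ fourier g χ = 1 ∧ ∀ ψ ∈ s, fourier g ψ = 0 := by
    intro s
    induction s using Finset.induction_on with
    | empty => exact fun _ => ⟨_, hδ, hFδ χ, by simp⟩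
    | insert φ s _ ih =>
      intro hs
      obtain ⟨g, hg, hg1, hgs⟩ := ih fun ψ hψ => hs ψ (Finset.mem_insert_of_mem hψ)
      have hφ := hs φ (Finset.mem_insert_self _ _)
      simp only [DualRel, not_forall] at hφ
      obtain ⟨f, hf, hne⟩ := hφ
      -- The interpolation factor: its transform is 1 at χ and 0 at φ.
      let k : G → ℂ := fun x =>
        (fourier f χ - fourier f φ)⁻¹ * (f x - fourier f φ * if x = 0 then 1 else 0)
      have hk : A.Inv k := by
        intro x y h
        simp only [k, hf x y h, hδ x y h]
      have hFk : ∀ ψ, fourier k ψ =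
          (fourier f χ - fourier f φ)⁻¹ * (fourier f ψ - fourier f φ) := by
        intro ψ
        have h1 := hFδ ψ
        simp only [fourier] at h1 ⊢
        simp only [k]
        simp_rw [mul_assoc, sub_mul, ← Finset.mul_sum, Finset.sum_sub_distrib, mul_assoc,
          ← Finset.mul_sum, h1, mul_one]
        rfl
      refine ⟨_, hg.conv hk, ?_, ?_⟩
      · rw [fourier_conv, hg1, one_mul, hFk, inv_mul_cancel₀ (sub_ne_zero.2 hne)]
      · intro ψ hψ
        rw [fourier_conv]
        rcases Finset.mem_insert.1 hψ with rfl | hψ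
        · rw [hFk, sub_self, mul_zero, mul_zero]
        · rw [hgs ψ hψ, zero_mul]
  obtain ⟨g, hg, hg1, hg0⟩ := key (Finset.univ.filter fun ψ => ¬ A.DualRel χ ψ) (by simp)
  refine ⟨g, hg, fun ψ hψ => ?_, fun ψ hψ => hg0 ψ (by simpa using hψ)⟩
  rw [← hψ g hg, hg1]

/-- The characters that are trivial on a subgroup. -/
def annihilator (I : AddSubgroup G) : Subgroup (AddChar G ℂ) where
  carrier := {π | ∀ x ∈ I, π x = 1}
  one_mem' := fun x _ => AddChar.one_apply x
  mul_mem' := fun {a b} ha hb x hx => by rw [AddChar.mul_apply, ha x hx, hb x hx, one_mul]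
  inv_mem' := fun {a} ha x hx => by rw [AddChar.inv_apply]; exact ha _ (neg_mem hx)

instance fintypeAnnihilator (I : AddSubgroup G) : Fintype (annihilator I) := Fintype.ofFinite _

omit [Fintype G] in
theorem sum_annihilator_apply (I : AddSubgroup G) [DecidablePred (· ∈ I)] (x : G) :
    ∑ π : annihilator I, (π : AddChar G ℂ) x =
      if x ∈ I then (Fintype.card (annihilator I) : ℂ) else 0 := by
  classical
  split_ifs with h
  · rw [Finset.sum_congr rfl fun π _ => π.2 x h]
    simp
  · obtain ⟨ψ, hψ⟩ : ∃ ψ : AddChar (G ⧸ I) ℂ, ψ (x : G ⧸ I) ≠ 1 :=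
      AddChar.exists_apply_ne_zero.2 fun h' => h ((QuotientAddGroup.eq_zero_iff x).1 h')
    let π₀ : annihilator I := ⟨ψ.compAddMonoidHom (QuotientAddGroup.mk' I), fun y hy => by
      have : (QuotientAddGroup.mk' I) y = 0 := (QuotientAddGroup.eq_zero_iff y).2 hy
      rw [AddChar.compAddMonoidHom_apply, this, AddChar.map_zero_eq_one]⟩
    have h1 : ∑ π : annihilator I, (π : AddChar G ℂ) x =
        ∑ π : annihilator I, ((π₀ * π : annihilator I) : AddChar G ℂ) x :=
      (Fintype.sum_equiv (Equiv.mulLeft π₀) _ _ fun π => rfl).symm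
    simp only [Subgroup.coe_mul, AddChar.mul_apply, ← Finset.mul_sum] at h1
    have h2 : (π₀ : AddChar G ℂ) x ≠ 1 := hψ
    by_contra h0
    exact h2 (mul_right_cancel₀ h0 (by rw [one_mul]; exact h1.symm))

/-- By orthogonality, summing over a coset of the annihilator of I removes the contribution of
points outside I. -/
theorem sum_fourier_annihilator (I : AddSubgroup G) [DecidablePred (· ∈ I)] (f : G → ℂ)
    (χ : AddChar G ℂ) : ∑ π : annihilator I, fourier f (χ * π) =
      Fintype.card (annihilator I) * fourier (fun x => if x ∈ I then f x else 0) χ := by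
  simp only [fourier, AddChar.mul_apply, ← mul_assoc]
  rw [Finset.sum_comm]
  simp_rw [← Finset.mul_sum, sum_annihilator_apply]
  rw [Finset.mul_sum]
  refine Finset.sum_congr rfl fun x _ => ?_
  split_ifs <;> ring

theorem card_annihilator (I : AddSubgroup G) :
    Nat.card (annihilator I) * Nat.card I = Nat.card G := by
  classical
  have h : ∑ x, ∑ π : annihilator I, (π : AddChar G ℂ) x = Nat.card G := by
    rw [Finset.sum_comm]
    have : ∀ π : annihilator I, ∑ x, (π : AddChar G ℂ) x =
        if π = 1 then (Nat.card G : ℂ) else 0 := by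
      intro π
      split_ifs with h
      · subst h
        simp
      · exact AddChar.sum_eq_zero_of_ne_one fun h' => h (Subtype.ext h')
    simp [this]
  simp_rw [sum_annihilator_apply] at h
  rw [← Finset.sum_filter, Finset.sum_const, nsmul_eq_mul] at h
  have h2 : (Finset.univ.filter fun x => x ∈ I).card = Nat.card I := by
    rw [← Fintype.card_subtype, Nat.card_eq_fintype_card]
  rw [h2, ← Nat.card_eq_fintype_card (α := annihilator I)] at h
  rw [mul_comm]
  exact_mod_cast h

variable {Γ : Type*} [Group Γ] [Finite Γ] [DistribMulAction Γ G]

/-- The action of automorphisms on characters. -/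
def charAct (χ : AddChar G ℂ) (γ : Γ) : AddChar G ℂ :=
  χ.compAddMonoidHom (DistribSMul.toAddMonoidHom G γ)

omit [Finite G] [Fintype G] [Finite Γ] in
theorem charAct_apply (χ : AddChar G ℂ) (γ : Γ) (x : G) : charAct χ γ x = χ (γ • x) := rfl

omit [Finite G] [Fintype G] [Finite Γ] in
theorem charAct_one (χ : AddChar G ℂ) : charAct χ (1 : Γ) = χ := by
  ext x
  rw [charAct_apply, one_smul]

omit [Finite G] [Fintype G] [Finite Γ] in
theorem charAct_mul (χ : AddChar G ℂ) (γ δ : Γ) : charAct χ (γ * δ) = charAct (charAct χ γ) δ := by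
  ext x
  rw [charAct_apply, charAct_apply, charAct_apply, mul_smul]

omit [Finite G] [Finite Γ] in
theorem fourier_charAct (f : G → ℂ) (χ : AddChar G ℂ) (γ : Γ) :
    fourier f (charAct χ γ) = fourier (fun x => f (γ⁻¹ • x)) χ := by
  refine Fintype.sum_equiv (MulAction.toPerm γ) _ _ fun x => ?_
  simp [charAct_apply]

/-- Let `V ≤ I` be subgroups, and let `Γ` be a group of automorphisms of a Schur ring whose order is
prime to the index of `I`. If all `Γ`-invariant functions in the Schur ring which vanish on `I` are
`V`-invariant, then all functions in the Schur ring which vanish on `I` are `V`-invariant. -/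
theorem map_add_eq_of_group_invariant {I V : AddSubgroup G} (hI : A.IsASet I)
    (hΓ : ∀ (γ : Γ) (x y : G), A.Rel x y → A.Rel (γ • x) (γ • y))
    (hΓI : ∀ (γ : Γ), ∀ x ∈ I, γ • x ∈ I) (hcop : (Nat.card Γ).Coprime I.index)
    (hinv : ∀ f, A.Inv f → (∀ x ∈ I, f x = 0) → (∀ (γ : Γ) x, f (γ • x) = f x) →
      ∀ x, ∀ v ∈ V, f (x + v) = f x)
    {f : G → ℂ} (hf : A.Inv f) (hfI : ∀ x ∈ I, f x = 0) (x v : G) (hv : v ∈ V) :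
    f (x + v) = f x := by
  classical
  have := Fintype.ofFinite Γ
  set P := annihilator I with hP
  have hPidx : Nat.card P = I.index := by
    have h1 := card_annihilator I
    rw [← I.card_mul_index, mul_comm] at h1
    exact Nat.eq_of_mul_eq_mul_left Nat.card_pos h1
  have hP0 : (Fintype.card P : ℂ) ≠ 0 := Nat.cast_ne_zero.2 Fintype.card_ne_zero
  have hrestr : ∀ {g : G → ℂ}, A.Inv g → A.Inv fun x => if x ∈ I then g x else 0 := by
    intro g hg x y h
    have : x ∈ I ↔ y ∈ I := hI.mem_iff h
    simp only [this, hg x y h]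
  -- the transform vanishes at all characters which are nontrivial on `V`
  have main : ∀ χ : AddChar G ℂ, (∃ v ∈ V, χ v ≠ 1) → fourier f χ = 0 := by
    rintro χ ⟨v, hv, hχv⟩
    have trans : ∀ {χ ψ φ : AddChar G ℂ}, A.DualRel χ ψ → A.DualRel ψ φ → A.DualRel χ φ :=
      fun h h' f hf => (h f hf).trans (h' f hf)
    have act : ∀ (γ : Γ) {g : G → ℂ}, A.Inv g → A.Inv fun x => g (γ • x) :=
      fun γ g hg x y h => hg _ _ (hΓ γ x y h)
    obtain ⟨g₀, hg₀, hg1, hg0⟩ := exists_fourier_eq_indicator A χ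
    -- The number of characters in ψP belonging to the dual class of χ. By `sum_fourier_annihilator`
    -- it is the transform of the restriction of g₀ to I, up to the factor |P|.
    let N : AddChar G ℂ → ℕ := fun ψ => (Finset.univ.filter fun π : P => A.DualRel χ (ψ * π)).card
    have hN : ∀ ψ, (N ψ : ℂ) =
        Fintype.card P * fourier (fun x => if x ∈ I then g₀ x else 0) ψ := by
      intro ψ
      rw [← sum_fourier_annihilator]
      simp only [N]
      rw [Finset.card_filter]
      push_cast
      refine Finset.sum_congr rfl fun π _ => ?_
      split_ifs with h
      · exact (hg1 _ h).symm
      · exact (hg0 _ h).symm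
    -- the equivalence of characters dual to the restriction to `I`
    let E : AddChar G ℂ → AddChar G ℂ → Prop := fun ψ φ =>
      ∀ g, A.Inv g → (∀ x, x ∉ I → g x = 0) → fourier g ψ = fourier g φ
    have hEN : ∀ {ψ φ}, E ψ φ → N ψ = N φ := by
      intro ψ φ h
      have : (N ψ : ℂ) = N φ := by
        rw [hN, hN, h _ (hrestr hg₀) fun x hx => if_neg hx]
      exact_mod_cast this
    have hEP : ∀ ψ (π : P), E (ψ * π) ψ := by
      intro ψ π g _ hgI
      refine Finset.sum_congr rfl fun x _ => ?_
      by_cases hx : x ∈ I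
      · rw [AddChar.mul_apply, π.2 x hx, mul_one]
      · rw [hgI x hx, zero_mul, zero_mul]
    -- Γ₁ and Γ₂ stabilize the class of χ for `A.DualRel` and for the coarser relation E. The aim is
    -- to show that they coincide.
    let Γ₁ : Subgroup Γ :=
      { carrier := {γ | A.DualRel χ (charAct χ γ)}
        one_mem' := by
          rw [Set.mem_ofPred_eq, charAct_one]
          exact fun _ _ => rfl
        mul_mem' := fun {γ δ} hγ hδ => by
          rw [Set.mem_ofPred_eq] at hγ hδ ⊢
          intro g hg
          rw [charAct_mul, fourier_charAct, ← hγ _ (act _ hg), ← fourier_charAct]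
          exact hδ g hg
        inv_mem' := fun {γ} hγ => by
          rw [Set.mem_ofPred_eq] at hγ ⊢
          intro g hg
          rw [fourier_charAct, hγ _ (act _ hg), ← fourier_charAct, ← charAct_mul, mul_inv_cancel,
            charAct_one] }
    let Γ₂ : Subgroup Γ :=
      { carrier := {γ | E χ (charAct χ γ)}
        one_mem' := by
          rw [Set.mem_ofPred_eq, charAct_one]
          exact fun _ _ _ => rfl
        mul_mem' := fun {γ δ} hγ hδ => by
          rw [Set.mem_ofPred_eq] at hγ hδ ⊢
          intro g hg hgI
          have hgI' : ∀ x, x ∉ I → g (δ⁻¹ • x) = 0 := fun x hx => hgI _ fun h => hx (by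
            have := hΓI δ _ h
            rwa [smul_inv_smul] at this)
          rw [charAct_mul, fourier_charAct, ← hγ _ (act _ hg) hgI', ← fourier_charAct]
          exact hδ g hg hgI
        inv_mem' := fun {γ} hγ => by
          rw [Set.mem_ofPred_eq] at hγ ⊢
          intro g hg hgI
          have hgI' : ∀ x, x ∉ I → g (γ⁻¹⁻¹ • x) = 0 := fun x hx => hgI _ fun h => hx (by
            have := hΓI γ⁻¹ _ h
            rwa [inv_inv, inv_smul_smul] at this)
          rw [fourier_charAct, hγ _ (act _ hg) hgI', ← fourier_charAct, ← charAct_mul,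
            mul_inv_cancel, charAct_one] }
    have hle : Γ₁ ≤ Γ₂ := fun γ hγ g hg _ => hγ g hg
    -- the trace of the part outside `I` of the indicator of the dual class of `χ`
    have hcount : Nat.card Γ₁ * Nat.card P = N χ * Nat.card Γ₂ := by
      let g : G → ℂ := fun x => g₀ x - if x ∈ I then g₀ x else 0
      let h : G → ℂ := fun x => ∑ γ : Γ, g (γ • x)
      have hg : A.Inv g := fun x y hxy =>
        congrArg₂ (· - ·) (hg₀ x y hxy) (hrestr hg₀ x y hxy)
      have hFg : ∀ ψ, Fintype.card P * fourier g ψ = Fintype.card P * fourier g₀ ψ - N ψ := by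
        intro ψ
        rw [hN, ← mul_sub]
        congr 1
        simp only [fourier, g, sub_mul, Finset.sum_sub_distrib]
      have hh := hinv h
        (fun x y hxy => Finset.sum_congr rfl fun γ _ => hg _ _ (hΓ γ x y hxy))
        (fun x hx => Finset.sum_eq_zero fun γ _ => by simp [g, hΓI γ x hx])
        (fun γ x => Fintype.sum_equiv (Equiv.mulRight γ) _ _ fun δ => by simp [mul_smul])
      -- h is V-invariant by hypothesis, and χ is nontrivial on V.
      have hFh : fourier h χ = 0 := by
        have h1 : fourier h χ = χ v * fourier h χ := by
          simp only [fourier]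
          rw [Finset.mul_sum]
          refine Fintype.sum_equiv (Equiv.subRight v) _ _ fun x => ?_
          rw [Equiv.subRight_apply, mul_left_comm, ← AddChar.map_add_eq_mul, add_sub_cancel]
          congr 1
          have := hh (x - v) v hv
          rwa [sub_add_cancel] at this
        by_contra h0
        exact hχv (mul_right_cancel₀ h0 (by rw [one_mul]; exact h1.symm))
      have hFh' : fourier h χ = ∑ γ : Γ, fourier g (charAct χ γ) := by
        have h1 : fourier h χ = ∑ γ : Γ, fourier (fun x => g (γ • x)) χ := by
          simp only [fourier, h, Finset.sum_mul]
          rw [Finset.sum_comm]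
        rw [h1]
        refine Fintype.sum_equiv (Equiv.inv Γ) _ _ fun γ => ?_
        rw [fourier_charAct]
        simp
      have hsum : ∑ γ : Γ, Fintype.card P * fourier g₀ (charAct χ γ) =
          ∑ γ : Γ, (N (charAct χ γ) : ℂ) := by
        rw [← sub_eq_zero, ← Finset.sum_sub_distrib, Finset.sum_congr rfl fun γ _ => (hFg _).symm,
          ← Finset.mul_sum, ← hFh', hFh, mul_zero]
      have e1 : ∑ γ : Γ, Fintype.card P * fourier g₀ (charAct χ γ) =
          Nat.card Γ₁ * Nat.card P := by
        have : ∀ γ : Γ, Fintype.card P * fourier g₀ (charAct χ γ) =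
            if γ ∈ Γ₁ then (Fintype.card P : ℂ) else 0 := by
          intro γ
          split_ifs with hγ
          · rw [hg1 _ hγ, mul_one]
          · rw [hg0 _ hγ, mul_zero]
        simp_rw [this]
        rw [← Finset.sum_filter, Finset.sum_const, nsmul_eq_mul, ← Fintype.card_subtype,
          Nat.card_eq_fintype_card, Nat.card_eq_fintype_card]
      have e2 : ∑ γ : Γ, (N (charAct χ γ) : ℂ) = N χ * Nat.card Γ₂ := by
        have : ∀ γ : Γ, (N (charAct χ γ) : ℂ) = if γ ∈ Γ₂ then (N χ : ℂ) else 0 := by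
          intro γ
          split_ifs with hγ
          · rw [hEN hγ]
          · rw [Nat.cast_eq_zero]
            simp only [N]
            rw [Finset.card_eq_zero, Finset.filter_eq_empty_iff]
            intro π _ hπ
            exact hγ fun g hg hgI => (hπ g hg).trans (hEP _ π g hg hgI)
        simp_rw [this]
        rw [← Finset.sum_filter, Finset.sum_const, nsmul_eq_mul, ← Fintype.card_subtype,
          Nat.card_eq_fintype_card, mul_comm]
      rw [e1, e2] at hsum
      exact_mod_cast hsum
    -- k is the index of Γ₁ in Γ₂. The count gives |P| = N χ · k, so k divides both |Γ| and the
    -- index of I, and coprimality gives k = 1.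
    obtain ⟨k, hk⟩ := Subgroup.card_dvd_of_le hle
    have hk1 : k = 1 := by
      rw [hk, mul_left_comm] at hcount
      have h2 : Nat.card P = N χ * k := Nat.eq_of_mul_eq_mul_left Nat.card_pos hcount
      have h3 : k ∣ I.index := hPidx ▸ Dvd.intro_left _ h2.symm
      have h4 : k ∣ Nat.card Γ := (Dvd.intro_left _ hk.symm).trans Γ₂.card_subgroup_dvd_card
      exact Nat.eq_one_of_dvd_coprimes hcop h4 h3
    rw [hk, hk1, mul_one, mul_comm] at hcount
    have hNP : N χ = Fintype.card P := by
      rw [← Nat.card_eq_fintype_card]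
      exact (Nat.eq_of_mul_eq_mul_right Nat.card_pos hcount).symm
    -- All of χP lies in the dual class of χ, so the transform of f is constant on χP. Its sum there
    -- comes from the restriction of f to I, which is 0.
    have hall : ∀ π : P, A.DualRel χ (χ * π) := by
      have := (Finset.card_eq_iff_eq_univ _).1 hNP
      intro π
      have hπ := Finset.mem_univ π
      rw [← this] at hπ
      simpa using hπ
    have h5 := sum_fourier_annihilator I f χ
    rw [Finset.sum_congr rfl fun π _ => (hall π f hf).symm] at h5
    have h6 : fourier (fun x => if x ∈ I then f x else 0) χ = 0 :=
      Finset.sum_eq_zero fun x _ => by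
        beta_reduce
        split_ifs with hx
        · rw [hfI x hx, zero_mul]
        · rw [zero_mul]
    rw [h6, mul_zero, Finset.sum_const, nsmul_eq_mul, Finset.card_univ] at h5
    exact (mul_eq_zero.1 h5).resolve_left hP0
  have hcard : (Fintype.card G : ℂ) ≠ 0 := Nat.cast_ne_zero.2 Fintype.card_ne_zero
  refine mul_left_cancel₀ hcard ?_
  rw [← sum_fourier_mul, ← sum_fourier_mul]
  refine Finset.sum_congr rfl fun χ _ => ?_
  by_cases h : ∃ v ∈ V, χ v ≠ 1
  · rw [main χ h, zero_mul, zero_mul]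
  · push Not at h
    rw [neg_add, AddChar.map_add_eq_mul, h _ (neg_mem hv), mul_one]

end Duality
end SchurRing

/-! ### The p-group of principal units. -/

section PrincipalUnits

variable (R : Type u) [CommRing R] [Finite R]

/-- The principal units of the `p`-component of a finite ring. -/
def principalUnits (p : ℕ) : Subgroup Rˣ where
  carrier := {u | ∃ a, (u : R) = 1 + p * pIdem R p * a}
  one_mem' := ⟨0, by simp⟩
  mul_mem' := by
    rintro u v ⟨a, ha⟩ ⟨b, hb⟩
    exact ⟨a + b + a * (p * pIdem R p * b), by rw [Units.val_mul, ha, hb]; ring⟩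
  inv_mem' := by
    rintro u ⟨a, ha⟩
    refine ⟨-a * (u⁻¹ : Rˣ), ?_⟩
    have h : (u : R) * (u⁻¹ : Rˣ) = 1 := Units.mul_inv u
    linear_combination h - ((u⁻¹ : Rˣ) : R) * ha

variable {R}

theorem mem_principalUnits {p : ℕ} {u : Rˣ} :
    u ∈ principalUnits R p ↔ ∃ a, (u : R) = 1 + p * pIdem R p * a := Iff.rfl

/-- Raising to the power p^k takes an element congruent to 1 modulo p to one congruent to 1 modulo
p^(k+1), and p^(k+1) vanishes on the p-component. -/
theorem isPGroup_principalUnits (p : ℕ) : IsPGroup p (principalUnits R p) := by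
  rintro ⟨u, hu⟩
  obtain ⟨a, ha⟩ := mem_principalUnits.1 hu
  obtain ⟨k, -, hk⟩ := exists_pIdem_eq R p
  refine ⟨k, Subtype.ext (Units.ext ?_)⟩
  change (u : R) ^ p ^ k = 1
  have h1 : (p : R) ^ (k + 1) ∣ (u : R) ^ p ^ k - 1 := by
    have := dvd_sub_pow_of_dvd_sub (p := p) (a := (u : R)) (b := 1)
      ⟨pIdem R p * a, by rw [ha]; ring⟩ k
    simpa using this
  have h2 : ∀ n : ℕ, (u : R) ^ n * (1 - pIdem R p) = 1 - pIdem R p := by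
    intro n
    induction n with
    | zero => simp
    | succ n ih => rw [pow_succ, mul_assoc, ha, one_add_mul_one_sub_pIdem, ← ha, ih]
  obtain ⟨c, hc⟩ := h1
  linear_combination h2 (p ^ k) + pIdem R p * hc + c * hk

end PrincipalUnits

theorem Ideal.mem_of_natCast_mul_mem {R : Type*} [CommRing R] {I : Ideal R} {r : ℕ}
    (hr : I ⊔ Ideal.span {(r : R)} = ⊤) {x : R} (hx : (r : R) * x ∈ I) : x ∈ I := by
  have h1 : (1 : R) ∈ I ⊔ Ideal.span {(r : R)} := hr ▸ Submodule.mem_top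
  obtain ⟨i, hi, j, hj, hij⟩ := Submodule.mem_sup.1 h1
  obtain ⟨c, rfl⟩ := Ideal.mem_span_singleton.1 hj
  have : x = i * x + c * (r * x) := by linear_combination -x * hij
  rw [this]
  exact I.add_mem (I.mul_mem_right _ hi) (I.mul_mem_left _ hx)

theorem Ideal.not_dvd_index {R : Type*} [CommRing R] [Finite R] {I : Ideal R} {r : ℕ}
    (hp : r.Prime) (hr : I ⊔ Ideal.span {(r : R)} = ⊤) : ¬ r ∣ I.toAddSubgroup.index := by
  intro h
  have := Fact.mk hp
  obtain ⟨z, hz⟩ := exists_prime_addOrderOf_dvd_card' (G := R ⧸ I.toAddSubgroup) r h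
  obtain ⟨x, rfl⟩ := QuotientAddGroup.mk_surjective z
  have h1 : r • (x : R ⧸ I.toAddSubgroup) = 0 := hz ▸ addOrderOf_nsmul_eq_zero _
  rw [← QuotientAddGroup.mk_nsmul, QuotientAddGroup.eq_zero_iff, nsmul_eq_mul] at h1
  have h2 : x ∈ I := Ideal.mem_of_natCast_mul_mem hr h1
  rw [(QuotientAddGroup.eq_zero_iff x).2 h2, addOrderOf_zero] at hz
  exact hp.one_lt.ne hz

namespace SchurRing

/-! ### Translation by r-torsion for a prime r invertible modulo I. -/

section Torsion

variable {R : Type u} [CommRing R] [Finite R] {A : SchurRing R} {I : Ideal R}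

/-- A failure would give an A-ideal U without r-part containing rx. As r is invertible modulo I, rx
∉ I, so U is not contained in I and must contain e, which is a nonzero r-part. -/
theorem add_mem_of_stable (hA : A.IsOverRing) (hR : IsFieldModPrimes R) {r : ℕ} (hr : r.Prime)
    (hrI : I ⊔ Ideal.span {(r : R)} = ⊤) {e : R} (he : (r : R) * e = 0) (he0 : e ≠ 0)
    (hS : ∀ U : Ideal R, A.IsAIdeal U → ¬ U ≤ I → e ∈ U) {T : Set R} (hTA : A.IsASet T)
    (hTI : ∀ x ∈ T, x ∉ I)
    (hT : ∀ u : Rˣ, (u : R) * (1 - pIdem R r) = 1 - pIdem R r → ∀ x ∈ T, (u : R) * x ∈ T)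
    {x e' : R} (hx : x ∈ T) (he' : (r : R) * e' = 0) : x + e' ∈ T := by
  by_contra h
  obtain ⟨U, hU, hxU, hUe, -⟩ := hA.exists_isAIdeal_of_not_translate hR hr hTA hT hx he' h
  have h1 := hUe e (hS U hU fun hUI => hTI x hx (Ideal.mem_of_natCast_mul_mem hrI (hUI hxU)))
  rw [pIdem_mul_of_mul_eq_zero he] at h1
  exact he0 h1

/-- The multiples of the basic set of x by units of the r-component fill an A-set that, by
`add_mem_of_stable`, contains x with its r-part removed. That point is fixed by those units, so all
these basic sets coincide. -/
theorem rel_mul_of_torsion (hA : A.IsOverRing) (hR : IsFieldModPrimes R) (hI : A.IsAIdeal I)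
    {r : ℕ} (hr : r.Prime) (hrI : I ⊔ Ideal.span {(r : R)} = ⊤) {e : R} (he : (r : R) * e = 0)
    (he0 : e ≠ 0) (hS : ∀ U : Ideal R, A.IsAIdeal U → ¬ U ≤ I → e ∈ U) {x : R} (hx : x ∉ I)
    (hxr : (r : R) * (pIdem R r * x) = 0) {u : Rˣ}
    (hu : (u : R) * (1 - pIdem R r) = 1 - pIdem R r) : A.Rel x (u * x) := by
  set T : Set R := {t | ∃ u : Rˣ, (u : R) * (1 - pIdem R r) = 1 - pIdem R r ∧ A.Rel t (u * x)}
  have hTA : A.IsASet T := isASet_iff_rel.2 fun s t h ⟨u, hu, hs⟩ => ⟨u, hu, h.symm.trans hs⟩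
  have hTI : ∀ t ∈ T, t ∉ I := fun t ⟨u, _, hs⟩ h => hx (by
    have := I.mul_mem_left ((u⁻¹ : Rˣ) : R) ((hI.mem_iff hs).1 h)
    rwa [← mul_assoc, Units.inv_mul, one_mul] at this)
  have hT : ∀ u : Rˣ, (u : R) * (1 - pIdem R r) = 1 - pIdem R r → ∀ x ∈ T, (u : R) * x ∈ T := by
    rintro v hv t ⟨w, hw, ht⟩
    refine ⟨v * w, ?_, ?_⟩
    · rw [Units.val_mul, mul_assoc, hw, hv]
    · rw [Units.val_mul, mul_assoc]
      exact hA.rel_mul v ht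
  have hxT : x ∈ T := ⟨1, by simp, by simpa using Rel.refl A x⟩
  obtain ⟨w, hw, hxw⟩ := add_mem_of_stable hA hR hr hrI he he0 hS hTA hTI hT hxT
    (e' := -(pIdem R r * x)) (by rw [mul_neg, hxr, neg_zero])
  have hfix : ∀ w : Rˣ, (w : R) * (1 - pIdem R r) = 1 - pIdem R r →
      (w : R) * (x + -(pIdem R r * x)) = x + -(pIdem R r * x) := fun w hw => by
    linear_combination x * hw
  have h1 : A.Rel (x + -(pIdem R r * x)) x := by
    rw [← hfix w hw, hA.rel_mul_iff, ← mul_assoc, Units.inv_mul, one_mul] at hxw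
    exact hxw
  have h2 := hA.rel_mul u h1
  rw [hfix u hu] at h2
  exact h1.symm.trans h2

/-- Basic sets outside a maximal `A`-ideal `I` are unions of cosets of any `A`-ideal `V` which is
generated by elements killed by a prime `r` that is invertible modulo `I`, provided those elements
lie in each `A`-ideal not contained in `I`. -/
theorem rel_add_of_torsion (hA : A.IsOverRing) (hR : IsFieldModPrimes R) (hI : A.IsAIdeal I)
    {r : ℕ} (hr : r.Prime) (hrI : I ⊔ Ideal.span {(r : R)} = ⊤) {e : R} (he : (r : R) * e = 0)
    (he0 : e ≠ 0) (hS : ∀ U : Ideal R, A.IsAIdeal U → ¬ U ≤ I → e ∈ U) {V : Ideal R}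
    (hV : ∀ U : Ideal R, A.IsAIdeal U → e ∈ U → V ≤ U) {x v : R} (hx : x ∉ I) (hv : v ∈ V) :
    A.Rel x (x + v) := by
  classical
  have := Fintype.ofFinite R
  -- V-invariance for functions fixed by the principal units; `map_add_eq_of_group_invariant` then
  -- removes that restriction.
  have hinv : ∀ f, A.Inv f → (∀ x ∈ I.toAddSubgroup, f x = 0) →
      (∀ (γ : principalUnits R r) x, f (γ • x) = f x) →
      ∀ x, ∀ v ∈ V.toAddSubgroup, f (x + v) = f x := by
    intro f hf hfI hfΓ
    have key : ∀ c : ℂ, c ≠ 0 → ∀ x, f x = c → ∀ v ∈ V, f (x + v) = c := by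
      intro c hc x hx v hv
      have hTA : A.IsASet {x | f x = c} := isASet_iff_rel.2 fun y z h hy => by
        rw [Set.mem_ofPred_eq] at hy ⊢
        rw [← hf y z h, hy]
      have hle : V ≤ stabIdeal {x | f x = c} := by
        refine hV _ (hA.isAIdeal_stabIdeal hR hTA) fun a y hy => ?_
        have hae : (r : R) * (a * e) = 0 := by rw [mul_left_comm, he, mul_zero]
        rw [Set.mem_ofPred_eq] at hy ⊢
        -- If r kills the r-part of y, the basic set of y is itself stable under the units of the
        -- r-component. Otherwise y + ae is a principal unit times y, and f takes the same value
        -- there.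
        by_cases hyr : (r : R) * (pIdem R r * y) = 0
        · have hyI : y ∉ I := fun h => hc (hy.symm.trans (hfI y h))
          have h1 : A.Rel y (y + a * e) :=
            add_mem_of_stable (T := {z | A.Rel y z}) hA hR hr hrI he he0 hS (A.isASet_rel y)
              (fun z hz h => hyI ((hI.mem_iff hz).2 h))
              (fun u hu z hz => Rel.trans (rel_mul_of_torsion hA hR hI hr hrI he he0 hS hyI hyr hu)
                (hA.rel_mul u hz))
              (Rel.refl A y) hae
          rw [← hf _ _ h1, hy]
        · obtain ⟨u, hu, huy⟩ := exists_unit_mul_eq_add hR hr hyr hae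
          rw [← huy, ← hy]
          exact hfΓ ⟨u, hu⟩ y
      exact add_mem_of_mem_stabIdeal (T := {x | f x = c}) (hle hv) hx
    intro x v hv
    by_cases h0 : f x = 0
    · rw [h0]
      by_contra h1
      have := key _ h1 _ rfl (-v) (V.neg_mem hv)
      rw [add_neg_cancel_right, h0] at this
      exact h1 this.symm
    · exact key _ h0 x rfl v hv
  have hcop : (Nat.card (principalUnits R r)).Coprime I.toAddSubgroup.index := by
    have := Fact.mk hr
    obtain ⟨n, hn⟩ := (IsPGroup.iff_card (p := r)).1 (isPGroup_principalUnits (R := R) r)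
    rw [hn]
    exact Nat.Coprime.pow_left _ ((Nat.Prime.coprime_iff_not_dvd hr).2 (Ideal.not_dvd_index hr hrI))
  have h := map_add_eq_of_group_invariant (A := A) (Γ := principalUnits R r)
    (I := I.toAddSubgroup) (V := V.toAddSubgroup) hI
    (fun γ x y h => hA.rel_mul γ h) (fun γ x hx => I.mul_mem_left ((γ : Rˣ) : R) hx) hcop hinv
    (f := fun y => if A.Rel x y then 1 else 0)
    (fun y z h => by
      have : A.Rel x y ↔ A.Rel x z := ⟨fun h' => h'.trans h, fun h' => h'.trans h.symm⟩
      simp only [this])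
    (fun y hy => if_neg fun h => hx ((hI.mem_iff h).2 hy)) x v hv
  by_contra hn
  simp [hn, Rel.refl A x] at h

end Torsion
end SchurRing

/-! ### Components of R relative to an ideal. -/

theorem pIdem_mul_pIdem {R : Type*} [CommRing R] [Finite R] {p r : ℕ} (hp : p.Prime)
    (hr : r.Prime) (h : p ≠ r) : pIdem R p * pIdem R r = 0 := by
  obtain ⟨k, -, hk⟩ := exists_pIdem_eq R p
  obtain ⟨l, -, hl⟩ := exists_pIdem_eq R r
  have hc : Nat.Coprime (p ^ (k + 1)) (r ^ (l + 1)) :=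
    Nat.Coprime.pow _ _ ((Nat.coprime_primes hp hr).2 h)
  obtain ⟨a, b, hab⟩ := Nat.isCoprime_iff_coprime.2 hc
  have hab' := congrArg (Int.cast : ℤ → R) hab
  push_cast at hab'
  linear_combination -(pIdem R p * pIdem R r) * hab' + a * pIdem R r * hk + b * pIdem R p * hl

/-- Write 1 = i + s. If s were a multiple of p, then I + pR = R; hence s is a unit modulo p and
divides the idempotent. For this reason every A-ideal not contained in a maximal A-ideal I contains
R_Q. -/
theorem Ideal.pIdem_mem_of_sup_eq_top {R : Type*} [CommRing R] [Finite R] (hR : IsFieldModPrimes R)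
    {p : ℕ} (hp : p.Prime) {I S : Ideal R} (hIS : I ⊔ S = ⊤) (hpI : I ⊔ Ideal.span {(p : R)} ≠ ⊤) :
    pIdem R p ∈ S := by
  obtain ⟨i, hi, s, hs, his⟩ := Submodule.mem_sup.1 (hIS ▸ Submodule.mem_top : (1 : R) ∈ I ⊔ S)
  rcases hR p hp s with ⟨y, hy⟩ | ⟨y, z, hy⟩
  · refine absurd ((Ideal.eq_top_iff_one _).2 ?_) hpI
    rw [← his, hy]
    exact Submodule.add_mem_sup hi (Ideal.mul_mem_right _ _ (Ideal.mem_span_singleton_self _))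
  · obtain ⟨u, hu⟩ := isUnit_one_add_mul_pIdem (R := R) p z
    have h1 := pIdem_mul_self (R := R) p
    have h2 : pIdem R p = ((u⁻¹ : Rˣ) : R) * (pIdem R p * y) * s := by
      have h3 : ((u⁻¹ : Rˣ) : R) * u = 1 := Units.inv_mul u
      rw [hu] at h3
      linear_combination -pIdem R p * h3 - ((u⁻¹ : Rˣ) : R) * pIdem R p * hy +
        ((u⁻¹ : Rˣ) : R) * p * z * h1
    rw [h2]
    exact S.mul_mem_left _ hs

theorem Ideal.pIdem_notMem {R : Type*} [CommRing R] [Finite R] {p : ℕ} {I : Ideal R}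
    (hpI : I ⊔ Ideal.span {(p : R)} ≠ ⊤) : pIdem R p ∉ I := by
  intro h
  obtain ⟨c, hc⟩ := one_sub_pIdem (R := R) p
  refine hpI ((Ideal.eq_top_iff_one _).2 ?_)
  rw [show (1 : R) = pIdem R p + p * c by linear_combination hc]
  exact Submodule.add_mem_sup h (Ideal.mul_mem_right _ _ (Ideal.mem_span_singleton_self _))

theorem Ideal.one_sub_pIdem_mul_mem {R : Type*} [CommRing R] [Finite R] {p : ℕ} {I : Ideal R}
    {x : R} (h : (p : R) * x ∈ I) : (1 - pIdem R p) * x ∈ I := by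
  obtain ⟨c, hc⟩ := one_sub_pIdem (R := R) p
  rw [hc, show (p : R) * c * x = c * (p * x) by ring]
  exact I.mul_mem_left _ h

theorem Ideal.one_sub_pIdem_mem {R : Type*} [CommRing R] [Finite R] {p : ℕ} {I : Ideal R}
    (hI : ∀ q : ℕ, q.Prime → q ≠ p → I ⊔ Ideal.span {(q : R)} = ⊤) : 1 - pIdem R p ∈ I := by
  by_contra h
  let C : AddSubgroup R := I.toAddSubgroup.comap (AddMonoidHom.mulLeft (1 - pIdem R p))
  have h1 : (1 : R) ∉ C := fun h' => h (by
    have : (1 - pIdem R p) * 1 ∈ I := h'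
    rwa [mul_one] at this)
  obtain ⟨q, hq, b, hb, hqb⟩ := AddSubgroup.exists_prime_nsmul_mem h1
  have hqb' : (1 - pIdem R p) * (q • b) ∈ I := hqb
  rw [nsmul_eq_mul, mul_left_comm] at hqb'
  apply hb
  change (1 - pIdem R p) * b ∈ I
  by_cases hqp : q = p
  · subst hqp
    have := Ideal.one_sub_pIdem_mul_mem hqb'
    have h2 := pIdem_mul_self (R := R) q
    rwa [show (1 - pIdem R q) * ((1 - pIdem R q) * b) = (1 - pIdem R q) * b by
      linear_combination b * h2] at this
  · exact Ideal.mem_of_natCast_mul_mem (hI q hq hqp) hqb'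

theorem Ideal.two_mul_card_le {R : Type*} [CommRing R] [Finite R] {U : Ideal R} (hU : U ≠ ⊤) :
    2 * Nat.card U ≤ Nat.card R := by
  have h := U.toAddSubgroup.card_mul_index
  have h0 : U.toAddSubgroup.index ≠ 0 := AddSubgroup.index_ne_zero_of_finite
  have h1 : U.toAddSubgroup.index ≠ 1 := fun h => hU (by
    rw [AddSubgroup.index_eq_one] at h
    rw [eq_top_iff]
    intro x _
    have : x ∈ U.toAddSubgroup := h ▸ AddSubgroup.mem_top x
    exact this)
  have h2 : Nat.card U.toAddSubgroup = Nat.card U := rfl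
  rw [← h, h2, mul_comm]
  exact Nat.mul_le_mul_left _ (by omega)

/-! ### Primes dividing |R/I| and the main induction. -/

namespace SchurRing

variable {R : Type u} [CommRing R] [Finite R] {A : SchurRing R} {I : Ideal R}

theorem map_mem_maximalAIdeals {V : Ideal R} (hV : A.IsAIdeal V) (hI : I ∈ A.maximalAIdeals)
    (hVI : V ≤ I) : I.map (Ideal.Quotient.mk V) ∈ (A.quot V hV).maximalAIdeals := by
  rw [mem_maximalAIdeals]
  have hI' := mem_maximalAIdeals.1 hI
  refine ⟨⟨?_, fun h => hI'.prop.2 ?_⟩, fun U hU hle => ?_⟩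
  · rw [isAIdeal_quot, Ideal.comap_map_mk hVI]
    exact hI'.prop.1
  · rw [← Ideal.comap_map_mk hVI, h, Ideal.comap_top]
  · rw [← Ideal.map_comap_of_surjective _ Ideal.Quotient.mk_surjective U]
    refine Ideal.map_mono (hI'.le_of_ge ⟨(isAIdeal_quot hV U).1 hU.1, ?_⟩ ?_)
    · rw [Ne, Ideal.comap_eq_top_iff]
      exact hU.2
    · rwa [← Ideal.map_le_iff_le_comap]

/-- Translation by elements killed by `p` when `R/I` is a `p`-group. -/
theorem rel_add_of_primary (hA : A.IsOverRing) (hR : IsFieldModPrimes R)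
    (hI : I ∈ A.maximalAIdeals) {p : ℕ} (hp : p.Prime) (hpI : I ⊔ Ideal.span {(p : R)} ≠ ⊤)
    (hQ : ∀ q : ℕ, q.Prime → q ≠ p → I ⊔ Ideal.span {(q : R)} = ⊤) {x e : R}
    (he : (p : R) * e = 0) (hx : (p : R) * x ∉ I) : A.Rel x (x + e) := by
  have h1 := pIdem_mul_self (R := R) p
  have hxI : x ∉ I := fun h => hx (I.mul_mem_left _ h)
  have hpI' := Ideal.one_sub_pIdem_mem hQ
  -- Otherwise multiplication by p would be injective on R/I, making p invertible modulo I.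
  obtain ⟨y, hyI, hy⟩ : ∃ y, y ∉ I ∧ (p : R) * y ∈ I := by
    by_contra! hn
    apply hpI
    have hinj : Function.Injective (fun z : R ⧸ I => (p : R ⧸ I) * z) := by
      intro z w h
      obtain ⟨z, rfl⟩ := Ideal.Quotient.mk_surjective z
      obtain ⟨w, rfl⟩ := Ideal.Quotient.mk_surjective w
      rw [Ideal.Quotient.eq]
      by_contra hzw
      refine hn _ hzw ?_
      rw [← Ideal.Quotient.eq_zero_iff_mem]
      simp only [map_mul, map_sub, map_natCast]
      rw [mul_sub, sub_eq_zero]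
      exact h
    obtain ⟨z, hz⟩ := Finite.surjective_of_injective hinj 1
    obtain ⟨z, rfl⟩ := Ideal.Quotient.mk_surjective z
    have h2 : 1 - (p : R) * z ∈ I := by
      rw [← Ideal.Quotient.eq_zero_iff_mem]
      simp only [map_mul, map_sub, map_natCast, map_one]
      rw [sub_eq_zero]
      exact hz.symm
    rw [Ideal.eq_top_iff_one, show (1 : R) = (1 - p * z) + p * z by ring]
    exact Submodule.add_mem_sup h2 (Ideal.mul_mem_right _ _ (Ideal.mem_span_singleton_self _))
  obtain ⟨u, i, hi, hrel⟩ := exists_rel_of_notMem hA hR hI hxI hyI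
  set x₀ := (u : R) * y + i
  have hx₀ : (p : R) * x₀ ∈ I := by
    rw [show (p : R) * x₀ = u * (p * y) + p * i by simp only [x₀]; ring]
    exact I.add_mem (I.mul_mem_left _ hy) (I.mul_mem_left _ hi)
  have hpx : (p : R) * (pIdem R p * x) ∉ I := fun h => hx (by
    rw [show (p : R) * x = p * (pIdem R p * x) + (1 - pIdem R p) * (p * x) by ring]
    exact I.add_mem h (I.mul_mem_right _ hpI'))
  have hpx0 : (p : R) * (pIdem R p * x) ≠ 0 := fun h => hpx (h ▸ I.zero_mem)
  obtain ⟨s, hs, hs'⟩ := exists_pow_mul_torsion (p := p) (y := x)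
    (fun h => hpx0 (by rw [h, mul_zero]))
  have hs0 : s ≠ 0 := by
    rintro rfl
    rw [zero_add, pow_one] at hs'
    exact hpx0 hs'
  -- The p-part of x₀ has smaller order than that of x: otherwise the latter would be a multiple of
  -- the former, and px would lie in I.
  have hsx₀ : (p : R) ^ s * (pIdem R p * x₀) = 0 := by
    by_contra h
    obtain ⟨a, ha⟩ := exists_mul_eq_of_pow hR hp s (y := pIdem R p * x) (z := pIdem R p * x₀)
      (by rw [← mul_assoc, h1]) (by rw [← mul_assoc, h1]) hs' h
    apply hpx
    rw [← ha, show (p : R) * (a * (pIdem R p * x₀)) = a * pIdem R p * (p * x₀) by ring]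
    exact I.mul_mem_left _ hx₀
  obtain ⟨c, hc⟩ := exists_mul_eq_of_torsion hR hp
    (by rw [← mul_assoc, ← pow_succ', hs'] : (p : R) * ((p : R) ^ s * (pIdem R p * x)) = 0) hs he
  obtain ⟨t, rfl⟩ := Nat.exists_eq_succ_of_ne_zero hs0
  -- v is 1 plus a multiple of p^s on the p-component, with s = t + 1. It fixes x₀ and moves x to x
  -- + e, so both are related to x₀.
  obtain ⟨v, hv⟩ := isUnit_one_add_mul_pIdem (R := R) p ((p : R) ^ t * c)
  have h2 := hA.rel_mul v hrel
  have e1 : (v : R) * x = x + e := by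
    rw [hv, ← hc, Nat.succ_eq_add_one, pow_succ]
    ring
  have e2 : (v : R) * x₀ = x₀ := by
    rw [hv]
    rw [Nat.succ_eq_add_one, pow_succ] at hsx₀
    linear_combination c * hsx₀
  rw [e1, e2] at h2
  exact hrel.trans h2.symm

/-- Translation by elements killed by `p` inside a basic set which meets the complementary
component. -/
theorem rel_add_of_rel (hA : A.IsOverRing) (hR : IsFieldModPrimes R) {p : ℕ} (hp : p.Prime)
    {e₀ : R} (he₀ : (p : R) * e₀ = 0) (h0 : e₀ ≠ 0)
    (hS : ∀ U : Ideal R, A.IsAIdeal U → ¬ U ≤ I → e₀ ∈ U) {x x₁ e : R} (hx : (p : R) * x ∉ I)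
    (hrel : A.Rel x x₁) (hx₁ : pIdem R p * x₁ = 0) (he : (p : R) * e = 0) : A.Rel x (x + e) := by
  by_contra h
  obtain ⟨U, hU, hxU, hUe, -⟩ := hA.exists_isAIdeal_of_not_translate hR hp (A.isASet_rel x)
    -- The units of the p-component fix x₁, hence stabilize its basic set.
    (fun u hu z hz => (by
      have hfix : (u : R) * x₁ = x₁ := by linear_combination x₁ * hu + (u - 1 : R) * hx₁
      have h1 : A.Rel (u * z) (u * x₁) := hA.rel_mul u (Rel.trans (Rel.symm hz) hrel)
      rw [hfix] at h1
      exact hrel.trans h1.symm)) (Rel.refl A x) he h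
  have h1 := hUe e₀ (hS U hU fun hUI => hx (hUI hxU))
  rw [pIdem_mul_of_mul_eq_zero he₀] at h1
  exact h0 h1

/-- Otherwise Schur's theorem gives an A-ideal U without p-part. If U is not contained in I, it
contains e₀. If it is, then px ∈ I while p kills the p-part of x; that part lies in V ≤ I, so x
itself lies in I. -/
theorem le_stabIdeal_orbit (hA : A.IsOverRing) (hR : IsFieldModPrimes R) (hI : A.IsAIdeal I)
    {p : ℕ} (hp : p.Prime) {V : Ideal R} (hV : A.IsMinimalAIdeal V)
    {e₀ : R} (he₀ : (p : R) * e₀ = 0) (h0 : e₀ ≠ 0) (heV : ∀ e : R, (p : R) * e = 0 → e ∈ V)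
    (hVI : V ≤ I) (hS : ∀ U : Ideal R, A.IsAIdeal U → ¬ U ≤ I → e₀ ∈ U) {z : R} (hz : z ∉ I) :
    V ≤ stabIdeal {t | ∃ u : Rˣ, A.Rel t (u * z)} := by
  refine hV.le_of_mem (hA.isAIdeal_stabIdeal hR (A.isASet_orbit z)) (heV e₀ he₀) h0
    fun a x hx => ?_
  by_contra h
  obtain ⟨U, hU, hxU, hUe, hpx⟩ := hA.exists_isAIdeal_of_not_translate hR hp (A.isASet_orbit z)
    (fun u _ t ht => hA.orbit_stable u ht) hx (by rw [mul_left_comm, he₀, mul_zero]) h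
  have hxI : x ∉ I := fun h => by
    obtain ⟨u, hu⟩ := hx
    have := I.mul_mem_left ((u⁻¹ : Rˣ) : R) ((hI.mem_iff hu).1 h)
    rw [← mul_assoc, Units.inv_mul, one_mul] at this
    exact hz this
  by_cases hUI : U ≤ I
  · apply hxI
    rw [show x = pIdem R p * x + (1 - pIdem R p) * x by ring]
    exact I.add_mem (hVI (heV _ hpx)) (Ideal.one_sub_pIdem_mul_mem (hUI hxU))
  · have h1 := hUe e₀ (hS U hU hUI)
    rw [pIdem_mul_of_mul_eq_zero he₀] at h1
    exact h0 h1

/-- With V a minimal A-ideal in I ∩ S, induction applied to R/V gives the relation up to an error in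
V, and the error is removed by comparing elements congruent modulo V. If I ∩ S = 0, then S is
minimal and is treated directly. The ring varies in the statement because the induction passes to
quotients. -/
theorem rel_of_sub_mem_aux (n : ℕ) : ∀ {R : Type u} [CommRing R] [Finite R] {A : SchurRing R}
    {I S : Ideal R}, Nat.card R = n → A.IsOverRing → IsFieldModPrimes R → I ∈ A.maximalAIdeals →
    (∀ p : ℕ, p.Prime → I ⊔ Ideal.span {(p : R)} ≠ ⊤ → (p : R) ∉ I) →
    A.IsAIdeal S → ¬ S ≤ I → (∀ U : Ideal R, A.IsAIdeal U → ¬ U ≤ I → S ≤ U) →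
    ∀ {x y : R}, x ∉ I → y ∉ I → x - y ∈ S → A.Rel x y := by
  induction n using Nat.strong_induction_on with
  | _ n ih =>
  intro R _ _ A I S hn hA hR hI hNF hS hSI hmin
  have hIA := isAIdeal_of_maximal hI
  have hIS := eq_top_of_maximal hI hS hSI
  -- the argument by counting, for a prime dividing the index of `I`
  have hcount : ∀ {V : Ideal R} {p : ℕ} {e₀ : R}, A.IsMinimalAIdeal V → V ≤ S → p.Prime →
      I ⊔ Ideal.span {(p : R)} ≠ ⊤ → (∀ e : R, (p : R) * e = 0 → e ∈ V) → (p : R) * e₀ = 0 →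
      e₀ ≠ 0 → (∀ r : ℕ, r.Prime → r ≠ p → I ⊔ Ideal.span {(r : R)} ≠ ⊤ → ∀ x : R, x ∉ I →
        ∃ x₁, A.Rel x x₁ ∧ pIdem R p * x₁ = 0) →
      ∀ {x y : R}, x ∉ I → y ∉ I → x - y ∈ V → A.Rel x y := by
    intro V p e₀ hV hVS hp hpI heV he₀ h0 hpart a b ha hb hab
    -- The exceptional elements, with px ∈ I, form a proper ideal because p ∉ I.
    let U : Ideal R := Submodule.comap (LinearMap.mulLeft R (p : R)) I
    have hU : U ≠ ⊤ := fun h => hNF p hp hpI (by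
      have h1 : (1 : R) ∈ U := h ▸ Submodule.mem_top
      have h2 : (p : R) * 1 ∈ I := h1
      rwa [mul_one] at h2)
    refine rel_of_sub_mem_of_translate hA hR hI (U := U) (fun x hx => I.mul_mem_left _ hx)
      (Ideal.two_mul_card_le hU) hV (heV e₀ he₀) h0 (fun x hx u => ?_) ha hb hab
    have hpx : (p : R) * x ∉ I := hx
    have hue : (p : R) * (u * e₀) = 0 := by rw [mul_left_comm, he₀, mul_zero]
    -- If p is the only prime dividing |R/I|, `rel_add_of_primary` applies. Otherwise a second prime
    -- r provides related elements with trivial p-part.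
    by_cases hQ : ∀ q : ℕ, q.Prime → q ≠ p → I ⊔ Ideal.span {(q : R)} = ⊤
    · exact rel_add_of_primary hA hR hI hp hpI hQ hue hpx
    · push Not at hQ
      obtain ⟨r, hr, hrp, hrI⟩ := hQ
      obtain ⟨x₁, hrel, hx₁⟩ := hpart r hr hrp hrI x fun h => hpx (I.mul_mem_left _ h)
      exact rel_add_of_rel hA hR hp he₀ h0
        (fun U hU hUI => hmin U hU hUI (hVS (heV e₀ he₀))) hpx hrel hx₁ hue
  intro a b ha hb hab
  by_cases hJ : I ⊓ S = ⊥
  · have hSmin : A.IsMinimalAIdeal S := by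
      refine ⟨hS, fun h => hSI (h ▸ bot_le), fun U hU hUS hU0 => hmin U hU fun hUI => hU0 ?_⟩
      rw [eq_bot_iff, ← hJ]
      exact le_inf hUI hUS
    obtain ⟨p, hp, heS, e₀, h0, he₀⟩ := Ideal.exists_torsion_le hR hSmin.2.1
    have hnot : ∀ e : R, (p : R) * e = 0 → e ∈ I → e = 0 := fun e he heI =>
      (Submodule.mem_bot R).1 (hJ ▸ (⟨heI, heS e he⟩ : e ∈ I ⊓ S))
    have hpI : I ⊔ Ideal.span {(p : R)} ≠ ⊤ := fun h =>
      h0 (hnot e₀ he₀ (Ideal.mem_of_natCast_mul_mem h (he₀ ▸ I.zero_mem)))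
    refine hcount hSmin le_rfl hp hpI heS he₀ h0 (fun r hr hrp hrI x hx => ?_) ha hb hab
    -- The representative is built from the idempotent of r, which has no p-part; an i with nonzero
    -- p-part would put p-torsion of S into I.
    obtain ⟨u, i, hi, hrel⟩ := exists_rel_of_notMem hA hR hI hx (Ideal.pIdem_notMem hrI)
    refine ⟨_, hrel, ?_⟩
    have hpi : pIdem R p * i = 0 := by
      by_contra h
      exact h0 (hnot e₀ he₀ (Ideal.torsion_mem hR hp I hi h he₀))
    linear_combination hpi + (u : R) * pIdem_mul_pIdem (R := R) hp hr hrp.symm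
  · obtain ⟨V, hVJ, hV⟩ := exists_isMinimalAIdeal_le (hIA.inf hS) hJ
    have hVI : V ≤ I := hVJ.trans inf_le_left
    have hVS : V ≤ S := hVJ.trans inf_le_right
    obtain ⟨p, hp, heV, e₀, h0, he₀⟩ := Ideal.exists_torsion_le hR hV.2.1
    have hminV : ∀ U : Ideal R, A.IsAIdeal U → ¬ U ≤ I → e₀ ∈ U := fun U hU hUI =>
      hmin U hU hUI (hVS (heV e₀ he₀))
    -- the induction hypothesis for the quotient by `V`
    have hquot : ∀ {x y : R}, x ∉ I → y ∉ I → x - y ∈ S → ∃ v ∈ V, A.Rel x (y + v) := by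
      intro x y hx hy hxy
      refine exists_rel_of_rel_quot hV.1 ?_
      have hmem : ∀ {K : Ideal R} (_ : V ≤ K) (a : R),
          Ideal.Quotient.mk V a ∈ K.map (Ideal.Quotient.mk V) ↔ a ∈ K := fun hVK a => by
        rw [← Ideal.mem_comap, Ideal.comap_map_mk hVK]
      refine ih (Nat.card (R ⧸ V)) ?_ (I := I.map (Ideal.Quotient.mk V))
        (S := S.map (Ideal.Quotient.mk V)) rfl
        (hA.quot hV.1) (hR.of_surjective (Ideal.Quotient.mk V) Ideal.Quotient.mk_surjective)
        (map_mem_maximalAIdeals hV.1 hI hVI) ?_ ?_ ?_ ?_ ?_ ?_ ?_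
      · rw [← hn]
        refine lt_of_le_of_ne (Nat.card_le_card_of_surjective _ Ideal.Quotient.mk_surjective)
          fun h => hV.2.1 ?_
        have hbij := (Nat.bijective_iff_surjective_and_card (Ideal.Quotient.mk V)).2
          ⟨Ideal.Quotient.mk_surjective, h.symm⟩
        rw [eq_bot_iff]
        intro a ha
        refine (Submodule.mem_bot R).2 (hbij.1 ?_)
        rw [Ideal.Quotient.eq_zero_iff_mem.2 ha, map_zero]
      · intro q hq hqI h
        rw [← map_natCast (Ideal.Quotient.mk V), hmem hVI] at h
        refine hNF q hq (fun h' => hqI ?_) h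
        rw [← map_natCast (Ideal.Quotient.mk V), ← Set.image_singleton, ← Ideal.map_span,
          ← Ideal.map_sup, h', Ideal.map_top]
      · rw [isAIdeal_quot, Ideal.comap_map_mk hVS]
        exact hS
      · rw [Ideal.map_le_iff_le_comap, Ideal.comap_map_mk hVI]
        exact hSI
      · intro U hU hUI
        rw [Ideal.map_le_iff_le_comap]
        refine hmin _ ((isAIdeal_quot hV.1 U).1 hU) fun h => hUI ?_
        rw [← Ideal.map_comap_of_surjective _ Ideal.Quotient.mk_surjective U]
        exact Ideal.map_mono h
      · rwa [hmem hVI]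
      · rwa [hmem hVI]
      · rwa [← map_sub, hmem hVS]
    have hVrel : ∀ {x y : R}, x ∉ I → y ∉ I → x - y ∈ V → A.Rel x y := by
      intro x₀ y₀ hx₀ hy₀ hxy
      by_cases hpI : I ⊔ Ideal.span {(p : R)} = ⊤
      · have := rel_add_of_torsion hA hR hIA hp hpI he₀ h0 hminV
          (fun U hU heU => hV.le_of_mem hU (heV e₀ he₀) h0 heU) hx₀ (V.neg_mem hxy)
        rwa [neg_sub, add_sub_cancel] at this
      · refine hcount hV hVS hp hpI heV he₀ h0 (fun r hr hrp hrI x hx => ?_) hx₀ hy₀ hxy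
        obtain ⟨u, i, hi, hrel⟩ := exists_rel_of_notMem hA hR hI hx (Ideal.pIdem_notMem hrI)
        have hpS := Ideal.pIdem_mem_of_sup_eq_top hR hp hIS hpI
        have hpr := pIdem_mul_pIdem (R := R) hp hr hrp.symm
        have hpp := pIdem_mul_self (R := R) p
        set y := (u : R) * pIdem R r + i
        -- Removing the p-part changes y by an element of S, so y is related to x₂ + v with v ∈ V.
        -- Since the orbit of the basic set of x is V-stable, x₂ lies in it.
        set x₂ := y - pIdem R p * y
        have hyI : y ∉ I := fun h => hx ((hIA.mem_iff hrel).2 h)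
        have hx₂ : pIdem R p * x₂ = 0 := by
          simp only [x₂]
          linear_combination -y * hpp
        have hx₂I : x₂ ∉ I := fun h => hyI (by
          have : y = x₂ + pIdem R p * i := by
            simp only [x₂, y]
            linear_combination (u : R) * hpr
          rw [this]
          exact I.add_mem h (I.mul_mem_left _ hi))
        obtain ⟨v, hv, hyv⟩ := hquot hyI hx₂I (by
          rw [show y - x₂ = y * pIdem R p by simp only [x₂]; ring]
          exact S.mul_mem_left _ hpS)
        have hst := le_stabIdeal_orbit hA hR hIA hp hV he₀ h0 heV hVI hminV hx
        have hmem : x₂ + v ∈ {t | ∃ u : Rˣ, A.Rel t (u * x)} :=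
          ⟨1, by simpa using (hrel.trans hyv).symm⟩
        have := add_mem_of_mem_stabIdeal (hst (V.neg_mem hv)) hmem
        rw [add_neg_cancel_right] at this
        obtain ⟨w, hw⟩ := this
        refine ⟨_, (hA.rel_mul_iff w).1 hw.symm, ?_⟩
        rw [mul_left_comm, hx₂, mul_zero]
    obtain ⟨v, hv, hrel⟩ := hquot ha hb hab
    refine hrel.trans (hVrel (fun h => ha ((hIA.mem_iff hrel).2 h)) hb ?_)
    rwa [add_sub_cancel_left]

/-- Let `I` be a maximal `A`-ideal such that no prime number lies in `I` without being invertible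
modulo `I`, and let `S` be the smallest `A`-ideal not contained in `I`. Then the basic sets outside `I`
are the traces on the complement of `I` of unions of cosets of `S`. -/
theorem rel_of_sub_mem {S : Ideal R} (hA : A.IsOverRing) (hR : IsFieldModPrimes R)
    (hI : I ∈ A.maximalAIdeals)
    (hNF : ∀ p : ℕ, p.Prime → I ⊔ Ideal.span {(p : R)} ≠ ⊤ → (p : R) ∉ I)
    (hS : A.IsAIdeal S) (hSI : ¬ S ≤ I) (hmin : ∀ U : Ideal R, A.IsAIdeal U → ¬ U ≤ I → S ≤ U)
    {x y : R} (hx : x ∉ I) (hy : y ∉ I) (hxy : x - y ∈ S) : A.Rel x y :=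
  rel_of_sub_mem_aux _ rfl hA hR hI hNF hS hSI hmin hx hy hxy

end SchurRing

/-! ### Tensor decompositions and rank two. -/

namespace SchurRing

section Group

variable {G G' G₁ G₂ : Type*} [AddCommGroup G] [Finite G] [AddCommGroup G'] [Finite G']
  [AddCommGroup G₁] [Finite G₁] [AddCommGroup G₂] [Finite G₂]

theorem ext_rel {A B : SchurRing G} (h : ∀ x y, A.Rel x y ↔ B.Rel x y) : A = B := by
  have hb : A.basicSets = B.basicSets := by
    ext X
    simp only [mem_basicSets_iff, h]
  refine SchurRing.ext ?_ hb
  ext f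
  rw [A.mem_iff_mem_span, B.mem_iff_mem_span, hb]

theorem rel_comap (A : SchurRing G) (i : G' →+ G) (hi : Function.Injective i)
    (hr : A.IsASet (Set.range i)) (x y : G') :
    (A.comap i hi hr).Rel x y ↔ A.Rel (i x) (i y) := by
  constructor
  · rintro ⟨X, hX, hx, hy⟩
    exact ⟨i '' X, hX, ⟨x, hx, rfl⟩, ⟨y, hy, rfl⟩⟩
  · rintro ⟨X, hX, hx, hy⟩
    refine ⟨i ⁻¹' X, ?_, hx, hy⟩
    change i '' (i ⁻¹' X) ∈ A.basicSets
    rwa [Set.image_preimage_eq_of_subset ((isASet_iff A _).1 hr X hX _ hx ⟨x, rfl⟩)]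

theorem rel_map (A : SchurRing G) (e : G ≃+ G') (x y : G') :
    (A.map e).Rel x y ↔ A.Rel (e.symm x) (e.symm y) :=
  rel_comap A _ _ _ x y

theorem rel_restrict (A : SchurRing G) (H : AddSubgroup G) (hH : A.IsASet (H : Set G)) (x y : H) :
    (A.restrict H hH).Rel x y ↔ A.Rel x y :=
  rel_comap A _ _ _ x y

theorem rel_tensor (A₁ : SchurRing G₁) (A₂ : SchurRing G₂) (x y : G₁ × G₂) :
    (A₁.tensor A₂).Rel x y ↔ A₁.Rel x.1 y.1 ∧ A₂.Rel x.2 y.2 := by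
  constructor
  · rintro ⟨_, ⟨X₁, h₁, X₂, h₂, rfl⟩, hx, hy⟩
    exact ⟨⟨X₁, h₁, hx.1, hy.1⟩, ⟨X₂, h₂, hx.2, hy.2⟩⟩
  · rintro ⟨⟨X₁, h₁, hx₁, hy₁⟩, X₂, h₂, hx₂, hy₂⟩
    exact ⟨_, ⟨X₁, h₁, X₂, h₂, rfl⟩, ⟨hx₁, hx₂⟩, hy₁, hy₂⟩

theorem rank_eq_two {A : SchurRing G} {g : G} (hg : g ≠ 0)
    (h : ∀ x y, x ≠ 0 → y ≠ 0 → A.Rel x y) : A.rank = 2 := by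
  classical
  have hne : ∀ f ∈ A.toSubring, ∀ x, x ≠ 0 → f.coeff x = f.coeff g := fun f hf x hx =>
    mem_toSubring_iff.1 hf x g (h x g hx hg)
  let φ : A.toSubring →+ ℤ × ℤ :=
    { toFun := fun f => ((f : AddMonoidAlgebra ℤ G).coeff 0, (f : AddMonoidAlgebra ℤ G).coeff g)
      map_zero' := by simp
      map_add' := fun f f' => by simp }
  have hinj : Function.Injective φ := by
    rintro ⟨f, hf⟩ ⟨f', hf'⟩ hff'
    obtain ⟨h0, h1⟩ := Prod.ext_iff.1 hff'
    refine Subtype.ext (AddMonoidAlgebra.coeff_injective (Finsupp.ext fun x => ?_))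
    by_cases hx : x = 0
    · rw [hx]
      exact h0
    · change f.coeff x = f'.coeff x
      rw [hne f hf x hx, hne f' hf' x hx]
      exact h1
  have hsurj : Function.Surjective φ := by
    rintro ⟨a, b⟩
    have hu : groupRingSum Set.univ ∈ A.toSubring :=
      groupRingSum_mem (isASet_iff_rel.2 fun _ _ _ _ => Set.mem_univ _)
    have hz : groupRingSum {0} ∈ A.toSubring := groupRingSum_mem (isASet_iff_rel.2 fun x y h hx => by
      obtain rfl : x = 0 := hx
      exact rel_zero_left.1 h)
    refine ⟨⟨b • groupRingSum Set.univ + (a - b) • groupRingSum {0},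
      add_mem (zsmul_mem hu _) (zsmul_mem hz _)⟩, ?_⟩
    change ((b • groupRingSum Set.univ + (a - b) • groupRingSum ({0} : Set G) :
      AddMonoidAlgebra ℤ G).coeff 0, (b • groupRingSum Set.univ + (a - b) • groupRingSum ({0} : Set G) :
      AddMonoidAlgebra ℤ G).coeff g) = _
    simp only [AddMonoidAlgebra.coeff_add, AddMonoidAlgebra.coeff_smul, Finsupp.add_apply,
      Finsupp.smul_apply, coeff_groupRingSum]
    simp [hg]
  rw [rank, (AddEquiv.ofBijective φ ⟨hinj, hsurj⟩).toIntLinearEquiv.finrank_eq]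
  simp

end Group

section DirectSum

variable {R : Type u} [CommRing R] [Finite R] {A : SchurRing R} {I S : Ideal R}

/-- A Schur ring over `I ⊕ S` all of whose basic sets outside `I` are unions of sets
`a + (S \ {0})` is a tensor product. -/
theorem rel_add_iff (hI : A.IsAIdeal I) (hS : A.IsAIdeal S) (hIS : I ⊓ S = ⊥)
    (h : ∀ x y, x ∉ I → y ∉ I → x - y ∈ S → A.Rel x y) {a b s t : R} (ha : a ∈ I) (hb : b ∈ I)
    (hs : s ∈ S) (ht : t ∈ S) : A.Rel (a + s) (b + t) ↔ A.Rel a b ∧ A.Rel s t := by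
  have h0 : ∀ s ∈ S, s ∈ I → s = 0 := fun s hs hsI =>
    (Submodule.mem_bot R).1 (hIS ▸ (⟨hsI, hs⟩ : s ∈ I ⊓ S))
  have hne : ∀ a ∈ I, ∀ s ∈ S, s ≠ 0 → a + s ∉ I := fun a ha s hs hs0 hI' =>
    hs0 (h0 s hs ((I.add_mem_iff_right ha).1 hI'))
  have hst : ∀ a ∈ I, ∀ s ∈ S, ∀ t ∈ S, s ≠ 0 → t ≠ 0 → A.Rel (a + s) (a + t) :=
    fun a ha s hs t ht hs0 ht0 => h _ _ (hne a ha s hs hs0) (hne a ha t ht ht0)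
      (by rw [add_sub_add_left_eq_sub]; exact S.sub_mem hs ht)
  have hst' : ∀ s ∈ S, ∀ t ∈ S, s ≠ 0 → t ≠ 0 → A.Rel s t := fun s hs t ht hs0 ht0 => by
    simpa using hst 0 I.zero_mem s hs t ht hs0 ht0
  constructor
  · intro hrel
    constructor
    · obtain ⟨x, hx, s', hs', hxs⟩ := (((A.isASet_rel a).add hS).mem_iff hrel).1
        ⟨a, Rel.refl A a, s, hs, rfl⟩
      have hxI : x ∈ I := (hI.mem_iff hx).1 ha
      have hxs' : x + s' = b + t := hxs
      have : x - b = 0 := h0 _ (by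
        rw [show x - b = t - s' by linear_combination hxs']
        exact S.sub_mem ht hs') (I.sub_mem hxI hb)
      rw [← sub_eq_zero.1 this]
      exact hx
    · by_cases hs0 : s = 0
      · subst hs0
        have : b + t ∈ I := (hI.mem_iff hrel).1 (by rwa [add_zero])
        rw [h0 t ht ((I.add_mem_iff_right hb).1 this)]
        exact Rel.refl A 0
      · refine hst' s hs t ht hs0 ?_
        rintro rfl
        exact hne a ha s hs hs0 ((hI.mem_iff hrel).2 (by rwa [add_zero]))
  · rintro ⟨hab, hrel⟩
    by_cases hs0 : s = 0
    · subst hs0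
      rw [rel_zero_left.1 hrel, add_zero, add_zero]
      exact hab
    · have ht0 : t ≠ 0 := by
        rintro rfl
        exact hs0 (rel_zero_left.1 hrel.symm)
      -- The basic set of a + s plus S is an A-set containing a, hence b. So a + s is related to
      -- some y in b + S, which lies outside I and is therefore related to b + t.
      obtain ⟨y, hy, s', hs', hys⟩ := (((A.isASet_rel (a + s)).add hS).mem_iff hab).1
        ⟨a + s, Rel.refl A _, -s, S.neg_mem hs, by simp⟩
      have hys' : y + s' = b := hys
      have hy' : A.Rel (a + s) y := hy
      have hyb : y = b + -s' := by linear_combination hys'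
      have hs0' : -s' ≠ 0 := fun h' => by
        rw [hyb, h', add_zero] at hy'
        exact hne a ha s hs hs0 ((hI.mem_iff hy').2 hb)
      rw [hyb] at hy'
      exact hy'.trans (hst b hb _ (S.neg_mem hs') t ht hs0' ht0)

theorem isInternalTensor_of_rel (hI : A.IsAIdeal I) (hS : A.IsAIdeal S) (hIS : I ⊓ S = ⊥)
    (htop : I ⊔ S = ⊤) (h : ∀ x y, x ∉ I → y ∉ I → x - y ∈ S → A.Rel x y) :
    A.IsInternalTensor I S := by
  have hc : IsCompl I S := ⟨disjoint_iff.2 hIS, codisjoint_iff.2 htop⟩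
  refine ⟨hI, hS, hc, ext_rel fun x y => ?_⟩
  obtain ⟨⟨⟨a, ha⟩, s, hs⟩, rfl⟩ := (Submodule.prodEquivOfIsCompl I S hc).surjective x
  obtain ⟨⟨⟨b, hb⟩, t, ht⟩, rfl⟩ := (Submodule.prodEquivOfIsCompl I S hc).surjective y
  rw [rel_map, rel_tensor]
  have hsymm : ∀ z, (Submodule.prodEquivOfIsCompl I S hc).toAddEquiv.symm
      (Submodule.prodEquivOfIsCompl I S hc z) = z :=
    (Submodule.prodEquivOfIsCompl I S hc).symm_apply_apply
  rw [hsymm, hsymm]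
  refine (and_congr (rel_restrict A I.toAddSubgroup hI ⟨a, ha⟩ ⟨b, hb⟩)
    (rel_restrict A S.toAddSubgroup hS ⟨s, hs⟩ ⟨t, ht⟩)).trans ?_
  exact (rel_add_iff hI hS hIS h ha hb hs ht).symm

/-- The factors are realized as R/S and R/I, isomorphic to I and S respectively. Any two nonzero
classes modulo I lift to elements of S \ I, whose difference lies in S, hence the rank 2. -/
theorem hasRankTwoTensorFactor_of_rel (hA : A.IsOverRing) (hI : A.IsAIdeal I) (hS : A.IsAIdeal S)
    (hIS : I ⊓ S = ⊥) (htop : I ⊔ S = ⊤) (hI1 : I ≠ ⊤) (hf : ¬ IsField (R ⧸ I))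
    (h : ∀ x y, x ∉ I → y ∉ I → x - y ∈ S → A.Rel x y) : A.HasRankTwoTensorFactor := by
  have hdecomp : ∀ x : R, ∃ a ∈ I, ∃ s ∈ S, a + s = x := fun x =>
    Submodule.mem_sup.1 (htop ▸ Submodule.mem_top : x ∈ I ⊔ S)
  let f : R →+* (R ⧸ S) × (R ⧸ I) := (Ideal.Quotient.mk S).prod (Ideal.Quotient.mk I)
  have hf' : Function.Bijective f := by
    constructor
    · rw [injective_iff_map_eq_zero]
      intro x hx
      obtain ⟨h1, h2⟩ := Prod.ext_iff.1 hx
      exact (Submodule.mem_bot R).1 (hIS ▸ (⟨Ideal.Quotient.eq_zero_iff_mem.1 h2,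
        Ideal.Quotient.eq_zero_iff_mem.1 h1⟩ : x ∈ I ⊓ S))
    · rintro ⟨z, w⟩
      obtain ⟨x, rfl⟩ := Ideal.Quotient.mk_surjective z
      obtain ⟨y, rfl⟩ := Ideal.Quotient.mk_surjective w
      obtain ⟨a, ha, s, hs, rfl⟩ := hdecomp x
      obtain ⟨b, hb, t, ht, rfl⟩ := hdecomp y
      refine ⟨a + t, Prod.ext (Ideal.Quotient.eq.2 ?_) (Ideal.Quotient.eq.2 ?_)⟩
      · rw [add_sub_add_left_eq_sub]
        exact S.sub_mem ht hs
      · rw [add_sub_add_right_eq_sub]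
        exact I.sub_mem ha hb
  let e : R ≃+* (R ⧸ S) × (R ⧸ I) := RingEquiv.ofBijective f hf'
  obtain ⟨g, hg⟩ : ∃ g, g ∉ I := by
    by_contra! hn
    exact hI1 (eq_top_iff.2 fun x _ => hn x)
  refine ⟨R ⧸ S, R ⧸ I, inferInstance, inferInstance, inferInstance, inferInstance, e,
    A.quot S hS, A.quot I hI, hA.quot hS, hA.quot hI, ext_rel fun z w => ?_, ?_, hf⟩
  · obtain ⟨x, rfl⟩ := e.surjective z
    obtain ⟨y, rfl⟩ := e.surjective w
    rw [rel_map, rel_tensor]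
    have hsymm : ∀ z, e.toAddEquiv.symm (e z) = z := e.symm_apply_apply
    rw [hsymm, hsymm]
    change A.Rel x y ↔ (A.quot S hS).Rel (Ideal.Quotient.mk S x) (Ideal.Quotient.mk S y) ∧
      (A.quot I hI).Rel (Ideal.Quotient.mk I x) (Ideal.Quotient.mk I y)
    refine ⟨fun h => ⟨rel_quot_mk hS h, rel_quot_mk hI h⟩, fun ⟨h1, h2⟩ => ?_⟩
    obtain ⟨v, hv, h1⟩ := exists_rel_of_rel_quot hS h1
    obtain ⟨i, hi, h2⟩ := exists_rel_of_rel_quot hI h2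
    obtain ⟨a, ha, s, hs, rfl⟩ := hdecomp x
    obtain ⟨b, hb, t, ht, rfl⟩ := hdecomp y
    rw [add_assoc] at h1
    rw [add_right_comm] at h2
    exact (rel_add_iff hI hS hIS h ha hb hs ht).2
      ⟨((rel_add_iff hI hS hIS h ha hb hs (S.add_mem ht hv)).1 h1).1,
        ((rel_add_iff hI hS hIS h ha (I.add_mem hb hi) hs ht).1 h2).2⟩
  · refine rank_eq_two (g := Ideal.Quotient.mk I g)
      (fun h => hg (Ideal.Quotient.eq_zero_iff_mem.1 h)) fun z w hz hw => ?_
    have hlift : ∀ z : R ⧸ I, z ≠ 0 → ∃ s ∈ S, s ∉ I ∧ Ideal.Quotient.mk I s = z := by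
      intro z hz
      obtain ⟨x, rfl⟩ := Ideal.Quotient.mk_surjective z
      obtain ⟨a, ha, s, hs, rfl⟩ := hdecomp x
      have : Ideal.Quotient.mk I s = Ideal.Quotient.mk I (a + s) := by
        rw [map_add, Ideal.Quotient.eq_zero_iff_mem.2 ha, zero_add]
      refine ⟨s, hs, fun hsI => hz ?_, this⟩
      rw [← this, Ideal.Quotient.eq_zero_iff_mem.2 hsI]
    obtain ⟨s, hs, hsI, rfl⟩ := hlift z hz
    obtain ⟨t, ht, htI, rfl⟩ := hlift w hw
    exact rel_quot_mk hI (h s t hsI htI (S.sub_mem hs ht))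

end DirectSum

/-! ### The ideal I^⋆ and the conclusions. -/

section Star

variable {R : Type u} [CommRing R] [Finite R] {A : SchurRing R} {I : Ideal R}

theorem mem_quotientPrimes {p : ℕ} (hp : p.Prime) :
    p ∈ quotientPrimes I ↔ I ⊔ Ideal.span {(p : R)} ≠ ⊤ := by
  rw [quotientPrimes, Nat.mem_primeFactors]
  constructor
  · rintro ⟨-, h, -⟩ htop
    exact Ideal.not_dvd_index hp htop h
  · intro h
    refine ⟨hp, ?_, Nat.card_pos.ne'⟩
    by_contra hn
    have hc := (Nat.Prime.coprime_iff_not_dvd hp).2 hn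
    obtain ⟨a, b, hab⟩ := Nat.isCoprime_iff_coprime.2 hc
    have hab' := congrArg (Int.cast : ℤ → R) hab
    push_cast at hab'
    apply h
    have hm : ((Nat.card (R ⧸ I) : ℕ) : R) ∈ I := by
      rw [← Ideal.Quotient.eq_zero_iff_mem, map_natCast, ← nsmul_one]
      exact card_nsmul_eq_zero'
    rw [Ideal.eq_top_iff_one, ← hab', add_comm]
    exact Submodule.add_mem_sup (I.mul_mem_left _ hm)
      (Ideal.mul_mem_left _ _ (Ideal.mem_span_singleton_self _))

theorem exists_mem_quotientPrimes (hI : I ≠ ⊤) :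
    ∃ p : ℕ, p.Prime ∧ I ⊔ Ideal.span {(p : R)} ≠ ⊤ := by
  have := Ideal.Quotient.nontrivial_iff.2 hI
  obtain ⟨p, hp, h⟩ := Nat.exists_prime_and_dvd (n := Nat.card (R ⧸ I)) Finite.one_lt_card.ne'
  exact ⟨p, hp, (mem_quotientPrimes hp).1 (Nat.mem_primeFactors.2 ⟨hp, h, Nat.card_pos.ne'⟩)⟩

omit [Finite R] in
-- If p ∈ I, then R/I is a quotient of R/pR, which is zero or a field. This is how the assumption on
-- R/I enters `rel_of_sub_mem`.
theorem natCast_notMem_of_not_isField (hR : IsFieldModPrimes R) (hI : I ≠ ⊤)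
    (hf : ¬ IsField (R ⧸ I)) {p : ℕ} (hp : p.Prime) : (p : R) ∉ I := by
  intro h
  have := Ideal.Quotient.nontrivial_iff.2 hI
  refine hf ⟨exists_pair_ne _, mul_comm, fun {z} hz => ?_⟩
  obtain ⟨x, rfl⟩ := Ideal.Quotient.mk_surjective z
  rcases hR p hp x with ⟨y, rfl⟩ | ⟨y, c, hy⟩
  · exact absurd (Ideal.Quotient.eq_zero_iff_mem.2 (I.mul_mem_right _ h)) hz
  · refine ⟨Ideal.Quotient.mk I y, ?_⟩
    rw [← map_mul, hy, map_add, Ideal.Quotient.eq_zero_iff_mem.2 (I.mul_mem_right _ h), map_one,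
      add_zero]

omit [Finite R] in
theorem mem_pComponent {p : ℕ} {x : R} : x ∈ pComponent R p ↔ ∃ k : ℕ, p ^ k • x = 0 := Iff.rfl

theorem pIdem_mem_pComponent (p : ℕ) : pIdem R p ∈ pComponent R p := by
  obtain ⟨k, -, hk⟩ := exists_pIdem_eq R p
  refine mem_pComponent.2 ⟨k + 1, ?_⟩
  rw [nsmul_eq_mul, Nat.cast_pow, hk]

theorem pComponent_le_of_pIdem_mem {p : ℕ} {U : Ideal R} (h : pIdem R p ∈ U) :
    pComponent R p ≤ U := by
  intro x hx
  obtain ⟨k, hk⟩ := mem_pComponent.1 hx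
  rw [nsmul_eq_mul, Nat.cast_pow] at hk
  obtain ⟨c, hc⟩ := one_sub_pIdem (R := R) p
  have hpow : (1 - pIdem R p) ^ (k + 1) = 1 - pIdem R p :=
    IsIdempotentElem.pow_succ_eq k (IsIdempotentElem.one_sub (pIdem_mul_self p))
  have h2 : (1 - pIdem R p) * x = 0 := by
    rw [← hpow, hc, mul_pow, pow_succ]
    linear_combination (p * c ^ (k + 1)) * hk
  rw [show x = x * pIdem R p by linear_combination h2]
  exact U.mul_mem_left _ h

theorem isAIdeal_starIdeal (A : SchurRing R) (I : Ideal R) : A.IsAIdeal (A.starIdeal I) :=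
  A.isAIdeal_sInf _ fun _ h => h.1

theorem component_le_starIdeal (A : SchurRing R) (I : Ideal R) :
    component R (quotientPrimes I) ≤ A.starIdeal I := le_sInf fun _ h => h.2

theorem not_starIdeal_le (A : SchurRing R) (hI : I ≠ ⊤) : ¬ A.starIdeal I ≤ I := by
  intro h
  obtain ⟨p, hp, hpI⟩ := exists_mem_quotientPrimes hI
  refine Ideal.pIdem_notMem hpI (h (component_le_starIdeal A I ?_))
  have hle : pComponent R p ≤ component R (quotientPrimes I) :=
    le_iSup₂_of_le p ((mem_quotientPrimes hp).2 hpI) le_rfl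
  exact hle (pIdem_mem_pComponent p)

/-- Such a U satisfies I + U = R, so it contains the idempotents of all p ∈ Q. With
`not_starIdeal_le`, this makes I^⋆ the smallest A-ideal not contained in I. -/
theorem starIdeal_le (hR : IsFieldModPrimes R) (hI : I ∈ A.maximalAIdeals) {U : Ideal R}
    (hU : A.IsAIdeal U) (hUI : ¬ U ≤ I) : A.starIdeal I ≤ U := by
  refine sInf_le ⟨hU, iSup₂_le fun p hp => ?_⟩
  have hp' := Nat.prime_of_mem_primeFactors hp
  exact pComponent_le_of_pIdem_mem (Ideal.pIdem_mem_of_sup_eq_top hR hp'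
    (eq_top_of_maximal hI hU hUI) ((mem_quotientPrimes hp').1 hp))

/-- The intersections of the complement of `I` with the cosets of `I^⋆` lie in basic sets. -/
theorem rel_of_sub_mem_starIdeal (hA : A.IsOverRing) (hR : IsFieldModPrimes R)
    (hI : I ∈ A.maximalAIdeals) (hf : ¬ IsField (R ⧸ I)) (x y : R) (hx : x ∉ I) (hy : y ∉ I)
    (hxy : x - y ∈ A.starIdeal I) : A.Rel x y :=
  have hI1 := (mem_maximalAIdeals.1 hI).prop.2
  rel_of_sub_mem hA hR hI (fun _ hp _ => natCast_notMem_of_not_isField hR hI1 hf hp)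
    (isAIdeal_starIdeal A I) (not_starIdeal_le A hI1) (fun _ hU => starIdeal_le hR hI hU) hx hy hxy

theorem satisfiesCondition_of_rel {J : Ideal R} (hI : A.IsAIdeal I) (hJ : A.IsAIdeal J)
    (hJI : J ≤ I) (h : ∀ x, x ∉ I → ∀ v ∈ J, A.Rel x (x + v)) : A.SatisfiesCondition I J := by
  refine ⟨hI, hJ, fun X hX hXI => le_inf (le_sSup ?_) hJI⟩
  obtain ⟨x, rfl⟩ := mem_basicSets_iff.1 hX
  refine Set.Subset.antisymm ?_ fun y hy => ⟨y, hy, 0, J.zero_mem, add_zero y⟩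
  rintro _ ⟨y, hy, v, hv, rfl⟩
  exact Rel.trans hy (h y (hXI hy) v hv)

theorem isRationalSet_of_mem_basicSets (hA : A.IsOverRing) (hR : IsFieldModPrimes R)
    (hI : I ∈ A.maximalAIdeals) (hf : ¬ IsField (R ⧸ I)) {X : Set R} (hX : X ∈ A.basicSets)
    (hXI : X ⊆ (I : Set R)ᶜ) : IsRationalSet (quotientPrimes I) X := by
  obtain ⟨x, rfl⟩ := mem_basicSets_iff.1 hX
  refine Set.Subset.antisymm ?_ fun y hy => ⟨1, ?_, y, hy, one_smul _ y⟩
  · rintro _ ⟨u, hu, y, hy, rfl⟩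
    refine Rel.trans hy (rel_of_sub_mem_starIdeal hA hR hI hf _ _ (hXI hy) (fun h => hXI hy ?_) ?_)
    · have h1 := I.mul_mem_left ((u⁻¹ : Rˣ) : R) h
      change ((u⁻¹ : Rˣ) : R) * (u * y) ∈ I at h1
      rwa [← mul_assoc, Units.inv_mul, one_mul] at h1
    · have h1 : (u : R) - 1 ∈ A.starIdeal I := component_le_starIdeal A I hu
      change y - u * y ∈ _
      rw [show y - u * y = -y * (u - 1) by ring]
      exact Ideal.mul_mem_left _ _ h1
  · change ((1 : Rˣ) : R) - 1 ∈ component R (quotientPrimes I)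
    rw [Units.val_one, sub_self]
    exact zero_mem _

theorem satisfiesCondition_starIdeal (hA : A.IsOverRing) (hR : IsFieldModPrimes R)
    (hI : I ∈ A.maximalAIdeals) (hf : ¬ IsField (R ⧸ I)) :
    A.SatisfiesCondition I (I ⊓ A.starIdeal I) := by
  have hIA := isAIdeal_of_maximal hI
  refine satisfiesCondition_of_rel hIA (hIA.inf (isAIdeal_starIdeal A I)) inf_le_left
    fun x hx v hv => rel_of_sub_mem_starIdeal hA hR hI hf _ _ hx
      (fun h => hx ((I.add_mem_iff_left hv.1).1 h)) ?_
  rw [sub_add_cancel_left]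
  exact neg_mem hv.2

theorem exists_mem_maximalAIdeals_ge {W : Ideal R} (hW : A.IsAIdeal W) (h : W ≠ ⊤) :
    ∃ I ∈ A.maximalAIdeals, W ≤ I := by
  have hfin : {U : Ideal R | A.IsAIdeal U ∧ U ≠ ⊤ ∧ W ≤ U}.Finite := Set.toFinite _
  obtain ⟨I, ⟨hI, hI1, hWI⟩, hmax⟩ := hfin.exists_maximal ⟨W, hW, h, le_rfl⟩
  exact ⟨I, mem_maximalAIdeals.2 ⟨⟨hI, hI1⟩, fun U hU hIU => hmax ⟨hU.1, hU.2, hWI.trans hIU⟩ hIU⟩,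
    hWI⟩

theorem exists_prime_eq_span (hR : IsFieldModPrimes R) {M : Ideal R} (hM : M ≠ ⊤)
    (hmax : M.IsMaximal) : ∃ r : ℕ, r.Prime ∧ M = Ideal.span {(r : R)} := by
  obtain ⟨r, hr, hrM⟩ := exists_mem_quotientPrimes hM
  refine ⟨r, hr, le_antisymm (fun x hx => ?_) ?_⟩
  · rcases hR r hr x with ⟨y, hy⟩ | ⟨y, z, hy⟩
    · exact Ideal.mem_span_singleton.2 ⟨y, hy⟩
    · refine absurd ((Ideal.eq_top_iff_one _).2 ?_) hrM
      rw [show (1 : R) = x * y + r * -z by linear_combination -hy]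
      exact Submodule.add_mem_sup (M.mul_mem_right _ hx)
        (Ideal.mul_mem_right _ _ (Ideal.mem_span_singleton_self _))
  · exact le_sup_right.trans (hmax.eq_of_le hrM le_sup_left).ge

/-- If all maximal `A`-ideals are maximal ideals but not conversely, then `A` is a generalized wreath
product. -/
theorem isNontrivialGenWreath_of_isMaximal (hA : A.IsOverRing) (hR : IsFieldModPrimes R)
    (hmax : ∀ I ∈ A.maximalAIdeals, I.IsMaximal) {M : Ideal R} (hM : M.IsMaximal)
    (hMA : M ∉ A.maximalAIdeals) : A.IsNontrivialGenWreath := by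
  obtain ⟨r, hr, rfl⟩ := exists_prime_eq_span hR hM.ne_top hM
  have hfin : {U : Ideal R | A.IsAIdeal U ∧ U ≤ Ideal.span {(r : R)}}.Finite := Set.toFinite _
  -- W is chosen largest among the A-ideals inside rR and I above W. If I^⋆ were in rR, it would be
  -- contained in W, hence in I.
  obtain ⟨W, ⟨hW, hWM⟩, hWmax⟩ := hfin.exists_maximal ⟨⊥, isAIdeal_bot, bot_le⟩
  obtain ⟨I, hI, hWI⟩ := exists_mem_maximalAIdeals_ge hW fun h => hM.ne_top (top_le_iff.1 (h ▸ hWM))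
  have hIA := isAIdeal_of_maximal hI
  have hI1 := (mem_maximalAIdeals.1 hI).prop.2
  have hrI : I ⊔ Ideal.span {(r : R)} = ⊤ :=
    Ideal.IsMaximal.coprime_of_ne (hmax I hI) hM fun h => hMA (h ▸ hI)
  have hS := isAIdeal_starIdeal A I
  have hSM : ¬ A.starIdeal I ≤ Ideal.span {(r : R)} := fun h =>
    not_starIdeal_le A hI1 ((le_sup_right.trans
      (hWmax (y := W ⊔ A.starIdeal I) ⟨hW.sup hS, sup_le hWM h⟩ le_sup_left)).trans hWI)
  obtain ⟨x, hxS, hxM⟩ := SetLike.not_le_iff_exists.1 hSM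
  have hx : pIdem R r * x ≠ 0 := fun h => hxM (by
    obtain ⟨c, hc⟩ := one_sub_pIdem (R := R) r
    rw [show x = r * (c * x) by linear_combination h + x * hc]
    exact Ideal.mul_mem_right _ _ (Ideal.mem_span_singleton_self _))
  obtain ⟨s, hs, hs'⟩ := exists_pow_mul_torsion hx
  set e := (r : R) ^ s * (pIdem R r * x)
  -- An element of I^⋆ outside rR has a nonzero r-part, hence a nonzero multiple e killed by r. As r
  -- is invertible modulo I, e also lies in I.
  have he : (r : R) * e = 0 := by rw [← hs', pow_succ']; simp only [e]; ring
  have heS : e ∈ A.starIdeal I := Ideal.mul_mem_left _ _ (Ideal.mul_mem_left _ _ hxS)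
  have heI : e ∈ I := Ideal.mem_of_natCast_mul_mem hrI (he ▸ I.zero_mem)
  let V : Ideal R := sInf {U | A.IsAIdeal U ∧ e ∈ U}
  have hV : A.IsAIdeal V := A.isAIdeal_sInf _ fun _ h => h.1
  have heV : e ∈ V := Submodule.mem_sInf.2 fun _ h => h.2
  have hVle : ∀ U : Ideal R, A.IsAIdeal U → e ∈ U → V ≤ U := fun U hU h => sInf_le ⟨hU, h⟩
  refine ⟨I, V, satisfiesCondition_of_rel hIA hV (hVle I hIA heI) fun y hy v hv =>
    rel_add_of_torsion hA hR hIA hr hrI he hs (fun U hU hUI => starIdeal_le hR hI hU hUI heS)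
      hVle hy hv, hI1, fun h => hs ?_⟩
  rw [h] at heV
  exact (Submodule.mem_bot R).1 heV

end Star
end SchurRing

end

theorem mainTheorem5 (R : Type u) [CommRing R] [Finite R] (hR : IsCGRing R)
    (A : SchurRing R) (hA : A.IsOverRing) :
    (∀ I ∈ A.maximalAIdeals, ¬ IsField (R ⧸ I) →
      ∀ X ∈ A.basicSets, X ⊆ (I : Set R)ᶜ → IsRationalSet (SchurRing.quotientPrimes I) X) ∧
    (∀ I ∈ A.maximalAIdeals, ¬ IsField (R ⧸ I) →
      A.SatisfiesCondition I (I ⊓ A.starIdeal I) ∧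
      (I ⊓ A.starIdeal I = ⊥ → A.IsInternalTensor I (A.starIdeal I))) ∧
    (A.maximalAIdeals ≠ {I : Ideal R | I.IsMaximal} →
      A.IsNontrivialGenWreath ∨ A.HasRankTwoTensorFactor) := by
  have hR' := hR.isFieldModPrimes
  have htop : ∀ I ∈ A.maximalAIdeals, I ⊔ A.starIdeal I = ⊤ := fun I hI =>
    SchurRing.eq_top_of_maximal hI (SchurRing.isAIdeal_starIdeal A I)
      (SchurRing.not_starIdeal_le A (SchurRing.mem_maximalAIdeals.1 hI).prop.2)
  refine ⟨fun I hI hf X hX hXI => SchurRing.isRationalSet_of_mem_basicSets hA hR' hI hf hX hXI,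
    fun I hI hf => ⟨SchurRing.satisfiesCondition_starIdeal hA hR' hI hf, fun hJ =>
      SchurRing.isInternalTensor_of_rel (SchurRing.isAIdeal_of_maximal hI)
        (SchurRing.isAIdeal_starIdeal A I) hJ (htop I hI)
        (SchurRing.rel_of_sub_mem_starIdeal hA hR' hI hf)⟩, fun hne => ?_⟩
  by_cases hall : ∀ I ∈ A.maximalAIdeals, IsField (R ⧸ I)
  · left
    have hmax : ∀ I ∈ A.maximalAIdeals, I.IsMaximal := fun I hI =>
      Ideal.Quotient.maximal_of_isField I (hall I hI)
    obtain ⟨M, hM, hMA⟩ : ∃ M : Ideal R, M.IsMaximal ∧ M ∉ A.maximalAIdeals := by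
      by_contra! hn
      exact hne (Set.Subset.antisymm hmax hn)
    exact SchurRing.isNontrivialGenWreath_of_isMaximal hA hR' hmax hM hMA
  · push Not at hall
    obtain ⟨I, hI, hf⟩ := hall
    by_cases hJ : I ⊓ A.starIdeal I = ⊥
    · exact Or.inr (SchurRing.hasRankTwoTensorFactor_of_rel hA (SchurRing.isAIdeal_of_maximal hI)
        (SchurRing.isAIdeal_starIdeal A I) hJ (htop I hI)
        (SchurRing.mem_maximalAIdeals.1 hI).prop.2 hf
        (SchurRing.rel_of_sub_mem_starIdeal hA hR' hI hf))
    · exact Or.inl ⟨I, _, SchurRing.satisfiesCondition_starIdeal hA hR' hI hf,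
        (SchurRing.mem_maximalAIdeals.1 hI).prop.2, hJ⟩
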